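/- **Fuzzy graphs.** A finite fuzzy graph $G=\langle V,E,L,\Sigma_V,\Sigma_E\rangle$ consists of a finite non-empty set $V$ of vertices, finite sets $\Sigma_V,\Sigma_E$ of vertex and edge labels, and functions $E:V\times\Sigma_E\times V\to[0,1]$ and $L:V\to(\Sigma_V\to[0,1])$. Write $x{\uparrow}_r=\{y\in V\mid E(x,r,y)>0\}$. A non-empty relation $Z\subseteq V\times V$ is an *s-bisimulation* of $G$ if, whenever $Z(x,x')$ holds, $L(x)=L(x')$ and, for every $r\in\Sigma_E$, there is a bijection $h:x{\uparrow}_r\to x'{\uparrow}_r$ with $Z(y,h(y))$ and $E(x,r,y)=E(x',r,h(y))$ for all $y\in x{\uparrow}_r$. **Objects of the algorithm.** An *edge* object exists for each $(x,r,y)$ with $E(x,r,y)>0$; it has label $r$, origin $x$, destination $y$, degree $E(x,r,y)$ and a reference *blockEdge*. A *vertex* $x$ has a reference *block*, a list *comingEdges* of the edges with destination $x$, and a flag *processed* (initially false). A *block-edge* is a finite map from $[0,1]$ to $\mathbb N$ with references *departingBlockEdge* and *sourceBlockEdge* (initially null unless specified); pushKey$(d)$ increases the value of the key $d$ by 1 (adding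 it with value 1 if absent), popKey$(d)$ decreases it by 1 (deleting the key when the value becomes 0); two block-edges are equal if their maps are. A *block* has a list *vertices*, a map *superBlocks* from $\Sigma_E$ to super-blocks, and a finite map *departingBlocks* from block-edges to lists of vertices (initially empty). A *super-block* has a list *blocks* and belongs to a super-partition; it is compound if it has more than one block. A *super-partition* consists of the list of its compound super-blocks and the list of its other super-blocks (these lists are kept up to date when blocks are added to or removed from a super-block). The global variables are a list $\mathbb P$ of blocks and super-partitions $\mathbb Q[r]$, $r\in\Sigma_E$. Creating a block with given lists of vertices and given map superBlocks adds it to $\mathbb P$, makes it the block of its vertices, and adds it to superBlocks$[r]$ for each $r$. **s-Initialize$(G)$.** Create the vertices and edges, the empty list $\mathbb P$, for each $r$ the super-partition $\mathbb Q[r]$ with one super-block $msb[r]$ without blocks, and for each $(x,r)$ a block-edge $b_{x,r}$ with empty map. For each edge $e$ with origin $x$, label $r$, degree $d$: set $e.$blockEdge $:=b_{x,r}$ and call $b_{x,r}.$pushKey$(d)$. Divide the vertices into lists such that $x,x'$ are in the same list iff $L(x)=L(x')$ and $b_{x,r}$, $b_{x',r}$ are equal for all $r$; create from each list a block with superBlocks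 $=msb$. **s-Split$(Y',Y,r)$.** Let $Y'$ be a block in the super-block $Y$ of $\mathbb Q[r]$. Fix a vector $\vec y$ of the vertices of $Y'$; "for each $e$" means: for each $y$ in $\vec y$ and each $e\in y.$comingEdges with label $r$. 1. (ComputeBlockEdges) For each $e$: let $bE=e.$blockEdge; if $bE.$departingBlockEdge is null, set it to a new block-edge with empty map and sourceBlockEdge $bE$; call $bE.$popKey and $bE.$departingBlockEdge.pushKey with the degree of $e$. 2. (s-ComputeSubblocks) For each $e$, with $x$ its origin and $bx=x.$block: if $x$ is not processed, move $x$ from $bx.$vertices to the list $bx.$departingBlocks$[e.\text{blockEdge}]$ (created empty if the key is absent), and mark $x$ as processed. 3. (s-DoSplitting) Remove $Y'$ from $Y$; create a new super-block of the same super-partition, consisting of $Y'$, and let $Y'.$superBlocks$[r]$ be it. For each $e$, with $bx$ the block of its origin: set $e.$blockEdge $:=e.$blockEdge.departingBlockEdge; if $bx.$departingBlocks is non-empty, then: if $bx.$vertices is empty, let it be the list at the first key of $bx.$departingBlocks and remove this key; create from each of the remaining lists in $bx.$departingBlocks a new block with superBlocks $=bx.$superBlocks; empty $bx.$departingBlocks.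 4. (ClearAuxiliaryInfo) For each $e$: set the flag processed of its origin to false; let $bE=e.$blockEdge; if $sbE=bE.$sourceBlockEdge is not null, set $sbE.$departingBlockEdge and $bE.$sourceBlockEdge to null. **s-CompCB2$(G)$.** Call s-Initialize$(G)$. If $\mathbb P$ has exactly one block, return $\mathbb P$. Otherwise set $changed:=true$ and, while $changed$ holds: set $changed:=false$; for each $r\in\Sigma_E$, while $\mathbb Q[r]$ has a compound super-block, let $Y$ be the first one, let $Y'$ be the smaller one of the first two blocks of $Y$ (any of them if their sizes are equal), call s-Split$(Y',Y,r)$ and set $changed:=true$. Finally return $\mathbb P$. **Theorem.** Let $G$ be a finite fuzzy graph (with non-empty $V$). Then $G$ has a largest s-bisimulation, it is an equivalence relation, and, whichever way the choices left open above are resolved (orders of enumeration, the places at which elements are put into lists, ties), the algorithm s-CompCB2 terminates on $G$ without a run-time error (no null reference is followed, no absent key is looked up or popped, no absent element is removed) and returns the partition of $V$ into the equivalence classes of the largest s-bisimulation of $G$: each class is listed as exactly one block, by a list of its vertices without repetitions. -/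

import Mathlib

/-! ### Fuzzy graphs and bisimulations with counting successors -/

/-- A fuzzy labelled graph with vertices `V`, vertex labels `S` and edge labels `R`. -/
structure FuzzyGraph (V S R : Type) where
  /-- `E x r y` is the degree of the edge from `x` to `y` labelled by `r`. -/
  E : V → R → V → unitInterval
  /-- `L x p` is the degree to which `p` belongs to the label of `x`. -/
  L : V → S → unitInterval

namespace FuzzyGraph

/-- The `r`-successors of `x`. -/
def succs {V S R : Type} (G : FuzzyGraph V S R) (x : V) (r : R) : Set V := {y | 0 < G.E x r y}

/-- Crisp auto-bisimulations with counting successors. -/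
structure IsSBisimulation {V S R : Type} (G : FuzzyGraph V S R) (Z : V → V → Prop) : Prop where
  nonempty : ∃ x x', Z x x'
  label_eq : ∀ x x', Z x x' → G.L x = G.L x'
  succs_equiv : ∀ x x' r, Z x x' → ∃ h : G.succs x r ≃ G.succs x' r,
    ∀ y : G.succs x r, Z y (h y) ∧ G.E x r y = G.E x' r (h y)

/-- `Z` is the largest s-bisimulation of `G`. -/
def IsLargestSBisimulation {V S R : Type} (G : FuzzyGraph V S R) (Z : V → V → Prop) : Prop :=
  G.IsSBisimulation Z ∧ ∀ Z', G.IsSBisimulation Z' → ∀ x x', Z' x x' → Z x x'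

end FuzzyGraph

/-- The list of lists `out` lists the blocks of `𝒬`: every block is listed exactly once, and by a
list that has no repetitions. -/
def ListsPartition {V : Type} (out : List (List V)) (𝒬 : Set (Set V)) : Prop :=
  (∀ X ∈ out, X.Nodup) ∧
  (out.map fun X => {x | x ∈ X}).Nodup ∧
  {B : Set V | ∃ X ∈ out, B = {x | x ∈ X}} = 𝒬

namespace SCompCB

/-! ### Objects and the store

Objects of the classes `BlockEdge`, `Block` and `SuperBlock` are referred to by natural numbers.
A vertex object is referred to by the vertex, an edge object by the triple consisting of its origin,
its label and its destination, and the super-partition `ℚ[r]` by `r`. Attributes that are references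
have a type `Option _`, where `none` is the null reference. Linked lists are represented by `List`,
finite maps by `Finmap`. -/

/-- The map of a block-edge: a finite map from degrees to natural numbers. -/
abbrev DegreeMap : Type := Finmap (fun _ : unitInterval => ℕ)

structure BlockEdge where
  map : DegreeMap
  departingBlockEdge : Option ℕ
  sourceBlockEdge : Option ℕ

/-- The reference of an edge object: origin, label, destination. -/
abbrev EdgeRef (V R : Type) : Type := V × R × V

def EdgeRef.origin {V R : Type} (e : EdgeRef V R) : V := e.1
def EdgeRef.label {V R : Type} (e : EdgeRef V R) : R := e.2.1
def EdgeRef.dest {V R : Type} (e : EdgeRef V R) : V := e.2.2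

structure Edge where
  degree : unitInterval
  blockEdge : Option ℕ

/-- The keys of `departingBlocks` are block-edges. Two block-edges count as equal iff their maps are
equal, so a key is represented by its map. -/
structure Block (V R : Type) where
  vertices : List V
  superBlocks : R → Option ℕ
  departingBlocks : Finmap (fun _ : DegreeMap => List V)

structure SuperBlock (R : Type) where
  blocks : List ℕ
  superPartition : R

structure SuperPartition where
  compoundSuperBlocks : List ℕ
  simpleSuperBlocks : List ℕ

/-- The memory. `fresh` is the next unused reference, `P` and `Q` are the global variables of the
algorithm. `choices` resolves everything that the algorithm leaves open (the order in which the
elements of a set are enumerated, the place at which an element is put into a list, ties): whenever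
such a choice comes up, the first number of the sequence is consumed. -/
structure Store (V R : Type) where
  vertexBlock : V → Option ℕ
  comingEdges : V → List (EdgeRef V R)
  processed : V → Bool
  edge : EdgeRef V R → Option Edge
  blockEdge : ℕ → Option BlockEdge
  block : ℕ → Option (Block V R)
  superBlock : ℕ → Option (SuperBlock R)
  fresh : ℕ
  P : List ℕ
  Q : R → Option SuperPartition
  choices : ℕ → ℕ

/-- The memory before the algorithm starts. -/
def Store.initial (V R : Type) (choices : ℕ → ℕ) : Store V R where
  vertexBlock := fun _ => none
  comingEdges := fun _ => []
  processed := fun _ => false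
  edge := fun _ => none
  blockEdge := fun _ => none
  block := fun _ => none
  superBlock := fun _ => none
  fresh := 0
  P := []
  Q := fun _ => none
  choices := choices

/-- Programs that work on the memory and may fail (dereferencing a null reference, looking up a key
that is absent, removing an element that is not there, and so on). -/
abbrev Prog (V R : Type) : Type → Type := StateT (Store V R) Option

/-! ### Basic operations -/

def deref {V R : Type} {α : Type} : Option α → Prog V R α
  | some a => pure a
  | none => failure

/-- An arbitrary number below `n + 1`. -/
def chooseUpTo {V R : Type} (n : ℕ) : Prog V R ℕ := do
  let k := (← get).choices 0
  modify fun s => { s with choices := fun i => s.choices (i + 1) }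
  pure (k % (n + 1))

/-- Put `a` somewhere into the list `l`. -/
def add {V R : Type} {α : Type} (a : α) (l : List α) : Prog V R (List α) := do
  let k ← chooseUpTo l.length
  pure (l.insertIdx k a)

/-- Remove `a` from the list `l`. -/
def remove {V R : Type} {α : Type} [DecidableEq α] (a : α) (l : List α) : Prog V R (List α) :=
  if a ∈ l then pure (l.erase a) else failure

/-- The elements of a finite set, in an arbitrary order. -/
noncomputable def inAnyOrder {V R : Type} {α : Type} (A : Finset α) : Prog V R (List α) :=
  A.toList.foldlM (fun l a => add a l) []

def newRef {V R : Type} : Prog V R ℕ := do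
  let i := (← get).fresh
  modify fun s => { s with fresh := s.fresh + 1 }
  pure i

/-- The loop "while `cond` do `body`", where `b` is the value of a local variable. The first argument
bounds the number of evaluations of the condition; the program fails if the bound is exceeded. -/
def whileLoop {V R : Type} {β : Type} : ℕ → (β → Prog V R Bool) → (β → Prog V R β) → β → Prog V R β
  | 0, _, _, _ => failure
  | n + 1, cond, body, b => do
    if ← cond b then
      let b' ← body b
      whileLoop n cond body b'
    else
      pure b

def getBlockEdge {V R : Type} (i : ℕ) : Prog V R BlockEdge := do deref ((← get).blockEdge i)

def setBlockEdge {V R : Type} (i : ℕ) (bE : BlockEdge) : Prog V R Unit :=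
  modify fun s => { s with blockEdge := Function.update s.blockEdge i (some bE) }

def getBlock {V R : Type} (b : ℕ) : Prog V R (Block V R) := do deref ((← get).block b)

def setBlock {V R : Type} (b : ℕ) (B : Block V R) : Prog V R Unit :=
  modify fun s => { s with block := Function.update s.block b (some B) }

def getSuperBlock {V R : Type} (i : ℕ) : Prog V R (SuperBlock R) := do deref ((← get).superBlock i)

def setSuperBlock {V R : Type} (i : ℕ) (Y : SuperBlock R) : Prog V R Unit :=
  modify fun s => { s with superBlock := Function.update s.superBlock i (some Y) }

/-- The block of `P` that contains the vertex `x`. -/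
def getVertexBlock {V R : Type} (x : V) : Prog V R ℕ := do deref ((← get).vertexBlock x)

def setVertexBlock {V R : Type} [DecidableEq V] (x : V) (b : ℕ) : Prog V R Unit :=
  modify fun s => { s with vertexBlock := Function.update s.vertexBlock x (some b) }

def setProcessed {V R : Type} [DecidableEq V] (x : V) (p : Bool) : Prog V R Unit :=
  modify fun s => { s with processed := Function.update s.processed x p }

def getEdge {V R : Type} (e : EdgeRef V R) : Prog V R Edge := do deref ((← get).edge e)

def setEdge {V R : Type} [DecidableEq V] [DecidableEq R] (e : EdgeRef V R) (a : Edge) : Prog V R Unit :=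
  modify fun s => { s with edge := Function.update s.edge e (some a) }

def getSuperPartition {V R : Type} (r : R) : Prog V R SuperPartition := do deref ((← get).Q r)

def setSuperPartition {V R : Type} [DecidableEq R] (r : R) (Q : SuperPartition) : Prog V R Unit :=
  modify fun s => { s with Q := Function.update s.Q r (some Q) }

/-! ### Methods of the classes -/

namespace BlockEdge

/-- The constructor; its parameter is the source block-edge (`none` in the default constructor). -/
def new {V R : Type} (source : Option ℕ) : Prog V R ℕ := do
  let i ← newRef
  setBlockEdge i { map := ∅, departingBlockEdge := none, sourceBlockEdge := source }
  pure i

noncomputable def pushKey {V R : Type} (i : ℕ) (d : unitInterval) : Prog V R Unit := do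
  let bE ← getBlockEdge i
  match bE.map.lookup d with
  | none => setBlockEdge i { bE with map := bE.map.insert d 1 }
  | some k => setBlockEdge i { bE with map := bE.map.insert d (k + 1) }

noncomputable def popKey {V R : Type} (i : ℕ) (d : unitInterval) : Prog V R Unit := do
  let bE ← getBlockEdge i
  match bE.map.lookup d with
  | none => failure
  | some k =>
    if k - 1 = 0 then setBlockEdge i { bE with map := bE.map.erase d }
    else setBlockEdge i { bE with map := bE.map.insert d (k - 1) }

end BlockEdge

namespace Edge

/-- The constructor: the edge is added to the list of the edges coming to its destination. -/
def new {V R : Type} [DecidableEq V] [DecidableEq R] (r : R) (x y : V) (d : unitInterval)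
    (bE : Option ℕ) : Prog V R Unit := do
  setEdge (x, r, y) { degree := d, blockEdge := bE }
  let es ← add (x, r, y) ((← get).comingEdges y)
  modify fun s => { s with comingEdges := Function.update s.comingEdges y es }

end Edge

namespace SuperPartition

/-- The constructor of the super-partition `ℚ[r]`. -/
def new {V R : Type} [DecidableEq R] (r : R) : Prog V R Unit :=
  setSuperPartition r { compoundSuperBlocks := [], simpleSuperBlocks := [] }

def addSuperBlock {V R : Type} [DecidableEq R] (r : R) (i : ℕ) : Prog V R Unit := do
  let Y ← getSuperBlock i
  let Q ← getSuperPartition r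
  if Y.blocks.length > 1 then
    setSuperPartition r { Q with compoundSuperBlocks := ← add i Q.compoundSuperBlocks }
  else
    setSuperPartition r { Q with simpleSuperBlocks := ← add i Q.simpleSuperBlocks }

end SuperPartition

namespace SuperBlock

/-- The constructor of a super-block of `ℚ[r]`. -/
def new {V R : Type} [DecidableEq R] (r : R) : Prog V R ℕ := do
  let i ← newRef
  setSuperBlock i { blocks := [], superPartition := r }
  SuperPartition.addSuperBlock r i
  pure i

/-- One of the first two blocks of a compound super-block: the smaller one, or any of the two if
they have the same size. -/
def smallerBlock {V R : Type} (i : ℕ) : Prog V R ℕ := do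
  match (← getSuperBlock i).blocks with
  | b₁ :: b₂ :: _ =>
    let n₁ := (← getBlock b₁).vertices.length
    let n₂ := (← getBlock b₂).vertices.length
    if n₁ < n₂ then pure b₁
    else if n₂ < n₁ then pure b₂
    else
      let k ← chooseUpTo 1
      if k = 0 then pure b₁ else pure b₂
  | _ => failure

def addBlock {V R : Type} [DecidableEq R] (i b : ℕ) : Prog V R Unit := do
  let Y ← getSuperBlock i
  let bs ← add b Y.blocks
  setSuperBlock i { Y with blocks := bs }
  if bs.length = 2 then
    let Q ← getSuperPartition Y.superPartition
    let simple ← remove i Q.simpleSuperBlocks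
    let compound ← add i Q.compoundSuperBlocks
    setSuperPartition Y.superPartition
      { compoundSuperBlocks := compound, simpleSuperBlocks := simple }

def removeBlock {V R : Type} [DecidableEq R] (i b : ℕ) : Prog V R Unit := do
  let Y ← getSuperBlock i
  let bs ← remove b Y.blocks
  setSuperBlock i { Y with blocks := bs }
  if bs.length = 1 then
    let Q ← getSuperPartition Y.superPartition
    let compound ← remove i Q.compoundSuperBlocks
    let simple ← add i Q.simpleSuperBlocks
    setSuperPartition Y.superPartition
      { compoundSuperBlocks := compound, simpleSuperBlocks := simple }

/-- A new super-block of the super-partition `sp` that consists of the block `b`. -/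
def create {V R : Type} [DecidableEq R] (sp : R) (b : ℕ) (r : R) : Prog V R Unit := do
  let sb ← new sp
  addBlock sb b
  let B ← getBlock b
  setBlock b { B with superBlocks := Function.update B.superBlocks r (some sb) }

end SuperBlock

namespace Block

/-- The constructor: the block is added to `P`, it becomes the block of its vertices, and for every
edge label `r` it is added to the super-block `superBlocks' r`. -/
noncomputable def new {V R : Type} [Fintype R] [DecidableEq V] [DecidableEq R]
    (vertices' : List V) (superBlocks' : R → Option ℕ) : Prog V R Unit := do
  let b ← newRef
  setBlock b { vertices := vertices', superBlocks := fun _ => none, departingBlocks := ∅ }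
  let P ← add b (← get).P
  modify fun s => { s with P := P }
  for x in vertices' do
    setVertexBlock x b
  for r in ← inAnyOrder (Finset.univ : Finset R) do
    let sb ← deref (superBlocks' r)
    let B ← getBlock b
    setBlock b { B with superBlocks := Function.update B.superBlocks r (some sb) }
    SuperBlock.addBlock sb b

noncomputable def create {V R : Type} [Fintype R] [DecidableEq V] [DecidableEq R]
    (vl : List V) : Prog V R Unit := do
  let x ← deref vl.head?
  let bx ← getVertexBlock x
  new vl (← getBlock bx).superBlocks

end Block

/-! ### The procedures -/

/-- Put the vertex `x` into the list of the vertices that are equivalent to it with respect to `eqv`,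
or into a new list if there is none yet. -/
def insertIntoClass {V R : Type} (eqv : V → V → Prop) [DecidableRel eqv] (x : V) :
    List (List V) → Prog V R (List (List V))
  | [] => pure [[x]]
  | X :: 𝕏 => do
    if X.any (fun x' => decide (eqv x x')) then
      let X' ← add x X
      pure (X' :: 𝕏)
    else
      let 𝕏' ← insertIntoClass eqv x 𝕏
      pure (X :: 𝕏')

open Classical in
/-- The procedure s-Initialize. -/
noncomputable def sInitialize {V S R : Type} [Fintype V] [Fintype R] [DecidableEq V]
    [DecidableEq R] (G : FuzzyGraph V S R) : Prog V R Unit := do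
  let vertices ← inAnyOrder (Finset.univ : Finset V)
  let edges ← inAnyOrder
    ((Finset.univ : Finset (EdgeRef V R)).filter fun e => 0 < G.E e.origin e.label e.dest)
  for e in edges do
    Edge.new e.label e.origin e.dest (G.E e.origin e.label e.dest) none
  modify fun s => { s with P := [] }
  modify fun s => { s with Q := fun _ => none }
  let mut msb : R → Option ℕ := fun _ => none
  for r in ← inAnyOrder (Finset.univ : Finset R) do
    SuperPartition.new r
    let sb ← SuperBlock.new r
    msb := Function.update msb r (some sb)
  let mut blockEdges : V × R → Option ℕ := fun _ => none
  for xr in ← inAnyOrder (Finset.univ : Finset (V × R)) do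
    let i ← BlockEdge.new none
    blockEdges := Function.update blockEdges xr (some i)
  for e in edges do
    let i ← deref (blockEdges (e.origin, e.label))
    let a ← getEdge e
    setEdge e { a with blockEdge := some i }
    BlockEdge.pushKey i a.degree
  let s ← get
  let mapOf : V → R → Option DegreeMap := fun x r =>
    (blockEdges (x, r)).bind fun i => (s.blockEdge i).map BlockEdge.map
  let mut 𝕏 : List (List V) := []
  for x in vertices do
    𝕏 ← insertIntoClass (fun x x' => G.L x = G.L x' ∧ ∀ r, mapOf x r = mapOf x' r) x 𝕏
  for X in ← 𝕏.foldlM (fun l X => add X l) [] do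
    Block.new X msb

/-- The procedure ComputeBlockEdges; `ys` is the vector of the vertices of the block `Y'`. -/
noncomputable def computeBlockEdges {V R : Type} [DecidableEq V] [DecidableEq R] (ys : List V) (r : R) :
    Prog V R Unit := do
  for y in ys do
    for e in (← get).comingEdges y do
      if e.label = r then
        let a ← getEdge e
        let i ← deref a.blockEdge
        let bE ← getBlockEdge i
        if bE.departingBlockEdge = none then
          let j ← BlockEdge.new (some i)
          setBlockEdge i { bE with departingBlockEdge := some j }
        let j ← deref (← getBlockEdge i).departingBlockEdge
        BlockEdge.popKey i a.degree
        BlockEdge.pushKey j a.degree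

/-- The procedure s-ComputeSubblocks. -/
noncomputable def sComputeSubblocks {V R : Type} [DecidableEq V] [DecidableEq R] (ys : List V) (r : R) :
    Prog V R Unit := do
  for y in ys do
    for e in (← get).comingEdges y do
      if e.label = r then
        let x := e.origin
        let bx ← getVertexBlock x
        if (← get).processed x = false then
          let i ← deref (← getEdge e).blockEdge
          let key := (← getBlockEdge i).map
          let B ← getBlock bx
          if key ∉ B.departingBlocks then
            setBlock bx { B with departingBlocks := B.departingBlocks.insert key [] }
          let B ← getBlock bx
          let rest ← remove x B.vertices
          let moved ← add x (← deref (B.departingBlocks.lookup key))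
          setBlock bx
            { B with vertices := rest, departingBlocks := B.departingBlocks.insert key moved }
          setProcessed x true

/-- The procedure s-DoSplitting; `Y'` is a block and `Y` a super-block. -/
noncomputable def sDoSplitting {V R : Type} [Fintype R] [DecidableEq V] [DecidableEq R]
    (Y' : ℕ) (ys : List V) (Y : ℕ) (r : R) : Prog V R Unit := do
  SuperBlock.removeBlock Y Y'
  SuperBlock.create (← getSuperBlock Y).superPartition Y' r
  for y in ys do
    for e in (← get).comingEdges y do
      if e.label = r then
        let a ← getEdge e
        let bE ← getBlockEdge (← deref a.blockEdge)
        setEdge e { a with blockEdge := bE.departingBlockEdge }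
        let bx ← getVertexBlock e.origin
        let B ← getBlock bx
        if B.departingBlocks.keys ≠ ∅ then
          if B.vertices = [] then
            let key ← deref (← inAnyOrder B.departingBlocks.keys).head?
            let vl ← deref (B.departingBlocks.lookup key)
            setBlock bx
              { B with vertices := vl, departingBlocks := B.departingBlocks.erase key }
          let B ← getBlock bx
          for key in ← inAnyOrder B.departingBlocks.keys do
            Block.create (← deref (B.departingBlocks.lookup key))
          let B ← getBlock bx
          setBlock bx { B with departingBlocks := ∅ }

/-- The procedure ClearAuxiliaryInfo. -/
def clearAuxiliaryInfo {V R : Type} [DecidableEq V] [DecidableEq R] (ys : List V) (r : R) :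
    Prog V R Unit := do
  for y in ys do
    for e in (← get).comingEdges y do
      if e.label = r then
        setProcessed e.origin false
        let i ← deref (← getEdge e).blockEdge
        let bE ← getBlockEdge i
        match bE.sourceBlockEdge with
        | none => pure ()
        | some j =>
          let sbE ← getBlockEdge j
          setBlockEdge j { sbE with departingBlockEdge := none }
          let bE ← getBlockEdge i
          setBlockEdge i { bE with sourceBlockEdge := none }

/-- The procedure s-Split. -/
noncomputable def sSplit {V R : Type} [Fintype R] [DecidableEq V] [DecidableEq R]
    (Y' Y : ℕ) (r : R) : Prog V R Unit := do
  let ys := (← getBlock Y').vertices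
  computeBlockEdges ys r
  sComputeSubblocks ys r
  sDoSplitting Y' ys Y r
  clearAuxiliaryInfo ys r

/-- The value of `P` that is returned: the lists of the vertices of its blocks. -/
def returnP {V R : Type} : Prog V R (List (List V)) := do
  (← get).P.mapM fun b => do pure (← getBlock b).vertices

/-- The inner loop of the algorithm, "while `ℚ[r].compoundSuperBlocks` is not empty". Its value is
the new value of the variable `changed`. -/
noncomputable def refineLoop {V R : Type} [Fintype R] [DecidableEq V] [DecidableEq R]
    (bound : ℕ) (r : R) (changed : Bool) : Prog V R Bool :=
  whileLoop bound
    (fun _ => do pure (! (← getSuperPartition r).compoundSuperBlocks.isEmpty))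
    (fun _ => do
      let Y ← deref (← getSuperPartition r).compoundSuperBlocks.head?
      let Y' ← SuperBlock.smallerBlock Y
      sSplit Y' Y r
      pure true)
    changed

/-- The outer loop of the algorithm, "while `changed`". -/
noncomputable def mainLoop {V R : Type} [Fintype R] [DecidableEq V] [DecidableEq R]
    (bound : ℕ) : Prog V R Bool :=
  whileLoop bound
    (fun changed => pure changed)
    (fun _ => do
      let mut changed := false
      for r in ← inAnyOrder (Finset.univ : Finset R) do
        changed ← refineLoop bound r changed
      pure changed)
    true

/-- The algorithm s-CompCB2. Every single execution of one of its while loops is allowed at most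
`bound` evaluations of the loop condition. -/
noncomputable def sCompCB2 {V S R : Type} [Fintype V] [Fintype R] [DecidableEq V] [DecidableEq R]
    (bound : ℕ) (G : FuzzyGraph V S R) : Prog V R (List (List V)) := do
  sInitialize G
  if (← get).P.length = 1 then
    returnP
  else
    let _ ← mainLoop bound
    returnP

/-- Whichever way the choices are resolved, the algorithm terminates on `G` without failing, and it
returns the partition `𝒬`. -/
def Computes {V S R : Type} [Fintype V] [Fintype R] [DecidableEq V] [DecidableEq R]
    (G : FuzzyGraph V S R) (𝒬 : Set (Set V)) : Prop :=
  ∀ choices : ℕ → ℕ, ∃ N, ∀ bound ≥ N, ∃ out s,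
    (sCompCB2 bound G).run (Store.initial V R choices) = some (out, s) ∧ ListsPartition out 𝒬

end SCompCB

/-! The union of all s-bisimulations is an s-bisimulation, since the required bijection is inherited
from whichever member relates the two vertices. It is an equivalence because equality, converses and
non-empty composites of s-bisimulations are s-bisimulations. What remains is that the algorithm
computes its classes.

For every label `r` the super-blocks form a partition of the vertices coarser than the current
blocks; `sup r x` names the super-block of `x`, and `G.count sup x r i d` counts the `r`-edges of
degree `d` from `x` into super-block `i`. The invariant `Inv` says that vertices in one block have
equal labels and equal counts into all super-blocks (stability), and that vertices related by a
fixed s-bisimulation `Z` are never separated. With one super-block per label, stability is just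
equality of labels and of the multisets of outgoing degrees, which is how the initial blocks are
formed (`wp_sInitialize`).

The heart is `wp_sSplit`. Making a block `Y'` of `Y` a super-block of its own writes each count into
`Y` as the sum of a count into the rest of `Y` and a count into `Y'` (`count_separate_add`). Two
vertices of one block agree on the sum, so they agree on both summands as soon as they agree on one.
Hence it is enough to sort the vertices with an edge into `Y'` by what remains of their block-edge,
and to leave the others where they are. This restores stability, and it separates only vertices with
different counts; `Z`-related vertices have equal counts into unions of blocks by
`IsSBisimulation.count_eq`, so they stay together.

When no super-block is compound, super-blocks and blocks coincide, and equal counts glue to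
bijections of successors (`exists_equiv_of_card_fiber_eq`). The partition is then an s-bisimulation
(`Inv.isSBisimulation`), hence contained in the largest one; with `Z` the largest, the invariant
gives the other inclusion. Every split increases the total number of super-blocks over all labels,
which is at most `|R| * |V|`, so the loops end. Neither argument uses that the smaller block is
chosen.

The connection with the program is that two edges share a block-edge iff they agree in origin, label
and super-block of the destination, and that its map holds the counts (`EdgesWF`). The predicate
`wp` demands success, so run-time errors are excluded along the way. -/

namespace SCompCB

/-! ### Total correctness of programs -/

variable {V S R : Type} {α β : Type}

/-- Started in the memory `s`, the program `p` succeeds and its result and final memory satisfy `Q`. -/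
def wp (p : Prog V R α) (Q : α → Store V R → Prop) (s : Store V R) : Prop :=
  ∃ a s', p s = some (a, s') ∧ Q a s'

theorem wp_mono {p : Prog V R α} {Q Q' : α → Store V R → Prop} {s : Store V R}
    (h : wp p Q s) (hQ : ∀ a s', Q a s' → Q' a s') : wp p Q' s := by
  obtain ⟨a, s', e, q⟩ := h
  exact ⟨a, s', e, hQ _ _ q⟩

theorem wp_bind {p : Prog V R α} {f : α → Prog V R β} {Q : β → Store V R → Prop} {s : Store V R} :
    wp (p >>= f) Q s ↔ wp p (fun a s' => wp (f a) Q s') s := by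
  have : (p >>= f) s = (p s).bind fun x => f x.1 x.2 := rfl
  unfold wp
  rw [this]
  constructor
  · rintro ⟨b, s', e, q⟩
    obtain ⟨⟨a, s₁⟩, e₁, e₂⟩ := Option.bind_eq_some_iff.1 e
    exact ⟨a, s₁, e₁, b, s', e₂, q⟩
  · rintro ⟨a, s₁, e₁, b, s', e₂, q⟩
    exact ⟨b, s', by rw [e₁]; exact e₂, q⟩

theorem wp_pure {a : α} {Q : α → Store V R → Prop} {s : Store V R} :
    wp (pure a : Prog V R α) Q s ↔ Q a s := by
  constructor
  · rintro ⟨b, s', e, q⟩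
    cases e
    exact q
  · exact fun q => ⟨a, s, rfl, q⟩

theorem wp_get {Q : Store V R → Store V R → Prop} {s : Store V R} :
    wp (get : Prog V R (Store V R)) Q s ↔ Q s s := by
  constructor
  · rintro ⟨b, s', e, q⟩
    cases e
    exact q
  · exact fun q => ⟨s, s, rfl, q⟩

theorem wp_modify {f : Store V R → Store V R} {Q : Unit → Store V R → Prop} {s : Store V R} :
    wp (modify f : Prog V R Unit) Q s ↔ Q () (f s) := by
  constructor
  · rintro ⟨b, s', e, q⟩
    cases e
    exact q
  · exact fun q => ⟨(), f s, rfl, q⟩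

theorem wp_deref {o : Option α} {Q : α → Store V R → Prop} {s : Store V R} :
    wp (deref o : Prog V R α) Q s ↔ ∃ a, o = some a ∧ Q a s := by
  cases o with
  | none =>
    constructor
    · rintro ⟨b, s', e, q⟩
      cases e
    · rintro ⟨a, e, _⟩
      cases e
  | some a => simp [deref, wp_pure]

theorem wp_ite {c : Prop} [Decidable c] {p q : Prog V R α} {Q : α → Store V R → Prop}
    {s : Store V R} : wp (if c then p else q) Q s ↔ (c → wp p Q s) ∧ (¬ c → wp q Q s) := by
  split_ifs with h <;> simp [h]

theorem wp_getBlockEdge {i : ℕ} {Q : BlockEdge → Store V R → Prop} {s : Store V R} :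
    wp (getBlockEdge i) Q s ↔ ∃ a, s.blockEdge i = some a ∧ Q a s := by
  simp only [getBlockEdge, wp_bind, wp_get, wp_deref]

theorem wp_setBlockEdge {i : ℕ} {bE : BlockEdge} {Q : Unit → Store V R → Prop} {s : Store V R} :
    wp (setBlockEdge i bE) Q s ↔
      Q () { s with blockEdge := Function.update s.blockEdge i (some bE) } := by
  simp only [setBlockEdge, wp_modify]

theorem wp_getBlock {i : ℕ} {Q : Block V R → Store V R → Prop} {s : Store V R} :
    wp (getBlock i) Q s ↔ ∃ a, s.block i = some a ∧ Q a s := by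
  simp only [getBlock, wp_bind, wp_get, wp_deref]

theorem wp_setBlock {i : ℕ} {B : Block V R} {Q : Unit → Store V R → Prop} {s : Store V R} :
    wp (setBlock i B) Q s ↔ Q () { s with block := Function.update s.block i (some B) } := by
  simp only [setBlock, wp_modify]

theorem wp_getSuperBlock {i : ℕ} {Q : SuperBlock R → Store V R → Prop} {s : Store V R} :
    wp (getSuperBlock i) Q s ↔ ∃ a, s.superBlock i = some a ∧ Q a s := by
  simp only [getSuperBlock, wp_bind, wp_get, wp_deref]

theorem wp_setSuperBlock {i : ℕ} {Y : SuperBlock R} {Q : Unit → Store V R → Prop}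
    {s : Store V R} : wp (setSuperBlock i Y) Q s ↔
      Q () { s with superBlock := Function.update s.superBlock i (some Y) } := by
  simp only [setSuperBlock, wp_modify]

theorem wp_getVertexBlock {x : V} {Q : ℕ → Store V R → Prop} {s : Store V R} :
    wp (getVertexBlock x) Q s ↔ ∃ a, s.vertexBlock x = some a ∧ Q a s := by
  simp only [getVertexBlock, wp_bind, wp_get, wp_deref]

theorem wp_setVertexBlock [DecidableEq V] {x : V} {b : ℕ} {Q : Unit → Store V R → Prop}
    {s : Store V R} : wp (setVertexBlock x b) Q s ↔
      Q () { s with vertexBlock := Function.update s.vertexBlock x (some b) } := by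
  simp only [setVertexBlock, wp_modify]

theorem wp_setProcessed [DecidableEq V] {x : V} {p : Bool} {Q : Unit → Store V R → Prop}
    {s : Store V R} : wp (setProcessed x p) Q s ↔
      Q () { s with processed := Function.update s.processed x p } := by
  simp only [setProcessed, wp_modify]

theorem wp_getEdge {e : EdgeRef V R} {Q : Edge → Store V R → Prop} {s : Store V R} :
    wp (getEdge e) Q s ↔ ∃ a, s.edge e = some a ∧ Q a s := by
  simp only [getEdge, wp_bind, wp_get, wp_deref]

theorem wp_setEdge [DecidableEq V] [DecidableEq R] {e : EdgeRef V R} {a : Edge}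
    {Q : Unit → Store V R → Prop} {s : Store V R} :
    wp (setEdge e a) Q s ↔ Q () { s with edge := Function.update s.edge e (some a) } := by
  simp only [setEdge, wp_modify]

theorem wp_getSuperPartition {r : R} {Q : SuperPartition → Store V R → Prop} {s : Store V R} :
    wp (getSuperPartition r) Q s ↔ ∃ a, s.Q r = some a ∧ Q a s := by
  simp only [getSuperPartition, wp_bind, wp_get, wp_deref]

theorem wp_setSuperPartition [DecidableEq R] {r : R} {q : SuperPartition}
    {Q : Unit → Store V R → Prop} {s : Store V R} :
    wp (setSuperPartition r q) Q s ↔ Q () { s with Q := Function.update s.Q r (some q) } := by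
  simp only [setSuperPartition, wp_modify]

theorem wp_newRef {Q : ℕ → Store V R → Prop} {s : Store V R} :
    wp (newRef : Prog V R ℕ) Q s ↔ Q s.fresh { s with fresh := s.fresh + 1 } := by
  simp only [newRef, wp_bind, wp_get, wp_modify, wp_pure]

/-- Nothing is kept of the choice but its bound, and the rest of the sequence becomes arbitrary;
proofs through this rule are therefore uniform in all resolutions. -/
theorem wp_chooseUpTo {n : ℕ} {Q : ℕ → Store V R → Prop} {s : Store V R}
    (h : ∀ k c, k ≤ n → Q k { s with choices := c }) : wp (chooseUpTo n : Prog V R ℕ) Q s := by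
  simp only [chooseUpTo, wp_bind, wp_get, wp_modify, wp_pure]
  exact h _ _ (Nat.lt_succ_iff.1 (Nat.mod_lt _ (Nat.succ_pos n)))

/-- Lists matter only up to permutation, so the place of insertion never has to be mentioned again.
-/
theorem wp_add {a : α} {l : List α} {Q : List α → Store V R → Prop} {s : Store V R}
    (h : ∀ l' c, l'.Perm (a :: l) → Q l' { s with choices := c }) :
    wp (add a l : Prog V R (List α)) Q s := by
  simp only [add, wp_bind, wp_pure]
  exact wp_chooseUpTo fun k c hk => h _ _ (List.perm_insertIdx a l hk)

theorem wp_remove [DecidableEq α] {a : α} {l : List α} {Q : List α → Store V R → Prop}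
    {s : Store V R} (ha : a ∈ l) (h : Q (l.erase a) s) :
    wp (remove a l : Prog V R (List α)) Q s := by
  simp only [remove, if_pos ha, wp_pure, h]

theorem wp_foldlM_add {l : List α} {acc : List α} {Q : List α → Store V R → Prop} {s : Store V R}
    (h : ∀ l' c, l'.Perm (acc ++ l) → Q l' { s with choices := c }) :
    wp (l.foldlM (fun l a => add a l) acc : Prog V R (List α)) Q s := by
  induction l generalizing acc s with
  | nil =>
    rw [List.foldlM_nil, wp_pure]
    exact h acc s.choices (by simp)
  | cons a l ih =>
    rw [List.foldlM_cons, wp_bind]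
    refine wp_add fun l' c hl' => ih fun l'' c' hl'' => ?_
    refine h l'' c' (hl''.trans ((hl'.append_right l).trans ?_))
    simpa using List.perm_middle.symm

theorem wp_inAnyOrder {A : Finset α} {Q : List α → Store V R → Prop} {s : Store V R}
    (h : ∀ l c, l.Nodup → (∀ a, a ∈ l ↔ a ∈ A) → Q l { s with choices := c }) :
    wp (inAnyOrder A : Prog V R (List α)) Q s := by
  unfold inAnyOrder
  refine wp_foldlM_add fun l c hl => h l c ?_ ?_
  · exact hl.nodup_iff.2 (by simpa using A.nodup_toList)
  · intro a
    simpa using hl.mem_iff (a := a)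

/-- The invariant is indexed by the prefix already treated. Bodies that break out of the loop are
excluded by demanding `yield`. -/
theorem wp_forIn {l : List α} {f : α → β → Prog V R (ForInStep β)} {b : β} {s : Store V R}
    {Q : β → Store V R → Prop} (I : List α → β → Store V R → Prop) (h0 : I [] b s)
    (hstep : ∀ pre a suf b s, l = pre ++ a :: suf → I pre b s →
      wp (f a b) (fun o s' => ∃ b', o = .yield b' ∧ I (pre ++ [a]) b' s') s)
    (hend : ∀ b s, I l b s → Q b s) : wp (forIn l b f) Q s := by
  suffices H : ∀ suf pre b s, l = pre ++ suf → I pre b s → wp (forIn suf b f) Q s from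
    H l [] b s rfl h0
  intro suf
  induction suf with
  | nil =>
    intro pre b s hl hI
    rw [List.forIn_nil, wp_pure]
    exact hend _ _ (by simpa [hl] using hI)
  | cons a suf ih =>
    intro pre b s hl hI
    rw [List.forIn_cons, wp_bind]
    refine wp_mono (hstep pre a suf b s hl hI) ?_
    rintro o s' ⟨b', rfl, hI'⟩
    exact ih (pre ++ [a]) b' s' (by simp [hl]) hI'

/-- A loop that runs through the edges of label `r` that come to the vertices of a list. -/
theorem wp_forIn_comingEdges [DecidableEq R] {ys : List V} {r : R} {s : Store V R}
    {body : EdgeRef V R → Prog V R (ForInStep PUnit)} {Q : Unit → Store V R → Prop}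
    (CE : V → List (EdgeRef V R)) (es : List (EdgeRef V R))
    (hes : es = (ys.flatMap CE).filter fun e => e.label = r)
    (I : List (EdgeRef V R) → Store V R → Prop) (hCE : ∀ pre s, I pre s → s.comingEdges = CE)
    (h0 : I [] s)
    (hstep : ∀ pre e suf s, es = pre ++ e :: suf → I pre s →
      wp (body e) (fun o s' => o = .yield PUnit.unit ∧ I (pre ++ [e]) s') s)
    (hend : ∀ s, I es s → Q () s) :
    wp (do
      forIn ys PUnit.unit fun y _ => do
        let s ← get
        forIn (s.comingEdges y) PUnit.unit fun e _ =>
          if e.label = r then body e else pure (ForInStep.yield PUnit.unit)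
        pure (ForInStep.yield PUnit.unit)
      pure ()) Q s := by
  rw [wp_bind]
  refine wp_forIn (fun pre _ s => I ((pre.flatMap CE).filter fun e => e.label = r) s) h0 ?_ ?_
  · intro pre y suf _ s hl hI
    simp only [wp_bind, wp_get, hCE _ _ hI]
    refine wp_forIn (fun pre' _ s =>
      I (((pre.flatMap CE) ++ pre').filter fun e => e.label = r) s) (by simpa using hI) ?_ ?_
    · intro pre' e suf' _ s hl' hI'
      by_cases hr : e.label = r
      · rw [if_pos hr]
        refine wp_mono (hstep _ e (((suf' ++ suf.flatMap CE)).filter fun e => e.label = r) s ?_ hI')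
          ?_
        · rw [hes, hl]
          simp [hl', hr]
        · rintro o s' ⟨rfl, h⟩
          exact ⟨_, rfl, by simpa [hr] using h⟩
      · rw [if_neg hr, wp_pure]
        exact ⟨_, rfl, by simpa [hr] using hI'⟩
    · intro _ s hI'
      rw [wp_pure]
      exact ⟨_, rfl, by simpa using hI'⟩
  · intro _ s hI
    rw [wp_pure]
    exact hend s (by rw [hes]; exact hI)

/-- The rule for a loop with a decreasing variant. -/
theorem wp_whileLoop {cond : β → Prog V R Bool} {body : β → Prog V R β}
    {Q : β → Store V R → Prop} (I : ℕ → β → Store V R → Prop)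
    (h : ∀ n b s, I n b s → wp (cond b) (fun c s' =>
      if c then wp (body b) (fun b' s'' => ∃ m < n, I m b' s'') s' else Q b s') s)
    {fuel n : ℕ} {b : β} {s : Store V R} (hI : I n b s) (hn : n < fuel) :
    wp (whileLoop fuel cond body b) Q s := by
  induction fuel generalizing n b s with
  | zero => omega
  | succ k ih =>
    rw [whileLoop, wp_bind]
    refine wp_mono (h n b s hI) ?_
    rintro (_ | _) s' hc
    · simpa [wp_pure] using hc
    · simp only [if_true, wp_bind] at hc ⊢
      refine wp_mono hc ?_
      rintro b' s'' ⟨m, hm, hI'⟩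
      exact ih hI' (by omega)

end SCompCB

namespace SCompCB

variable {V S R : Type} {α β : Type}

/-! ### Super-partitions and super-blocks -/

/-- The super-partition of label `r` consists of the super-blocks `i` with `ids r i`, and `b` is a
block of the super-block `i` iff `rel r i b`. -/
def SuperWF (ids : R → ℕ → Prop) (rel : R → ℕ → ℕ → Prop) (sbm : ℕ → Option (SuperBlock R))
    (Qm : R → Option SuperPartition) (fr : ℕ) : Prop :=
  ∀ r, ∃ q, Qm r = some q ∧ (q.compoundSuperBlocks ++ q.simpleSuperBlocks).Nodup ∧
    (∀ i, i ∈ q.compoundSuperBlocks ++ q.simpleSuperBlocks ↔ ids r i) ∧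
    ∀ i, ids r i → i < fr ∧ ∃ bs, sbm i = some ⟨bs, r⟩ ∧ bs.Nodup ∧ (∀ b, b ∈ bs ↔ rel r i b) ∧
      (i ∈ q.compoundSuperBlocks ↔ 1 < bs.length)

namespace SuperWF

variable {ids ids' : R → ℕ → Prop} {rel rel' : R → ℕ → ℕ → Prop}
  {sbm : ℕ → Option (SuperBlock R)} {Qm : R → Option SuperPartition} {fr fr' : ℕ}

theorem mono (h : SuperWF ids rel sbm Qm fr) (hids : ∀ r i, ids r i ↔ ids' r i)
    (hrel : ∀ r i b, ids r i → (rel r i b ↔ rel' r i b)) (hfr : fr ≤ fr') :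
    SuperWF ids' rel' sbm Qm fr' := by
  intro r
  obtain ⟨q, hq, hnd, hmem, hi⟩ := h r
  refine ⟨q, hq, hnd, fun i => (hmem i).trans (hids r i), fun i hi' => ?_⟩
  have hi'' := (hids r i).2 hi'
  obtain ⟨hlt, bs, h1, h2, h3, h4⟩ := hi i hi''
  exact ⟨hlt.trans_le hfr, bs, h1, h2, fun b => (h3 b).trans (hrel r i b hi''), h4⟩

/-- A super-block records its label, so one reference cannot serve two labels. -/
theorem unique (h : SuperWF ids rel sbm Qm fr) {r r' : R} {i : ℕ} (hr : ids r i)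
    (hr' : ids r' i) : r = r' := by
  obtain ⟨q, -, -, -, hi⟩ := h r
  obtain ⟨q', -, -, -, hi'⟩ := h r'
  obtain ⟨-, bs, h1, -⟩ := hi i hr
  obtain ⟨-, bs', h1', -⟩ := hi' i hr'
  rw [h1] at h1'
  exact congrArg SuperBlock.superPartition (Option.some.inj h1')

theorem lt (h : SuperWF ids rel sbm Qm fr) {r : R} {i : ℕ} (hr : ids r i) : i < fr := by
  obtain ⟨q, -, -, -, hi⟩ := h r
  exact (hi i hr).1

variable [DecidableEq R]

/-- The common part of adding and removing a block: one super-block gets a new list and possibly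
changes between the compound and the simple ones. The other labels are unaffected by `unique`. -/
theorem update (h : SuperWF ids rel sbm Qm fr) {r : R} {i : ℕ} (hi : ids r i)
    {q q' : SuperPartition} (hq : Qm r = some q)
    (hperm : (q'.compoundSuperBlocks ++ q'.simpleSuperBlocks).Perm
      (q.compoundSuperBlocks ++ q.simpleSuperBlocks))
    (hne : ∀ j, j ≠ i → (j ∈ q'.compoundSuperBlocks ↔ j ∈ q.compoundSuperBlocks))
    {bs : List ℕ} (hbs : bs.Nodup) (hlen : i ∈ q'.compoundSuperBlocks ↔ 1 < bs.length)
    (hrel : ∀ r' j b, ids r' j → (rel' r' j b ↔ if r' = r ∧ j = i then b ∈ bs else rel r' j b)) :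
    SuperWF ids rel' (Function.update sbm i (some ⟨bs, r⟩)) (Function.update Qm r (some q')) fr := by
  intro r'
  by_cases hr : r' = r
  · subst hr
    obtain ⟨q₀, hq₀, hnd, hmem, hi'⟩ := h r'
    obtain rfl : q₀ = q := Option.some.inj (hq₀.symm.trans hq)
    refine ⟨q', by simp, hperm.nodup_iff.2 hnd, fun j => hperm.mem_iff.trans (hmem j), ?_⟩
    intro j hj
    obtain ⟨hlt, bs', h1, h2, h3, h4⟩ := hi' j hj
    refine ⟨hlt, ?_⟩
    by_cases hji : j = i
    · subst hji
      exact ⟨bs, by simp, hbs, fun b => by simp [hrel r' j b hj], hlen⟩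
    · exact ⟨bs', by simp [hji, h1], h2, fun b => by simp [hrel r' j b hj, hji, h3],
        (hne j hji).trans h4⟩
  · obtain ⟨q₀, hq₀, hnd, hmem, hi'⟩ := h r'
    refine ⟨q₀, by simp [hr, hq₀], hnd, hmem, fun j hj => ?_⟩
    obtain ⟨hlt, bs', h1, h2, h3, h4⟩ := hi' j hj
    have hji : j ≠ i := by
      rintro rfl
      exact hr (h.unique hj hi)
    exact ⟨hlt, bs', by simp [hji, h1], h2, fun b => by simp [hrel r' j b hj, hr, h3], h4⟩

end SuperWF

variable [DecidableEq R]

/-- Compoundness changes exactly when the length becomes 2, which is the test made by the program.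
-/
theorem wp_addBlock {ids : R → ℕ → Prop} {rel : R → ℕ → ℕ → Prop} {r : R} {i b : ℕ}
    {s : Store V R} {Q : Unit → Store V R → Prop} (h : SuperWF ids rel s.superBlock s.Q s.fresh)
    (hi : ids r i) (hb : ¬ rel r i b)
    (hQ : ∀ sbm Qm c,
      SuperWF ids (fun r' i' b' => rel r' i' b' ∨ r' = r ∧ i' = i ∧ b' = b) sbm Qm s.fresh →
      Q () { s with superBlock := sbm, Q := Qm, choices := c }) :
    wp (SuperBlock.addBlock i b) Q s := by
  obtain ⟨q, hq, hnd, hmem, hi'⟩ := h r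
  obtain ⟨hlt, bs, h1, h2, h3, h4⟩ := hi' i hi
  simp only [SuperBlock.addBlock, wp_bind, wp_getSuperBlock, h1, Option.some.injEq,
    exists_eq_left']
  refine wp_add fun bs' c hbs' => ?_
  have hbs'nd : bs'.Nodup := by
    rw [hbs'.nodup_iff, List.nodup_cons]
    exact ⟨fun hb' => hb ((h3 b).1 hb'), h2⟩
  have hlen : bs'.length = bs.length + 1 := by simpa using hbs'.length_eq
  have hrel : ∀ r' j b', ids r' j → ((rel r' j b' ∨ r' = r ∧ j = i ∧ b' = b) ↔
      if r' = r ∧ j = i then b' ∈ bs' else rel r' j b') := by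
    intro r' j b' _
    split_ifs with hc
    · obtain ⟨rfl, rfl⟩ := hc
      rw [hbs'.mem_iff, List.mem_cons, h3]
      tauto
    · tauto
  have hpos : i ∈ q.simpleSuperBlocks → bs.length ≤ 1 := by
    intro hs
    by_contra hc
    exact (List.disjoint_of_nodup_append hnd) (h4.2 (by omega)) hs
  have hor := List.mem_append.1 ((hmem i).2 hi)
  simp only [wp_setSuperBlock, wp_ite, wp_pure, wp_bind, wp_getSuperPartition, hq,
    Option.some.injEq, exists_eq_left', hlen]
  constructor
  · intro hl
    have hs : i ∈ q.simpleSuperBlocks := hor.resolve_left fun hc => by have := h4.1 hc; omega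
    refine wp_remove hs (wp_add fun comp c' hcomp => ?_)
    rw [wp_setSuperPartition]
    refine hQ _ _ _ (h.update hi hq ?_ ?_ hbs'nd ?_ hrel)
    · refine (hcomp.append_right _).trans ?_
      rw [List.cons_append]
      exact List.perm_middle.symm.trans ((List.perm_cons_erase hs).symm.append_left _)
    · intro j hj
      simp [hcomp.mem_iff, hj]
    · simp only [hcomp.mem_iff, List.mem_cons, true_or, true_iff]
      omega
  · intro hl
    -- Writing back the unchanged super-partition is the identity, so this case is an instance of
    -- `update` as well.
    have := h.update hi hq (List.Perm.refl _) (fun _ _ => Iff.rfl) hbs'nd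
      (h4.trans (by
        rcases hor with hc | hc
        · have := h4.1 hc; omega
        · have := hpos hc; omega)) hrel
    rw [← hq, Function.update_eq_self] at this
    exact hQ _ _ _ this

/-- Compoundness is lost exactly when the length drops to 1. The super-block stays in its
super-partition even if its list becomes empty. -/
theorem wp_removeBlock {ids : R → ℕ → Prop} {rel : R → ℕ → ℕ → Prop} {r : R} {i b : ℕ}
    {s : Store V R} {Q : Unit → Store V R → Prop} (h : SuperWF ids rel s.superBlock s.Q s.fresh)
    (hi : ids r i) (hb : rel r i b)
    (hQ : ∀ sbm Qm c,
      SuperWF ids (fun r' i' b' => rel r' i' b' ∧ ¬ (r' = r ∧ i' = i ∧ b' = b)) sbm Qm s.fresh →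
      Q () { s with superBlock := sbm, Q := Qm, choices := c }) :
    wp (SuperBlock.removeBlock i b) Q s := by
  obtain ⟨q, hq, hnd, hmem, hi'⟩ := h r
  obtain ⟨hlt, bs, h1, h2, h3, h4⟩ := hi' i hi
  simp only [SuperBlock.removeBlock, wp_bind, wp_getSuperBlock, h1, Option.some.injEq,
    exists_eq_left']
  have hbs := (h3 b).2 hb
  refine wp_remove hbs ?_
  have hnd' := h2.erase b
  have hlen := List.length_erase_add_one hbs
  have hrel : ∀ r' j b', ids r' j → ((rel r' j b' ∧ ¬ (r' = r ∧ j = i ∧ b' = b)) ↔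
      if r' = r ∧ j = i then b' ∈ bs.erase b else rel r' j b') := by
    intro r' j b' _
    split_ifs with hc
    · obtain ⟨rfl, rfl⟩ := hc
      rw [h2.mem_erase_iff, h3]
      tauto
    · tauto
  simp only [wp_setSuperBlock, wp_ite, wp_pure, wp_bind, wp_getSuperPartition, hq,
    Option.some.injEq, exists_eq_left']
  constructor
  · intro hl
    have hs : i ∈ q.compoundSuperBlocks := h4.2 (by omega)
    refine wp_remove hs (wp_add fun simp' c' hsimp => ?_)
    rw [wp_setSuperPartition]
    have hndc : q.compoundSuperBlocks.Nodup := (List.nodup_append.1 hnd).1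
    refine hQ _ _ _ (h.update hi hq ?_ ?_ hnd' ?_ hrel)
    · refine (hsimp.append_left _).trans ?_
      exact List.perm_middle.trans ((List.perm_cons_erase hs).symm.append_right _)
    · intro j hj
      simp [hj, hndc.mem_erase_iff]
    · simp only [hndc.mem_erase_iff]
      constructor
      · rintro ⟨hc, -⟩
        exact absurd rfl hc
      · omega
  · intro hl
    have := h.update hi hq (List.Perm.refl _) (fun _ _ => Iff.rfl) hnd'
      (h4.trans (by omega)) hrel
    rw [← hq, Function.update_eq_self] at this
    exact hQ _ _ _ this

theorem wp_newSuperBlock {r : R} {q : SuperPartition} {s : Store V R}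
    {Q : ℕ → Store V R → Prop} (hq : s.Q r = some q)
    (hQ : ∀ l c, l.Perm (s.fresh :: q.simpleSuperBlocks) → Q s.fresh
      { s with
        superBlock := Function.update s.superBlock s.fresh (some ⟨[], r⟩)
        Q := Function.update s.Q r (some ⟨q.compoundSuperBlocks, l⟩)
        choices := c
        fresh := s.fresh + 1 }) :
    wp (SuperBlock.new r) Q s := by
  simp only [SuperBlock.new, wp_bind, wp_newRef, wp_setSuperBlock, SuperPartition.addSuperBlock,
    wp_getSuperBlock, Function.update_self, Option.some.injEq, exists_eq_left',
    wp_getSuperPartition, hq, List.length_nil, wp_ite, wp_pure]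
  refine ⟨fun h => absurd h (by simp), fun _ => wp_add fun l c hl => ?_⟩
  rw [wp_setSuperPartition]
  exact hQ l c hl

/-- All existing super-blocks lie below `fr`, so the new reference clashes with none of them; its
list is empty, which is why `rel` must be void there. -/
theorem SuperWF.newSuperBlock {ids : R → ℕ → Prop} {rel : R → ℕ → ℕ → Prop}
    {sbm : ℕ → Option (SuperBlock R)} {Qm : R → Option SuperPartition} {fr : ℕ}
    (h : SuperWF ids rel sbm Qm fr) {r : R} {q : SuperPartition} (hq : Qm r = some q)
    (hrel : ∀ b, ¬ rel r fr b) {l : List ℕ} (hl : l.Perm (fr :: q.simpleSuperBlocks)) :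
    SuperWF (fun r' i => ids r' i ∨ r' = r ∧ i = fr) rel
      (Function.update sbm fr (some ⟨[], r⟩))
      (Function.update Qm r (some ⟨q.compoundSuperBlocks, l⟩)) (fr + 1) := by
  have hlt := fun r i hi => h.lt (r := r) (i := i) hi
  intro r'
  obtain ⟨q₀, hq₀, hnd, hmem, hi'⟩ := h r'
  have hold : ∀ i, ids r' i → i < fr + 1 ∧ ∃ bs,
      Function.update sbm fr (some ⟨[], r⟩) i = some ⟨bs, r'⟩ ∧ bs.Nodup ∧
      (∀ b, b ∈ bs ↔ rel r' i b) ∧ (i ∈ q₀.compoundSuperBlocks ↔ 1 < bs.length) := by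
    intro i hi
    obtain ⟨hlt, bs, h1, h2⟩ := hi' i hi
    exact ⟨by omega, bs, by rw [Function.update_of_ne hlt.ne, h1], h2⟩
  by_cases hr : r' = r
  · subst hr
    obtain rfl : q₀ = q := Option.some.inj (hq₀.symm.trans hq)
    have hperm : (q₀.compoundSuperBlocks ++ l).Perm
        (fr :: (q₀.compoundSuperBlocks ++ q₀.simpleSuperBlocks)) :=
      (hl.append_left _).trans List.perm_middle
    have hfr : fr ∉ q₀.compoundSuperBlocks ++ q₀.simpleSuperBlocks := fun hf =>
      lt_irrefl _ (hlt _ _ ((hmem fr).1 hf))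
    refine ⟨_, by simp; rfl, ?_, ?_, ?_⟩
    · exact hperm.nodup_iff.2 (List.nodup_cons.2 ⟨hfr, hnd⟩)
    · intro i
      rw [hperm.mem_iff, List.mem_cons, hmem]
      tauto
    · rintro i (hi | ⟨-, rfl⟩)
      · exact hold i hi
      · refine ⟨by omega, [], by simp, List.nodup_nil, fun b => by simpa using hrel b, ?_⟩
        simp only [List.length_nil, not_lt_zero, iff_false]
        exact fun hc => hfr (List.mem_append_left _ hc)
  · refine ⟨q₀, by simp [hr, hq₀], hnd, fun i => by simp [hmem, hr], ?_⟩
    rintro i (hi | ⟨hi, -⟩)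
    · exact hold i hi
    · exact absurd hi hr

/-- The specification of the constructor of blocks. -/
theorem wp_newBlock [Fintype R] [DecidableEq V] {ids : R → ℕ → Prop} {rel : R → ℕ → ℕ → Prop}
    {vl : List V} {σ : R → ℕ} {s : Store V R} {Q : Unit → Store V R → Prop}
    (h : SuperWF ids rel s.superBlock s.Q s.fresh) (hσ : ∀ r, ids r (σ r))
    (hrel : ∀ r i, ids r i → ¬ rel r i s.fresh)
    (hQ : ∀ sbm Qm c P, P.Perm (s.fresh :: s.P) →
      SuperWF ids (fun r i b => rel r i b ∨ b = s.fresh ∧ i = σ r) sbm Qm (s.fresh + 1) →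
      Q () { s with
        vertexBlock := fun x => if x ∈ vl then some s.fresh else s.vertexBlock x
        block := Function.update s.block s.fresh (some ⟨vl, fun r => some (σ r), ∅⟩)
        superBlock := sbm
        Q := Qm
        choices := c
        P := P
        fresh := s.fresh + 1 }) :
    wp (Block.new vl fun r => some (σ r)) Q s := by
  simp only [Block.new, wp_bind, wp_newRef, wp_setBlock, wp_get]
  refine wp_add fun P c hP => ?_
  rw [wp_modify]
  refine wp_forIn (fun pre _ s' => s' = { s with
        vertexBlock := fun x => if x ∈ pre then some s.fresh else s.vertexBlock x
        block := Function.update s.block s.fresh (some ⟨vl, fun _ => none, ∅⟩)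
        choices := c
        P := P
        fresh := s.fresh + 1 }) (by simp) ?_ ?_
  · rintro pre x suf _ s' - rfl
    simp only [wp_bind, wp_setVertexBlock, wp_pure]
    refine ⟨⟨⟩, trivial, ?_⟩
    congr 1
    funext y
    by_cases hy : y = x
    · subst hy; simp
    · simp [hy]
  rintro _ s' rfl
  refine wp_inAnyOrder fun rs c' hrsnd hrs => ?_
  refine wp_forIn (fun pre _ s' => ∃ sbm Qm c,
    SuperWF ids (fun r i b => rel r i b ∨ r ∈ pre ∧ i = σ r ∧ b = s.fresh) sbm Qm (s.fresh + 1) ∧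
    s' = { s with
        vertexBlock := fun x => if x ∈ vl then some s.fresh else s.vertexBlock x
        block := Function.update s.block s.fresh
          (some ⟨vl, fun r => if r ∈ pre then some (σ r) else none, ∅⟩)
        superBlock := sbm
        Q := Qm
        choices := c
        P := P
        fresh := s.fresh + 1 }) ?_ ?_ ?_
  · refine ⟨s.superBlock, s.Q, c', ?_, by simp⟩
    exact h.mono (fun _ _ => Iff.rfl) (by simp) (by omega)
  · rintro pre r suf _ s' hl ⟨sbm, Qm, c, hwf, rfl⟩
    have hr : r ∉ pre := by
      rw [hl] at hrsnd
      exact fun hr => (List.disjoint_of_nodup_append hrsnd) hr (by simp)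
    simp only [wp_deref, Option.some.injEq, exists_eq_left', wp_getBlock, Function.update_self,
      wp_setBlock, wp_bind, wp_pure]
    refine wp_addBlock hwf (hσ r) ?_ ?_
    · rintro (h' | ⟨h', -⟩)
      · exact hrel _ _ (hσ r) h'
      · exact hr h'
    · intro sbm' Qm' c' hwf'
      refine ⟨⟨⟩, trivial, sbm', Qm', c', hwf'.mono (fun _ _ => Iff.rfl) ?_ le_rfl, ?_⟩
      · intro r' i b _
        simp only [List.mem_append, List.mem_singleton]
        constructor
        · rintro ((h | ⟨h, h'⟩) | ⟨rfl, h, h'⟩)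
          · exact Or.inl h
          · exact Or.inr ⟨Or.inl h, h'⟩
          · exact Or.inr ⟨Or.inr rfl, h, h'⟩
        · rintro (h | ⟨h | rfl, h'⟩)
          · exact Or.inl (Or.inl h)
          · exact Or.inl (Or.inr ⟨h, h'⟩)
          · exact Or.inr ⟨rfl, h'⟩
      · have hsup : Function.update (fun r => if r ∈ pre then some (σ r) else none) r (some (σ r)) =
            fun r' => if r' ∈ pre ++ [r] then some (σ r') else none := by
          funext r'
          by_cases h' : r' = r
          · subst h'; simp
          · simp [h']
        simp only [Function.update_idem, hsup]
  · rintro _ s' ⟨sbm, Qm, c, hwf, rfl⟩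
    rw [wp_pure]
    have := hQ sbm Qm c P hP (hwf.mono (fun _ _ => Iff.rfl) (by simp [hrs, and_comm]) le_rfl)
    simpa [hrs] using this

end SCompCB

namespace SCompCB

variable {V S R : Type} {α β : Type}

/-! ### Blocks -/

/-- The vertices of a block are those with `C`. The list `verts` contains those with the value `κ₀`
of `κ`, and `dl k` is the list of those with the value `k`; nothing else occurs. -/
structure Shape (κ : V → Option DegreeMap) (κ₀ : Option DegreeMap) (C : V → Prop) (verts : List V)
    (dl : DegreeMap → Option (List V)) : Prop where
  nonempty : ∃ x, C x
  nodup : verts.Nodup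
  mem_verts : ∀ x, x ∈ verts ↔ C x ∧ κ x = κ₀
  departing : ∀ k l, dl k = some l →
    some k ≠ κ₀ ∧ l ≠ [] ∧ l.Nodup ∧ ∀ x, x ∈ l ↔ C x ∧ κ x = some k
  cover : ∀ x, C x → κ x ≠ κ₀ → ∃ k l, κ x = some k ∧ dl k = some l

/-- Consistency of the blocks and super-blocks; `sup r x` is the super-block of label `r` that
contains the block of `x`. The keys `kp` of the block `bx` do not count any more. If `p` holds, no
block has been split yet. -/
structure BlocksWF (p : Prop) (κ : V → Option DegreeMap) (bx : ℕ) (kp : List DegreeMap)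
    (sup : R → V → ℕ) (s : Store V R) : Prop where
  nodup : s.P.Nodup
  lt_fresh : ∀ b ∈ s.P, b < s.fresh
  vertexBlock : ∀ x, ∃ b ∈ s.P, s.vertexBlock x = some b
  block : ∀ b ∈ s.P, ∃ B, s.block b = some B ∧
    (∃ κ₀, (p → κ₀ = none) ∧ Shape κ κ₀ (fun x => s.vertexBlock x = some b) B.vertices
      fun k => if b = bx ∧ k ∈ kp then none else B.departingBlocks.lookup k) ∧
    ∀ x, s.vertexBlock x = some b → ∀ r, B.superBlocks r = some (sup r x)
  super : SuperWF (fun r i => ∃ x, sup r x = i)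
    (fun r i b => ∃ x, s.vertexBlock x = some b ∧ sup r x = i) s.superBlock s.Q s.fresh

namespace BlocksWF

variable {p : Prop} {κ : V → Option DegreeMap} {bx : ℕ} {kp : List DegreeMap} {sup : R → V → ℕ}
  {s s' : Store V R}

theorem congr (h : BlocksWF p κ bx kp sup s) (hP : s'.P = s.P) (hvb : s'.vertexBlock = s.vertexBlock)
    (hb : s'.block = s.block) (hsb : s'.superBlock = s.superBlock) (hQ : s'.Q = s.Q)
    (hfr : s.fresh ≤ s'.fresh) : BlocksWF p κ bx kp sup s' := by
  constructor
  · rw [hP]; exact h.nodup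
  · rw [hP]; exact fun b hb => (h.lt_fresh b hb).trans_le hfr
  · rw [hP, hvb]; exact h.vertexBlock
  · rw [hP, hvb, hb]; exact h.block
  · rw [hvb, hsb, hQ]; exact h.super.mono (fun _ _ => Iff.rfl) (fun _ _ _ _ => Iff.rfl) hfr

theorem mem_P (h : BlocksWF p κ bx kp sup s) {x : V} {b : ℕ} (hx : s.vertexBlock x = some b) :
    b ∈ s.P := by
  obtain ⟨b', hb', hx'⟩ := h.vertexBlock x
  obtain rfl : b' = b := Option.some.inj (hx'.symm.trans hx)
  exact hb'

theorem sup_eq (h : BlocksWF p κ bx kp sup s) {x x' : V}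
    (hx : s.vertexBlock x = s.vertexBlock x') (r : R) : sup r x = sup r x' := by
  obtain ⟨b, hb, hxb⟩ := h.vertexBlock x
  obtain ⟨B, -, -, hB⟩ := h.block b hb
  exact Option.some.inj ((hB x hxb r).symm.trans (hB x' (hx ▸ hxb) r))

/-- A vertex is moved from the vertices of its block to the departing ones. -/
theorem moveVertex [DecidableEq V] (h : BlocksWF True κ 0 [] sup s) {x : V} {b : ℕ}
    (hx : s.vertexBlock x = some b) (hκ : κ x = none) {B B' : Block V R} (hB : s.block b = some B)
    {key : DegreeMap} {moved : List V} (hverts : B'.vertices = B.vertices.erase x)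
    (hsup : B'.superBlocks = B.superBlocks)
    (hmoved : moved.Perm (x :: (B.departingBlocks.lookup key).getD []))
    (hlookup : ∀ k, B'.departingBlocks.lookup k =
      if k = key then some moved else B.departingBlocks.lookup k)
    {pr : V → Bool} {c : ℕ → ℕ} :
    BlocksWF True (Function.update κ x (some key)) 0 [] sup
      { s with
        block := Function.update s.block b (some B')
        processed := pr
        choices := c } where
  nodup := h.nodup
  lt_fresh := h.lt_fresh
  vertexBlock := h.vertexBlock
  super := h.super
  block b' hb' := by
    obtain ⟨B₁, hB₁, ⟨κ₀, hκ₀, hsh⟩, hs⟩ := h.block b' hb'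
    obtain rfl := hκ₀ trivial
    dsimp only at hb' ⊢
    simp only [List.not_mem_nil, and_false, if_false] at hsh ⊢
    by_cases hbb : b' = b
    · subst hbb
      obtain rfl : B₁ = B := Option.some.inj (hB₁.symm.trans hB)
      refine ⟨B', by simp, ⟨none, fun _ => rfl, ?_⟩, by simpa only [hsup] using hs⟩
      constructor
      · exact hsh.nonempty
      · rw [hverts]; exact hsh.nodup.erase x
      · intro y
        rw [hverts, hsh.nodup.mem_erase_iff, hsh.mem_verts]
        by_cases hy : y = x
        · subst hy; simp
        · simp [hy]
      · intro k l hl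
        rw [hlookup] at hl
        by_cases hk : k = key
        · subst hk
          obtain rfl : moved = l := by simpa using hl
          -- An absent key counts as an empty list: by `cover`, no vertex of the block has this
          -- value of `κ` yet.
          have hmem : ∀ y, y ∈ (B₁.departingBlocks.lookup k).getD [] ↔
              s.vertexBlock y = some b' ∧ κ y = some k := by
            intro y
            cases hlk : B₁.departingBlocks.lookup k with
            | some l' => simpa using (hsh.departing k l' hlk).2.2.2 y
            | none =>
              simp only [Option.getD_none, List.not_mem_nil, false_iff, not_and]
              intro hy hky
              obtain ⟨k', l', hk', hl'⟩ := hsh.cover y hy (by simp [hky])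
              obtain rfl : k = k' := Option.some.inj (hky.symm.trans hk')
              simp [hlk] at hl'
          refine ⟨by simp, ?_, ?_, ?_⟩
          · rintro rfl
            simpa using hmoved.length_eq
          · rw [hmoved.nodup_iff, List.nodup_cons, hmem]
            refine ⟨by simp [hκ], ?_⟩
            cases hlk : B₁.departingBlocks.lookup k with
            | some l' => simpa using (hsh.departing k l' hlk).2.2.1
            | none => simp
          · intro y
            rw [hmoved.mem_iff, List.mem_cons, hmem]
            by_cases hy : y = x
            · subst hy; simp [hx]
            · simp [hy]
        · rw [if_neg hk] at hl
          obtain ⟨h1, h2, h3, h4⟩ := hsh.departing k l hl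
          refine ⟨h1, h2, h3, fun y => ?_⟩
          rw [h4]
          by_cases hy : y = x
          · subst hy; simp [hκ, Ne.symm hk]
          · simp [hy]
      · intro y hy hκy
        simp only [hlookup]
        by_cases hyx : y = x
        · subst hyx
          exact ⟨key, moved, by simp, by simp⟩
        · rw [Function.update_of_ne hyx] at hκy ⊢
          obtain ⟨k, l, hk, hl⟩ := hsh.cover y hy hκy
          by_cases hkk : k = key
          · exact ⟨k, moved, hk, by simp [hkk]⟩
          · exact ⟨k, l, hk, by simp [hkk, hl]⟩
    · refine ⟨B₁, by simp [hbb, hB₁], ⟨none, fun _ => rfl, ?_⟩, hs⟩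
      have hne : ∀ y, s.vertexBlock y = some b' → Function.update κ x (some key) y = κ y := by
        intro y hy
        refine Function.update_of_ne ?_ _ _
        rintro rfl
        exact hbb (Option.some.inj (hy.symm.trans hx))
      constructor
      · exact hsh.nonempty
      · exact hsh.nodup
      · intro y
        rw [hsh.mem_verts]
        exact and_congr_right fun hy => by rw [hne y hy]
      · intro k l hl
        obtain ⟨h1, h2, h3, h4⟩ := hsh.departing k l hl
        refine ⟨h1, h2, h3, fun y => ?_⟩
        rw [h4]
        exact and_congr_right fun hy => by rw [hne y hy]
      · intro y hy
        rw [hne y hy]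
        exact hsh.cover y hy

end BlocksWF

/-- The partition `g` refines the partition `f`, and it does not separate vertices that have the same
value of `κ`. -/
def Refines (κ : V → Option DegreeMap) (f g : V → Option ℕ) : Prop :=
  (∀ x x', g x = g x' → f x = f x') ∧ ∀ x x', f x = f x' → κ x = κ x' → g x = g x'

theorem Refines.refl (κ : V → Option DegreeMap) (f : V → Option ℕ) : Refines κ f f :=
  ⟨fun _ _ h => h, fun _ _ h _ => h⟩

theorem Refines.trans {κ : V → Option DegreeMap} {f g h : V → Option ℕ} (h₁ : Refines κ f g)
    (h₂ : Refines κ g h) : Refines κ f h :=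
  ⟨fun x x' e => h₁.1 x x' (h₂.1 x x' e), fun x x' e e' => h₂.2 x x' (h₁.2 x x' e e') e'⟩

/-- A new block is created from the departing vertices with the given key. -/
theorem BlocksWF.newBlock [DecidableEq V] {κ : V → Option DegreeMap} {bx : ℕ}
    {kp : List DegreeMap} {sup : R → V → ℕ} {s : Store V R} (h : BlocksWF False κ bx kp sup s)
    (hbx : bx ∈ s.P) {B : Block V R} (hB : s.block bx = some B) (hne : B.vertices ≠ [])
    {key : DegreeMap} {vl : List V} (hkey : key ∉ kp) (hvl : B.departingBlocks.lookup key = some vl)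
    {x₀ : V} (hx₀ : x₀ ∈ vl) {sbm : ℕ → Option (SuperBlock R)} {Qm : R → Option SuperPartition}
    {c : ℕ → ℕ} {P : List ℕ} (hP : P.Perm (s.fresh :: s.P))
    (hwf : SuperWF (fun r i => ∃ x, sup r x = i)
      (fun r i b => (∃ x, s.vertexBlock x = some b ∧ sup r x = i) ∨ b = s.fresh ∧ i = sup r x₀)
      sbm Qm (s.fresh + 1)) :
    BlocksWF False κ bx (kp ++ [key]) sup
      { s with
        vertexBlock := fun x => if x ∈ vl then some s.fresh else s.vertexBlock x
        block := Function.update s.block s.fresh (some ⟨vl, fun r => some (sup r x₀), ∅⟩)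
        superBlock := sbm
        Q := Qm
        choices := c
        P := P
        fresh := s.fresh + 1 } ∧
    Refines κ s.vertexBlock (fun x => if x ∈ vl then some s.fresh else s.vertexBlock x) := by
  obtain ⟨B₁, hB₁, ⟨κ₀, -, hsh⟩, hs⟩ := h.block bx hbx
  obtain rfl : B₁ = B := Option.some.inj (hB₁.symm.trans hB)
  obtain ⟨hd1, hd2, hd3, hd4⟩ := hsh.departing key vl (by simp [hkey, hvl])
  have hlt : ∀ x, s.vertexBlock x ≠ some s.fresh := fun x hx =>
    lt_irrefl _ (h.lt_fresh _ (h.mem_P hx))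
  have hvb : ∀ b, b ≠ s.fresh → ∀ x, (if x ∈ vl then some s.fresh else s.vertexBlock x) = some b ↔
      x ∉ vl ∧ s.vertexBlock x = some b := by
    intro b hb x
    split_ifs with hx
    · simp [hx, Ne.symm hb]
    · simp [hx]
  have hvbf : ∀ x, (if x ∈ vl then some s.fresh else s.vertexBlock x) = some s.fresh ↔ x ∈ vl := by
    intro x
    split_ifs with hx
    · simp [hx]
    · simp [hx, hlt]
  -- A vertex that stays behind. It keeps the old block non-empty, and hence a member of its
  -- super-blocks.
  obtain ⟨x₁, hx₁⟩ := List.exists_mem_of_ne_nil _ hne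
  have hx₁vl : x₁ ∉ vl := fun hx => hd1 (((hd4 x₁).1 hx).2.symm.trans ((hsh.mem_verts x₁).1 hx₁).2)
  refine ⟨⟨?_, ?_, ?_, ?_, ?_⟩, ?_, ?_⟩
  · exact hP.nodup_iff.2 (List.nodup_cons.2 ⟨fun hf => lt_irrefl _ (h.lt_fresh _ hf), h.nodup⟩)
  · intro b hb
    rcases List.mem_cons.1 (hP.mem_iff.1 hb) with rfl | hb
    · exact Nat.lt_succ_self _
    · exact Nat.lt_succ_of_lt (h.lt_fresh b hb)
  · intro x
    obtain ⟨b, hb, hxb⟩ := h.vertexBlock x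
    dsimp only
    split_ifs with hx
    · exact ⟨_, hP.mem_iff.2 (by simp), rfl⟩
    · exact ⟨b, hP.mem_iff.2 (by simp [hb]), hxb⟩
  · intro b hb
    dsimp only at hb ⊢
    rcases List.mem_cons.1 (hP.mem_iff.1 hb) with rfl | hb
    · refine ⟨_, Function.update_self _ _ _, ⟨some key, False.elim, ?_⟩, ?_⟩
      · simp only [hvbf]
        refine ⟨⟨x₀, hx₀⟩, hd3, fun x => ?_, ?_, ?_⟩
        · simp only [iff_self_and]
          exact fun hx => ((hd4 x).1 hx).2
        · intro k l hl
          split_ifs at hl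
          simp at hl
        · exact fun x hx hx' => absurd ((hd4 x).1 hx).2 hx'
      · intro x hx r
        rw [hvbf] at hx
        exact congrArg some (h.sup_eq (((hd4 x₀).1 hx₀).1.trans ((hd4 x).1 hx).1.symm) r)
    · have hbf : b ≠ s.fresh := (h.lt_fresh b hb).ne
      obtain ⟨B', hB', ⟨κ₀', -, hsh'⟩, hs'⟩ := h.block b hb
      refine ⟨B', by rw [Function.update_of_ne hbf, hB'], ⟨κ₀', False.elim, ?_⟩, ?_⟩
      · simp only [hvb b hbf]
        by_cases hbb : b = bx
        · subst hbb
          obtain rfl : B' = B₁ := Option.some.inj (hB'.symm.trans hB)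
          have hκ' := ((hsh'.mem_verts x₁).1 hx₁).2
          refine ⟨⟨x₁, hx₁vl, ((hsh'.mem_verts x₁).1 hx₁).1⟩, hsh'.nodup, fun x => ?_, ?_, ?_⟩
          · rw [hsh'.mem_verts, and_assoc]
            refine ⟨fun hx => ⟨fun hxv => ?_, hx⟩, fun hx => hx.2⟩
            refine (hsh'.departing key vl (by simp [hkey, hvl])).1 ?_
            rw [← ((hd4 x).1 hxv).2, hx.2]
          · intro k l hl
            simp only [true_and, List.mem_append, List.mem_singleton] at hl
            split_ifs at hl with hk
            rw [not_or] at hk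
            obtain ⟨h1, h2, h3, h4⟩ := hsh'.departing k l (by simp [hk.1, hl])
            refine ⟨h1, h2, h3, fun x => ?_⟩
            rw [h4, and_assoc]
            refine ⟨fun hx => ⟨fun hxv => ?_, hx⟩, fun hx => hx.2⟩
            exact hk.2 (Option.some.inj (hx.2.symm.trans ((hd4 x).1 hxv).2))
          · rintro x ⟨hxv, hxb⟩ hκx
            obtain ⟨k, l, hk, hl⟩ := hsh'.cover x hxb hκx
            refine ⟨k, l, hk, ?_⟩
            have hkk : k ≠ key := by
              rintro rfl
              exact hxv ((hd4 x).2 ⟨hxb, hk⟩)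
            simpa [hkk] using hl
        · simp only [hbb, false_and, if_false] at hsh' ⊢
          have : ∀ x, x ∉ vl ∧ s.vertexBlock x = some b ↔ s.vertexBlock x = some b := by
            intro x
            rw [and_iff_right_iff_imp]
            intro hxb hxv
            exact hbb (Option.some.inj (hxb.symm.trans ((hd4 x).1 hxv).1))
          simp only [this]
          exact hsh'
      · intro x hx
        rw [hvb b hbf] at hx
        exact hs' x hx.2
  · refine hwf.mono (fun _ _ => Iff.rfl) ?_ le_rfl
    intro r i b _
    dsimp only
    by_cases hb : b = s.fresh
    · subst hb
      simp only [hvbf, hlt, false_and, exists_false, true_and, false_or]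
      constructor
      · rintro rfl
        exact ⟨x₀, hx₀, rfl⟩
      · rintro ⟨x, hx, rfl⟩
        exact h.sup_eq (((hd4 x).1 hx).1.trans ((hd4 x₀).1 hx₀).1.symm) r
    · simp only [hvb b hb, hb, false_and, or_false]
      constructor
      · rintro ⟨x, hx, rfl⟩
        by_cases hxv : x ∈ vl
        · have hbx := ((hd4 x).1 hxv).1
          obtain rfl : b = bx := Option.some.inj (hx.symm.trans hbx)
          have hx₁b := ((hsh.mem_verts x₁).1 hx₁).1
          exact ⟨x₁, ⟨hx₁vl, hx₁b⟩, h.sup_eq (hx₁b.trans hx.symm) r⟩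
        · exact ⟨x, ⟨hxv, hx⟩, rfl⟩
      · rintro ⟨x, ⟨-, hx⟩, rfl⟩
        exact ⟨x, hx, rfl⟩
  · intro x x' hxx
    by_cases hx : x ∈ vl <;> by_cases hx' : x' ∈ vl
    · exact ((hd4 x).1 hx).1.trans ((hd4 x').1 hx').1.symm
    · simp only [hx, hx', if_true, if_false] at hxx
      exact absurd hxx.symm (hlt x')
    · simp only [hx, hx', if_true, if_false] at hxx
      exact absurd hxx (hlt x)
    · simpa only [hx, hx', if_false] using hxx
  · intro x x' hxx hκ
    -- `vl` consists of all vertices of `bx` whose value of `κ` is `key`, so it cannot separate two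
    -- that agree in both respects.
    have : x ∈ vl ↔ x' ∈ vl := by rw [hd4, hd4, hxx, hκ]
    simp only [this, hxx]

/-- All lists of departing vertices of the block `bx` become blocks. -/
theorem wp_createBlocks [Fintype R] [DecidableEq V] [DecidableEq R] {κ : V → Option DegreeMap}
    {bx : ℕ} {sup : R → V → ℕ} {s : Store V R} (h : BlocksWF False κ bx [] sup s)
    (hbx : bx ∈ s.P) {B : Block V R} (hB : s.block bx = some B) (hne : B.vertices ≠ [])
    {ks : List DegreeMap} (hks : ks.Nodup) (hmem : ∀ k, k ∈ ks ↔ k ∈ B.departingBlocks.keys)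
    {Q : PUnit → Store V R → Prop}
    (hQ : ∀ vb bm sbm Qm c P fr,
      BlocksWF False κ bx ks sup { s with
        vertexBlock := vb, block := bm, superBlock := sbm, Q := Qm, choices := c, P := P,
        fresh := fr } →
      Refines κ s.vertexBlock vb → bm bx = some B → bx ∈ P → s.fresh ≤ fr →
      (∀ x b B', vb x = some b → bm b = some B' → b = bx ∨ B'.departingBlocks = ∅ ∨
        s.vertexBlock x = some b ∧ s.block b = some B') →
      Q ⟨⟩ { s with
        vertexBlock := vb, block := bm, superBlock := sbm, Q := Qm, choices := c, P := P,
        fresh := fr }) :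
    wp (forIn ks PUnit.unit fun key _ => do
      let vl ← deref (B.departingBlocks.lookup key)
      Block.create vl
      pure (ForInStep.yield PUnit.unit)) Q s := by
  -- The record of `bx` stays the same during the loop; the keys already used are retired through
  -- `pre`. The last clause says that any other block in use is new, without departing lists, or
  -- unchanged.
  refine wp_forIn (fun pre _ s' => ∃ vb bm sbm Qm c P fr, s' = { s with
      vertexBlock := vb, block := bm, superBlock := sbm, Q := Qm, choices := c, P := P,
      fresh := fr } ∧ BlocksWF False κ bx pre sup { s with
        vertexBlock := vb, block := bm, superBlock := sbm, Q := Qm, choices := c, P := P,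
        fresh := fr } ∧
      Refines κ s.vertexBlock vb ∧ bm bx = some B ∧ bx ∈ P ∧ s.fresh ≤ fr ∧
      ∀ x b B', vb x = some b → bm b = some B' → b = bx ∨ B'.departingBlocks = ∅ ∨
        s.vertexBlock x = some b ∧ s.block b = some B') ?_ ?_ ?_
  · exact ⟨_, _, _, _, _, _, _, rfl, h, Refines.refl _ _, hB, hbx, le_rfl,
      fun x b B' h1 h2 => Or.inr (Or.inr ⟨h1, h2⟩)⟩
  · rintro pre key suf _ s' hl ⟨vb, bm, sbm, Qm, c, P, fr, rfl, hwf, href, hbm, hbP, hfr, hold⟩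
    have hkey : key ∉ pre := by
      rw [hl] at hks
      exact fun hr => (List.disjoint_of_nodup_append hks) hr (by simp)
    have hkeys : key ∈ B.departingBlocks.keys := (hmem key).1 (by rw [hl]; simp)
    obtain ⟨vl, hvl⟩ := Option.isSome_iff_exists.1 (Finmap.lookup_isSome.2 (Finmap.mem_keys.1 hkeys))
    obtain ⟨B₁, hB₁, ⟨κ₀, -, hsh⟩, hs⟩ := hwf.block bx hbP
    obtain rfl : B₁ = B := Option.some.inj (hB₁.symm.trans hbm)
    obtain ⟨hd1, hd2, hd3, hd4⟩ := hsh.departing key vl (by simp [hkey, hvl])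
    -- `Block.create` looks up the super-blocks through the first vertex of the list, which still
    -- has the block `bx`.
    obtain ⟨x₀, tl, rfl⟩ := List.exists_cons_of_ne_nil hd2
    have hx₀ := ((hd4 x₀).1 (by simp)).1
    have hsup : B₁.superBlocks = fun r => some (sup r x₀) := funext (hs x₀ hx₀)
    simp only [Block.create, wp_bind, wp_deref, hvl, Option.some.injEq, exists_eq_left',
      wp_getVertexBlock, wp_getBlock, List.head?_cons]
    refine ⟨bx, hx₀, B₁, hbm, ?_⟩
    rw [hsup]
    refine wp_newBlock hwf.super (fun r => ⟨x₀, rfl⟩) ?_ ?_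
    · rintro r i - ⟨x, hx, -⟩
      exact lt_irrefl _ (hwf.lt_fresh _ (hwf.mem_P hx))
    · intro sbm' Qm' c' P' hP' hwf'
      rw [wp_pure]
      obtain ⟨h1, h2⟩ := hwf.newBlock (c := c') hbP hbm hne hkey hvl (x₀ := x₀) (by simp) hP' hwf'
      refine ⟨⟨⟩, rfl, _, _, _, _, _, _, _, rfl, h1, href.trans h2, ?_, ?_, ?_, ?_⟩
      · have := hwf.lt_fresh _ hbP
        rw [Function.update_of_ne (by exact this.ne)]
        exact hbm
      · exact hP'.mem_iff.2 (by simp [hbP])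
      · exact Nat.le_succ_of_le hfr
      · intro x b B' hx hb
        dsimp only at hx hb
        by_cases hbf : b = fr
        · subst hbf
          rw [Function.update_self] at hb
          exact Or.inr (Or.inl (by rw [← Option.some.inj hb]))
        · rw [Function.update_of_ne hbf] at hb
          split_ifs at hx with hxv
          · exact absurd (Option.some.inj hx).symm hbf
          · exact hold x b B' hx hb
  · rintro _ s' ⟨vb, bm, sbm, Qm, c, P, fr, rfl, hwf, href, hbm, hbP, hfr, hold⟩
    exact hQ vb bm sbm Qm c P fr hwf href hbm hbP hfr hold

end SCompCB

namespace SCompCB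

variable {V S R : Type} {α β : Type}

/-! ### Block-edges -/

/-- The map `m` tells for every degree how many members of `A` have it. -/
def Represents (deg : EdgeRef V R → unitInterval) (m : DegreeMap) (A : Set (EdgeRef V R)) : Prop :=
  ∀ d, m.lookup d =
    if {e ∈ A | deg e = d}.ncard = 0 then none else some {e ∈ A | deg e = d}.ncard

/-- Degrees that do not occur have no key, so a map is determined by the counts: comparing
block-edges is comparing multisets of degrees. -/
theorem Represents.eq_iff {deg : EdgeRef V R → unitInterval} {m m' : DegreeMap}
    {A A' : Set (EdgeRef V R)} (h : Represents deg m A) (h' : Represents deg m' A') :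
    m = m' ↔ ∀ d, {e ∈ A | deg e = d}.ncard = {e ∈ A' | deg e = d}.ncard := by
  constructor
  · rintro rfl d
    have := (h d).symm.trans (h' d)
    split_ifs at this with h1 h2 h2
    · rw [h1, h2]
    · exact Option.some.inj this
  · intro hd
    refine Finmap.ext_lookup fun d => ?_
    rw [h d, h' d, hd d]

theorem represents_empty (deg : EdgeRef V R → unitInterval) : Represents deg ∅ ∅ := by
  intro d
  simp

theorem wp_pushKey [Finite V] [Finite R] {deg : EdgeRef V R → unitInterval} {A : Set (EdgeRef V R)}
    {e : EdgeRef V R} {i : ℕ} {bE : BlockEdge} {s : Store V R} {Q : Unit → Store V R → Prop}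
    (hi : s.blockEdge i = some bE) (h : Represents deg bE.map A) (he : e ∉ A)
    (hQ : ∀ m, Represents deg m (insert e A) →
      Q () { s with blockEdge := Function.update s.blockEdge i (some { bE with map := m }) }) :
    wp (BlockEdge.pushKey i (deg e)) Q s := by
  have hset : {e' ∈ insert e A | deg e' = deg e} = insert e {e' ∈ A | deg e' = deg e} := by
    ext e'
    simp only [Set.mem_ofPred_eq, Set.mem_insert_iff]
    constructor
    · rintro ⟨rfl | h, h'⟩
      · exact Or.inl rfl
      · exact Or.inr ⟨h, h'⟩
    · rintro (rfl | ⟨h, h'⟩)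
      · exact ⟨Or.inl rfl, rfl⟩
      · exact ⟨Or.inr h, h'⟩
  have hcard : {e' ∈ insert e A | deg e' = deg e}.ncard =
      {e' ∈ A | deg e' = deg e}.ncard + 1 := by
    rw [hset, Set.ncard_insert_of_notMem (fun h => he h.1) (Set.toFinite _)]
  have hne : ∀ d, d ≠ deg e → {e' ∈ insert e A | deg e' = d} = {e' ∈ A | deg e' = d} := by
    intro d hd
    ext e'
    simp only [Set.mem_ofPred_eq, Set.mem_insert_iff]
    constructor
    · rintro ⟨rfl | h, h'⟩
      · exact absurd h'.symm hd
      · exact ⟨h, h'⟩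
    · exact fun h => ⟨Or.inr h.1, h.2⟩
  -- Both branches store the old count plus one, because an absent key means the count zero.
  have key : ∀ k, k = {e' ∈ A | deg e' = deg e}.ncard + 1 →
      Represents deg (bE.map.insert (deg e) k) (insert e A) := by
    intro k hk d
    by_cases hd : d = deg e
    · subst hd
      rw [Finmap.lookup_insert, hcard, hk]
      simp
    · rw [Finmap.lookup_insert_of_ne _ hd, hne d hd, h d]
  have hlk := h (deg e)
  simp only [BlockEdge.pushKey, wp_bind, wp_getBlockEdge, hi, Option.some.injEq, exists_eq_left']
  split
  · rename_i hl
    rw [wp_setBlockEdge]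
    refine hQ _ (key 1 ?_)
    rw [hl] at hlk
    split_ifs at hlk with h0
    rw [h0]
  · rename_i k hl
    rw [wp_setBlockEdge]
    refine hQ _ (key (k + 1) ?_)
    rw [hl] at hlk
    split_ifs at hlk with h0
    rw [Option.some.inj hlk]

theorem wp_popKey [Finite V] [Finite R] {deg : EdgeRef V R → unitInterval} {A : Set (EdgeRef V R)}
    {e : EdgeRef V R} {i : ℕ} {bE : BlockEdge} {s : Store V R} {Q : Unit → Store V R → Prop}
    (hi : s.blockEdge i = some bE) (h : Represents deg bE.map A) (he : e ∈ A)
    (hQ : ∀ m, Represents deg m (A \ {e}) →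
      Q () { s with blockEdge := Function.update s.blockEdge i (some { bE with map := m }) }) :
    wp (BlockEdge.popKey i (deg e)) Q s := by
  have hset : {e' ∈ A \ {e} | deg e' = deg e} = {e' ∈ A | deg e' = deg e} \ {e} := by
    ext e'
    simp only [Set.mem_ofPred_eq, Set.mem_sdiff, Set.mem_singleton_iff]
    tauto
  have hcard : {e' ∈ A \ {e} | deg e' = deg e}.ncard =
      {e' ∈ A | deg e' = deg e}.ncard - 1 := by
    rw [hset, Set.ncard_sdiff_singleton_of_mem
      (show e ∈ {e' ∈ A | deg e' = deg e} from ⟨he, rfl⟩)]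
  -- The edge itself is counted, so the key that is popped is present.
  have hpos : {e' ∈ A | deg e' = deg e}.ncard ≠ 0 :=
    Set.ncard_ne_zero_of_mem (a := e) ⟨he, rfl⟩ (Set.toFinite _)
  have hne : ∀ d, d ≠ deg e → {e' ∈ A \ {e} | deg e' = d} = {e' ∈ A | deg e' = d} := by
    intro d hd
    ext e'
    simp only [Set.mem_ofPred_eq, Set.mem_sdiff, Set.mem_singleton_iff]
    constructor
    · exact fun h => ⟨h.1.1, h.2⟩
    · refine fun h => ⟨⟨h.1, ?_⟩, h.2⟩
      rintro rfl
      exact hd h.2.symm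
  have hlk := h (deg e)
  rw [if_neg hpos] at hlk
  simp only [BlockEdge.popKey, wp_bind, wp_getBlockEdge, hi, Option.some.injEq, exists_eq_left',
    hlk, wp_ite, wp_setBlockEdge]
  constructor
  · intro h0
    refine hQ _ fun d => ?_
    by_cases hd : d = deg e
    · subst hd
      rw [Finmap.lookup_erase, hcard, if_pos h0]
    · rw [Finmap.lookup_erase_ne hd, hne d hd, h d]
  · intro h0
    refine hQ _ fun d => ?_
    by_cases hd : d = deg e
    · subst hd
      rw [Finmap.lookup_insert, hcard, if_neg h0]
    · rw [Finmap.lookup_insert_of_ne _ hd, hne d hd, h d]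

/-- The block-edges during ComputeBlockEdges when the edges `pre` have been treated: `A` is the set
of the edges, the edge `e` has the block-edge `be e`, and the references from `f` on are new. -/
structure DepartingWF (deg : EdgeRef V R → unitInterval) (A : Set (EdgeRef V R))
    (be : EdgeRef V R → ℕ) (f : ℕ) (pre : List (EdgeRef V R)) (bm : ℕ → Option BlockEdge)
    (f' : ℕ) : Prop where
  le : f ≤ f'
  blockEdge : ∀ e ∈ A, ∃ m dep, bm (be e) = some ⟨m, dep, none⟩ ∧
    Represents deg m {e' | e' ∈ A ∧ be e' = be e ∧ e' ∉ pre} ∧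
    ((∀ e' ∈ pre, be e' ≠ be e) ∧ dep = none ∨
      (∃ e' ∈ pre, be e' = be e) ∧ ∃ j m', dep = some j ∧ f ≤ j ∧ j < f' ∧
        bm j = some ⟨m', none, some (be e)⟩ ∧
        Represents deg m' {e' | e' ∈ A ∧ be e' = be e ∧ e' ∈ pre})

/-- Only the two block-edges belonging to `e` change. The hypothesis `hjs` keeps the departing
block-edges of different sources apart: `j` is either new or already has the source `be e`. -/
theorem DepartingWF.step {deg : EdgeRef V R → unitInterval} {A : Set (EdgeRef V R)}
    {be : EdgeRef V R → ℕ} {f : ℕ} {pre : List (EdgeRef V R)} {bm bm' : ℕ → Option BlockEdge}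
    {f' f'' : ℕ} (h : DepartingWF deg A be f pre bm f') (hlt : ∀ e ∈ A, be e < f)
    {e : EdgeRef V R} (he : e ∈ A) (hf : f' ≤ f'') {j : ℕ}
    (hj : f ≤ j) (hj' : j < f'')
    {m m' : DegreeMap} (hi : bm' (be e) = some ⟨m, some j, none⟩)
    (hbj : bm' j = some ⟨m', none, some (be e)⟩)
    (hm : Represents deg m {e' | e' ∈ A ∧ be e' = be e ∧ e' ∉ pre ++ [e]})
    (hm' : Represents deg m' {e' | e' ∈ A ∧ be e' = be e ∧ e' ∈ pre ++ [e]})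
    (hne : ∀ k, k ≠ be e → k ≠ j → bm' k = bm k)
    (hjs : ∀ a i, bm j = some a → a.sourceBlockEdge = some i → j < f' → i = be e) :
    DepartingWF deg A be f (pre ++ [e]) bm' f'' := by
  refine ⟨h.le.trans hf, fun e₁ he₁ => ?_⟩
  by_cases hb : be e₁ = be e
  · rw [hb]
    exact ⟨m, some j, hi, hm, Or.inr ⟨⟨e, by simp, rfl⟩, j, m', rfl, hj, hj', hbj, hm'⟩⟩
  · have hmem : ∀ e', be e' = be e₁ → (e' ∈ pre ++ [e] ↔ e' ∈ pre) := by
      intro e' he'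
      have : e' ≠ e := by
        rintro rfl
        exact hb he'.symm
      simp [this]
    have h1 : {e' | e' ∈ A ∧ be e' = be e₁ ∧ e' ∉ pre ++ [e]} =
        {e' | e' ∈ A ∧ be e' = be e₁ ∧ e' ∉ pre} := by
      ext e'
      simp only [Set.mem_ofPred_eq]
      exact and_congr_right fun _ => and_congr_right fun hx => not_congr (hmem e' hx)
    have h2 : {e' | e' ∈ A ∧ be e' = be e₁ ∧ e' ∈ pre ++ [e]} =
        {e' | e' ∈ A ∧ be e' = be e₁ ∧ e' ∈ pre} := by
      ext e'
      simp only [Set.mem_ofPred_eq]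
      exact and_congr_right fun _ => and_congr_right fun hx => hmem e' hx
    obtain ⟨m₁, dep, hm₁, hrep, hdep⟩ := h.blockEdge e₁ he₁
    have hne₁ : be e₁ ≠ j := (lt_of_lt_of_le (hlt e₁ he₁) hj).ne
    refine ⟨m₁, dep, by rw [hne _ hb hne₁, hm₁], by rwa [h1], ?_⟩
    rw [h2]
    rcases hdep with ⟨hd, rfl⟩ | ⟨⟨e₂, he₂, hbe₂⟩, j₁, m₁', rfl, hj₁, hj₁', hbj₁, hrep'⟩
    · left
      refine ⟨fun e' he' => ?_, rfl⟩
      rcases List.mem_append.1 he' with h' | h'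
      · exact hd e' h'
      · rw [List.mem_singleton.1 h']
        exact Ne.symm hb
    · right
      have hjj : j₁ ≠ j := by
        rintro rfl
        exact hb (hjs _ _ hbj₁ rfl hj₁')
      refine ⟨⟨e₂, by simp [he₂], hbe₂⟩, j₁, m₁', rfl, hj₁, hj₁'.trans_le hf, ?_, hrep'⟩
      rw [hne _ ((hlt e he).trans_le hj₁).ne' hjj, hbj₁]

/-- Each treated edge passes from the map of its block-edge to the map of the departing one. Since
`es` has no repetitions, an edge is still counted in its source map when its turn comes, so popping
succeeds. -/
theorem wp_computeBlockEdges [Finite V] [Finite R] [DecidableEq V] [DecidableEq R]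
    {deg : EdgeRef V R → unitInterval} {A : Set (EdgeRef V R)} {be : EdgeRef V R → ℕ}
    {ys : List V} {r : R} {es : List (EdgeRef V R)} {s : Store V R}
    (hes : es = (ys.flatMap s.comingEdges).filter fun e => e.label = r) (hnd : es.Nodup)
    (hA : ∀ e ∈ es, e ∈ A) (hedge : ∀ e ∈ A, s.edge e = some ⟨deg e, some (be e)⟩)
    (hlt : ∀ e ∈ A, be e < s.fresh)
    (hbe : ∀ e ∈ A, ∃ m, s.blockEdge (be e) = some ⟨m, none, none⟩ ∧
      Represents deg m {e' | e' ∈ A ∧ be e' = be e})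
    {Q : Unit → Store V R → Prop}
    (hQ : ∀ bm f, DepartingWF deg A be s.fresh es bm f →
      Q () { s with blockEdge := bm, fresh := f }) :
    wp (computeBlockEdges ys r) Q s := by
  unfold computeBlockEdges
  refine wp_forIn_comingEdges s.comingEdges es hes
    (fun pre s' => ∃ bm f, DepartingWF deg A be s.fresh pre bm f ∧
      s' = { s with blockEdge := bm, fresh := f }) ?_ ?_ ?_ ?_
  · rintro pre s' ⟨bm, f, -, rfl⟩
    rfl
  · refine ⟨s.blockEdge, s.fresh, ⟨le_rfl, fun e he => ?_⟩, rfl⟩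
    obtain ⟨m, hm, hr⟩ := hbe e he
    exact ⟨m, none, hm, by simpa using hr, Or.inl ⟨by simp, rfl⟩⟩
  · rintro pre e suf s' hl ⟨bm, f, hwf, rfl⟩
    have heA : e ∈ A := hA e (by rw [hl]; simp)
    have hepre : e ∉ pre := by
      rw [hl] at hnd
      exact fun hr => (List.disjoint_of_nodup_append hnd) hr (by simp)
    obtain ⟨m, dep, hm, hrep, hdep⟩ := hwf.blockEdge e heA
    have hltf : be e < f := (hlt e heA).trans_le hwf.le
    have hset1 : {e' | e' ∈ A ∧ be e' = be e ∧ e' ∉ pre ++ [e]} =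
        {e' | e' ∈ A ∧ be e' = be e ∧ e' ∉ pre} \ {e} := by
      ext e'
      simp only [Set.mem_ofPred_eq, Set.mem_sdiff, Set.mem_singleton_iff, List.mem_append,
        List.mem_singleton]
      tauto
    have hset2 : {e' | e' ∈ A ∧ be e' = be e ∧ e' ∈ pre ++ [e]} =
        insert e {e' | e' ∈ A ∧ be e' = be e ∧ e' ∈ pre} := by
      ext e'
      simp only [Set.mem_ofPred_eq, Set.mem_insert_iff, List.mem_append, List.mem_singleton]
      constructor
      · rintro ⟨h1, h2, h3 | h3⟩
        · exact Or.inr ⟨h1, h2, h3⟩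
        · exact Or.inl h3
      · rintro (rfl | ⟨h1, h2, h3⟩)
        · exact ⟨heA, rfl, Or.inr rfl⟩
        · exact ⟨h1, h2, Or.inl h3⟩
    simp only [wp_bind, wp_getEdge, hedge e heA, Option.some.injEq, exists_eq_left', wp_deref,
      wp_getBlockEdge, hm]
    rcases hdep with ⟨hd, rfl⟩ | ⟨⟨e₂, he₂, hbe₂⟩, j, m', rfl, hj, hj', hbj, hrep'⟩
    · have hempty : {e' | e' ∈ A ∧ be e' = be e ∧ e' ∈ pre} = ∅ := by
        ext e'
        simp only [Set.mem_ofPred_eq, Set.mem_empty_iff_false, iff_false]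
        exact fun h => hd e' h.2.2 h.2.1
      simp only [if_true, BlockEdge.new, wp_bind, wp_newRef, wp_setBlockEdge, wp_pure,
        wp_getBlockEdge, Function.update_self, Option.some.injEq, exists_eq_left', wp_deref]
      refine wp_popKey (Function.update_self _ _ _) hrep ⟨heA, rfl, hepre⟩ fun m₁ hm₁ => ?_
      refine wp_pushKey (i := f) (bE := ⟨∅, none, some (be e)⟩) ?_ (represents_empty deg)
        (Set.notMem_empty e) fun m₂ hm₂ => ?_
      · simp [hltf.ne']
      · refine ⟨trivial, _, _, ?_, rfl⟩
        refine hwf.step hlt heA (Nat.le_succ f) hwf.le (Nat.lt_succ_self f) (m := m₁)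
          (m' := m₂) ?_ (Function.update_self _ _ _) (by rwa [hset1]) (by rwa [hset2, hempty]) ?_ ?_
        · simp [hltf.ne]
        · intro k hk hk'
          simp [hk, hk']
        -- The departing block-edge has just got the reference `f`, so it is not one of those below
        -- `f`.
        · exact fun a i _ _ h => absurd h (lt_irrefl _)
    · have hne : be e ≠ j := ((hlt e heA).trans_le hj).ne
      simp only [reduceCtorEq, if_false, wp_bind, wp_getBlockEdge, hm, Option.some.injEq,
        exists_eq_left', wp_deref]
      refine wp_popKey hm hrep ⟨heA, rfl, hepre⟩ fun m₁ hm₁ => ?_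
      refine wp_pushKey (i := j) (bE := ⟨m', none, some (be e)⟩) ?_ hrep'
        (fun h => hepre h.2.2) fun m₂ hm₂ => ?_
      · simp [hne.symm, hbj]
      · rw [wp_pure]
        refine ⟨rfl, _, _, ?_, rfl⟩
        refine hwf.step hlt heA le_rfl hj hj' (m := m₁)
          (m' := m₂) ?_ (Function.update_self _ _ _) (by rwa [hset1]) (by rwa [hset2]) ?_ ?_
        · simp [hne]
        · intro k hk hk'
          simp [hk, hk']
        · intro a i ha hi _
          rw [hbj] at ha
          rw [← Option.some.inj ha] at hi
          exact (Option.some.inj hi).symm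
  · rintro s' ⟨bm, f, hwf, rfl⟩
    exact hQ bm f hwf

end SCompCB

/-! ### Departing vertices, and the separation of a block from its super-block. -/

namespace SCompCB

variable {V S R : Type} {α β : Type}

theorem BlocksWF.of_eq {p : Prop} {κ κ' : V → Option DegreeMap} {bx : ℕ} {kp : List DegreeMap}
    {sup : R → V → ℕ} {s : Store V R} (h : BlocksWF p κ bx kp sup s) (hκ : κ = κ') :
    BlocksWF p κ' bx kp sup s := hκ ▸ h

/-- The invariant is the shape for `κ` cut down to the origins of the treated edges, and the flags
mark exactly these origins. Skipping a flagged vertex is harmless because the key `κ e.origin`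
depends only on the origin. -/
theorem wp_sComputeSubblocks [DecidableEq V] [DecidableEq R]
    {deg : EdgeRef V R → unitInterval} {be : EdgeRef V R → ℕ} {sup : R → V → ℕ}
    {κ : V → Option DegreeMap} {ys : List V} {r : R} {es : List (EdgeRef V R)} {s : Store V R}
    (hes : es = (ys.flatMap s.comingEdges).filter fun e => e.label = r)
    (hedge : ∀ e ∈ es, s.edge e = some ⟨deg e, some (be e)⟩)
    (hκ : ∀ e ∈ es, ∃ a, s.blockEdge (be e) = some a ∧ κ e.origin = some a.map)
    (hκ' : ∀ x, (∀ e ∈ es, e.origin ≠ x) → κ x = none)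
    (hpr : ∀ x, s.processed x = false) (hwf : BlocksWF True (fun _ => none) 0 [] sup s)
    {Q : Unit → Store V R → Prop}
    (hQ : ∀ bm pr c, BlocksWF True κ 0 [] sup { s with block := bm, processed := pr, choices := c } →
      (∀ x, pr x = true → ∃ e ∈ es, e.origin = x) →
      Q () { s with block := bm, processed := pr, choices := c }) :
    wp (sComputeSubblocks ys r) Q s := by
  unfold sComputeSubblocks
  refine wp_forIn_comingEdges s.comingEdges es hes
    (fun pre s' => ∃ bm pr c, s' = { s with block := bm, processed := pr, choices := c } ∧
      BlocksWF True (fun x => if x ∈ pre.map EdgeRef.origin then κ x else none) 0 [] sup s' ∧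
      ∀ x, pr x = true ↔ x ∈ pre.map EdgeRef.origin) ?_ ?_ ?_ ?_
  · rintro pre s' ⟨bm, pr, c, rfl, -⟩
    rfl
  · exact ⟨s.block, s.processed, s.choices, rfl, by simpa using hwf, by simp [hpr]⟩
  · rintro pre e suf s' hl ⟨bm, pr, c, rfl, hwf', hpr'⟩
    have hees : e ∈ es := by rw [hl]; simp
    obtain ⟨a, ha, hκe⟩ := hκ e hees
    obtain ⟨b, hb, hxb⟩ := hwf'.vertexBlock e.origin
    obtain ⟨B, hB, ⟨κ₀, hκ₀, hsh⟩, hs⟩ := hwf'.block b hb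
    obtain rfl := hκ₀ trivial
    dsimp only at hxb hB
    simp only [wp_bind, wp_getVertexBlock, hxb, Option.some.injEq, exists_eq_left', wp_get, wp_ite,
      wp_getEdge, hedge e hees, wp_deref, wp_getBlockEdge, ha, wp_getBlock, hB]
    constructor
    · intro hp
      have hx : e.origin ∉ pre.map EdgeRef.origin := by
        rw [← hpr', hp]
        simp
      have hκpre : (if e.origin ∈ pre.map EdgeRef.origin then κ e.origin else none) = none :=
        if_neg hx
      have hverts : e.origin ∈ B.vertices := (hsh.mem_verts _).2 ⟨hxb, hκpre⟩
      have hup : Function.update (fun x => if x ∈ pre.map EdgeRef.origin then κ x else none)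
          e.origin (some a.map) =
          fun x => if x ∈ (pre ++ [e]).map EdgeRef.origin then κ x else none := by
        funext x
        by_cases hxe : x = e.origin
        · subst hxe; simp [hκe]
        · rw [Function.update_of_ne hxe]
          exact if_congr (by simp [hxe]) rfl rfl
      have hprup : ∀ x, Function.update pr e.origin true x = true ↔
          x ∈ (pre ++ [e]).map EdgeRef.origin := by
        intro x
        by_cases hxe : x = e.origin
        · subst hxe; simp
        · rw [Function.update_of_ne hxe, hpr']
          simp [hxe]
      constructor
      · intro hk
        have hk' := Finmap.lookup_eq_none.2 hk
        simp only [wp_setBlock, Function.update_self, Option.some.injEq,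
          exists_eq_left']
        refine wp_remove hverts ?_
        simp only [Finmap.lookup_insert, Option.some.injEq, exists_eq_left']
        refine wp_add fun moved c' hmoved => ?_
        simp only [wp_setProcessed, wp_pure, Function.update_idem]
        refine ⟨trivial, _, _, _, rfl, (hwf'.moveVertex hxb hκpre hB
          (B' := ⟨B.vertices.erase e.origin, B.superBlocks, _⟩) rfl rfl (key := a.map)
          (moved := moved) ?_ ?_).of_eq hup, hprup⟩
        · simpa [hk'] using hmoved
        · intro k
          by_cases hkk : k = a.map
          · subst hkk; simp
          · simp [hkk, Finmap.lookup_insert_of_ne]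
      · intro hk
        rw [not_not] at hk
        obtain ⟨l, hl'⟩ := Option.isSome_iff_exists.1 (Finmap.lookup_isSome.2 hk)
        refine wp_remove hverts ?_
        simp only [hl', Option.some.injEq, exists_eq_left']
        refine wp_add fun moved c' hmoved => ?_
        simp only [wp_setBlock, wp_setProcessed, wp_pure]
        refine ⟨trivial, _, _, _, rfl, (hwf'.moveVertex hxb hκpre hB
          (B' := ⟨B.vertices.erase e.origin, B.superBlocks, _⟩) rfl rfl (key := a.map)
          (moved := moved) ?_ ?_).of_eq hup, hprup⟩
        · simpa [hl'] using hmoved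
        · intro k
          by_cases hkk : k = a.map
          · subst hkk; simp
          · simp [hkk, Finmap.lookup_insert_of_ne]
    · intro hp
      have hx : e.origin ∈ pre.map EdgeRef.origin := by
        rw [← hpr']
        simpa using hp
      have hiff : ∀ x, x ∈ (pre ++ [e]).map EdgeRef.origin ↔ x ∈ pre.map EdgeRef.origin := by
        intro x
        simp only [List.map_append, List.mem_append, List.map_cons, List.map_nil,
          List.mem_singleton, or_iff_left_iff_imp]
        rintro rfl
        exact hx
      rw [wp_pure]
      refine ⟨rfl, bm, pr, c, rfl, ?_, fun x => (hpr' x).trans (hiff x).symm⟩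
      simp only [hiff]
      exact hwf'
  · rintro s' ⟨bm, pr, c, rfl, hwf', hpr'⟩
    refine hQ bm pr c (hwf'.of_eq (funext fun x => ?_)) fun x hx => ?_
    · split_ifs with hx
      · rfl
      · refine (hκ' x fun e he hex => hx ?_).symm
        exact List.mem_map.2 ⟨e, he, hex⟩
    · simpa using (hpr' x).1 hx

/-- The block `b` is removed from its super-block `i` of label `r`; it becomes a super-block. -/
theorem wp_separateBlock [DecidableEq V] [DecidableEq R] {p : Prop} {κ : V → Option DegreeMap}
    {sup : R → V → ℕ} {s : Store V R} (h : BlocksWF p κ 0 [] sup s) {i b : ℕ} {r : R}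
    {x₀ x₁ : V} (hx₀ : s.vertexBlock x₀ = some b) (hi : sup r x₀ = i)
    (hx₁ : sup r x₁ = i) (hx₁b : s.vertexBlock x₁ ≠ some b) {Q : Unit → Store V R → Prop}
    (hQ : ∀ bm sbm Qm c,
      BlocksWF p κ 0 []
        (fun r' x => if r' = r ∧ s.vertexBlock x = some b then s.fresh else sup r' x)
        { s with block := bm, superBlock := sbm, Q := Qm, choices := c, fresh := s.fresh + 1 } →
      Q () { s with block := bm, superBlock := sbm, Q := Qm, choices := c, fresh := s.fresh + 1 }) :
    wp (do
      SuperBlock.removeBlock i b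
      let Y ← getSuperBlock i
      SuperBlock.create Y.superPartition b r) Q s := by
  rw [wp_bind]
  refine wp_removeBlock h.super ⟨x₀, hi⟩ ⟨x₀, hx₀, hi⟩ fun sbm Qm c hwf => ?_
  obtain ⟨q, hq, -, -, hall⟩ := hwf r
  obtain ⟨-, bs, hbs, -⟩ := hall i ⟨x₀, hi⟩
  have hbP := h.mem_P hx₀
  obtain ⟨B, hB, hsh, hs⟩ := h.block b hbP
  simp only [wp_bind, wp_getSuperBlock, hbs, Option.some.injEq, exists_eq_left', SuperBlock.create]
  have hlt : ∀ r x, sup r x < s.fresh := fun r x => h.super.lt ⟨x, rfl⟩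
  refine wp_newSuperBlock hq fun l c' hl => ?_
  have hwf2 := hwf.newSuperBlock hq (by
    rintro b' ⟨⟨x, -, hx⟩, -⟩
    exact (hlt r x).ne hx) hl
  refine wp_addBlock hwf2 (r := r) (Or.inr ⟨rfl, rfl⟩) (by
    rintro ⟨⟨x, -, hx⟩, -⟩
    exact (hlt r x).ne hx) fun sbm' Qm' c'' hwf3 => ?_
  simp only [wp_getBlock, hB, Option.some.injEq, exists_eq_left', wp_setBlock]
  refine hQ _ _ _ _ ⟨h.nodup, fun b' hb' => Nat.lt_succ_of_lt (h.lt_fresh b' hb'), h.vertexBlock,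
    ?_, ?_⟩
  · intro b' hb'
    by_cases hbb : b' = b
    · subst hbb
      refine ⟨_, Function.update_self _ _ _, hsh, fun x hx r' => ?_⟩
      dsimp only at hx ⊢
      by_cases hr : r' = r
      · subst hr; simp [hx]
      · simp [hr, hs x hx]
    · obtain ⟨B', hB', hsh', hs'⟩ := h.block b' hb'
      refine ⟨B', by simp [hbb, hB'], hsh', fun x hx r' => ?_⟩
      dsimp only at hx ⊢
      rw [if_neg, hs' x hx]
      rintro ⟨-, hx'⟩
      exact hbb (Option.some.inj (hx.symm.trans hx'))
  · refine hwf3.mono ?_ ?_ le_rfl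
    · intro r' j
      constructor
      · rintro (⟨x, rfl⟩ | ⟨rfl, rfl⟩)
        · by_cases hc : r' = r ∧ s.vertexBlock x = some b
          · obtain ⟨rfl, hx⟩ := hc
            -- The vertex `x₁` lies in the old super-block but outside `b`, so the old super-block
            -- does not disappear.
            refine ⟨x₁, ?_⟩
            rw [if_neg fun hc => hx₁b hc.2, hx₁, ← hi]
            exact h.sup_eq (hx₀.trans hx.symm) r'
          · exact ⟨x, if_neg hc⟩
        · exact ⟨x₀, if_pos ⟨rfl, hx₀⟩⟩
      · rintro ⟨x, rfl⟩
        split_ifs with hc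
        · exact Or.inr ⟨hc.1, rfl⟩
        · exact Or.inl ⟨x, rfl⟩
    · intro r' j b' _
      dsimp only
      constructor
      · rintro (⟨⟨x, hx, rfl⟩, hne⟩ | ⟨rfl, rfl, rfl⟩)
        · refine ⟨x, hx, if_neg ?_⟩
          rintro ⟨rfl, hx'⟩
          refine hne ⟨rfl, ?_, Option.some.inj (hx.symm.trans hx')⟩
          rw [← hi]
          exact h.sup_eq (hx'.trans hx₀.symm) r'
        · exact ⟨x₀, hx₀, if_pos ⟨rfl, hx₀⟩⟩
      · rintro ⟨x, hx, rfl⟩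
        split_ifs with hc
        · exact Or.inr ⟨hc.1, rfl, Option.some.inj (hx.symm.trans hc.2)⟩
        · refine Or.inl ⟨⟨x, hx, rfl⟩, ?_⟩
          rintro ⟨hr, -, rfl⟩
          exact hc ⟨hr, hx⟩

theorem BlocksWF.weaken {p : Prop} {κ : V → Option DegreeMap} {bx : ℕ} {kp : List DegreeMap}
    {sup : R → V → ℕ} {s : Store V R} (h : BlocksWF p κ bx kp sup s) :
    BlocksWF False κ bx kp sup s := by
  refine ⟨h.nodup, h.lt_fresh, h.vertexBlock, fun b hb => ?_, h.super⟩
  obtain ⟨B, hB, ⟨κ₀, -, hsh⟩, hs⟩ := h.block b hb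
  exact ⟨B, hB, ⟨κ₀, False.elim, hsh⟩, hs⟩

/-- Without retired keys the block `bx` plays no role; the 0 that occurs elsewhere is a placeholder.
-/
theorem BlocksWF.of_nil {p : Prop} {κ : V → Option DegreeMap} {bx bx' : ℕ}
    {sup : R → V → ℕ} {s : Store V R} (h : BlocksWF p κ bx [] sup s) :
    BlocksWF p κ bx' [] sup s := by
  refine ⟨h.nodup, h.lt_fresh, h.vertexBlock, fun b hb => ?_, h.super⟩
  simpa using h.block b hb

/-- The map of the departing blocks is emptied. -/
theorem BlocksWF.clear {κ : V → Option DegreeMap} {bx : ℕ} {ks : List DegreeMap}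
    {sup : R → V → ℕ} {s : Store V R} (h : BlocksWF False κ bx ks sup s) {B : Block V R}
    (hB : s.block bx = some B) (hks : ∀ k, k ∈ B.departingBlocks.keys → k ∈ ks) :
    BlocksWF False κ 0 [] sup { s with
      block := Function.update s.block bx (some ⟨B.vertices, B.superBlocks, ∅⟩) } := by
  refine ⟨h.nodup, h.lt_fresh, h.vertexBlock, fun b hb => ?_, h.super⟩
  obtain ⟨B', hB', ⟨κ₀, -, hsh⟩, hs⟩ := h.block b hb
  by_cases hbb : b = bx
  · subst hbb
    obtain rfl : B' = B := Option.some.inj (hB'.symm.trans hB)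
    refine ⟨_, Function.update_self _ _ _, ⟨κ₀, False.elim, ?_⟩, hs⟩
    convert hsh using 2 with k
    simp only [List.not_mem_nil, and_false, if_false, Finmap.lookup_empty, true_and]
    split_ifs with hk
    · rfl
    · exact (Finmap.lookup_eq_none.2 fun hk' => hk (hks k (Finmap.mem_keys.2 hk'))).symm
  · refine ⟨B', by simp [hbb, hB'], ⟨κ₀, False.elim, ?_⟩, hs⟩
    simpa [hbb] using hsh

/-- If no vertices remain in the block, then the list of some key becomes the list of vertices. -/
theorem BlocksWF.pickKey {κ : V → Option DegreeMap} {bx : ℕ}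
    {sup : R → V → ℕ} {s : Store V R} (h : BlocksWF False κ bx [] sup s) {B : Block V R}
    (hB : s.block bx = some B) (hverts : B.vertices = []) {key : DegreeMap} {vl : List V}
    (hvl : B.departingBlocks.lookup key = some vl) {c : ℕ → ℕ} :
    BlocksWF False κ bx [] sup { s with
      block := Function.update s.block bx
        (some ⟨vl, B.superBlocks, B.departingBlocks.erase key⟩), choices := c } := by
  refine ⟨h.nodup, h.lt_fresh, h.vertexBlock, fun b hb => ?_, h.super⟩
  obtain ⟨B', hB', ⟨κ₀, -, hsh⟩, hs⟩ := h.block b hb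
  by_cases hbb : b = bx
  · subst hbb
    obtain rfl : B' = B := Option.some.inj (hB'.symm.trans hB)
    refine ⟨_, Function.update_self _ _ _, ⟨some key, False.elim, ?_⟩, hs⟩
    simp only [List.not_mem_nil, and_false, if_false] at hsh ⊢
    obtain ⟨h1, h2, h3, h4⟩ := hsh.departing key vl hvl
    refine ⟨hsh.nonempty, h3, h4, ?_, ?_⟩
    · intro k l hl
      by_cases hk : k = key
      · subst hk
        simp at hl
      · rw [Finmap.lookup_erase_ne hk] at hl
        obtain ⟨-, h2, h3, h4⟩ := hsh.departing k l hl
        exact ⟨by simpa using hk, h2, h3, h4⟩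
    · intro x hx hκ
      -- The vertices with the value `κ₀` are those in the list `vertices`, and this list is empty.
      have hκ₀ : κ x ≠ κ₀ := fun hc => by
        have := (hsh.mem_verts x).2 ⟨hx, hc⟩
        simp [hverts] at this
      obtain ⟨k, l, hk, hl⟩ := hsh.cover x hx hκ₀
      refine ⟨k, l, hk, ?_⟩
      rw [Finmap.lookup_erase_ne, hl]
      rintro rfl
      exact hκ hk
  · refine ⟨B', by simp [hbb, hB'], ⟨κ₀, False.elim, ?_⟩, hs⟩
    simpa using hsh

end SCompCB

/-! ### Carrying out a split and clearing its auxiliary references. -/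

namespace SCompCB

variable {V S R : Type} {α β : Type}

/-- Regroups a program so that its first three commands can be handled together by
`wp_separateBlock`. -/
theorem wp_bind₃ {γ δ : Type} {p : Prog V R α} {q : Prog V R β} {f : β → Prog V R γ}
    {g : Prog V R δ} {Q : δ → Store V R → Prop} {s : Store V R} :
    wp (p >>= fun _ => q >>= fun b => f b >>= fun _ => g) Q s ↔
      wp (p >>= fun _ => q >>= fun b => f b) (fun _ s' => wp g Q s') s := by
  simp only [wp_bind]

/-- If `κ` is constant on the blocks and there are no departing vertices, the splitting is over. -/
theorem BlocksWF.finish {p : Prop} {κ : V → Option DegreeMap} {sup : R → V → ℕ} {s : Store V R}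
    (h : BlocksWF p κ 0 [] sup s)
    (hdep : ∀ x b B, s.vertexBlock x = some b → s.block b = some B → κ x ≠ none →
      B.departingBlocks = ∅)
    (hnone : ∀ b B k l, s.block b = some B → b ∈ s.P → B.departingBlocks.lookup k = some l →
      ∃ x, s.vertexBlock x = some b ∧ κ x ≠ none) :
    BlocksWF True (fun _ => none) 0 [] sup s ∧
      ∀ x x', s.vertexBlock x = s.vertexBlock x' → κ x = κ x' := by
  -- By `hnone` a departing list would yield a vertex of the block with `κ x ≠ none`, and by `hdep`
  -- the block of such a vertex has no departing lists.
  have hempty : ∀ b ∈ s.P, ∀ B, s.block b = some B → ∀ k, B.departingBlocks.lookup k = none := by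
    intro b hb B hB k
    by_contra hc
    obtain ⟨l, hl⟩ := Option.ne_none_iff_exists'.1 hc
    obtain ⟨x, hx, hκ⟩ := hnone b B k l hB hb hl
    rw [hdep x b B hx hB hκ] at hl
    simp at hl
  have hconst : ∀ b ∈ s.P, ∀ B κ₀, s.block b = some B →
      Shape κ κ₀ (fun x => s.vertexBlock x = some b) B.vertices
        (fun k => if b = 0 ∧ k ∈ ([] : List DegreeMap) then none else B.departingBlocks.lookup k) →
      ∀ x, s.vertexBlock x = some b → κ x = κ₀ := by
    intro b hb B κ₀ hB hsh x hx
    by_contra hc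
    obtain ⟨k, l, -, hl⟩ := hsh.cover x hx hc
    simp [hempty b hb B hB k] at hl
  refine ⟨⟨h.nodup, h.lt_fresh, h.vertexBlock, fun b hb => ?_, h.super⟩, fun x x' hxx => ?_⟩
  · obtain ⟨B, hB, ⟨κ₀, -, hsh⟩, hs⟩ := h.block b hb
    have hc := hconst b hb B κ₀ hB hsh
    refine ⟨B, hB, ⟨none, fun _ => rfl, hsh.nonempty, hsh.nodup, fun x => ?_, ?_, ?_⟩, hs⟩
    · rw [hsh.mem_verts]
      exact and_congr_right fun hx => iff_of_true (hc x hx) rfl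
    · intro k l hl
      simp [hempty b hb B hB k] at hl
    · exact fun x _ hx => absurd rfl hx
  · obtain ⟨b, hb, hxb⟩ := h.vertexBlock x
    obtain ⟨B, hB, ⟨κ₀, -, hsh⟩, hs⟩ := h.block b hb
    have hc := hconst b hb B κ₀ hB hsh
    exact (hc x hxb).trans (hc x' (hxx ▸ hxb)).symm

/-- The final blocks are the classes of "same old block and same `κ`". One half holds throughout the
loop as `Refines`; the other holds at the end, because the block of every origin of a treated edge
has no departing lists left. -/
theorem wp_sDoSplitting [Fintype R] [DecidableEq V] [DecidableEq R]
    {deg : EdgeRef V R → unitInterval} {be dj : EdgeRef V R → ℕ} {sup : R → V → ℕ}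
    {κ : V → Option DegreeMap} {ys : List V} {r : R} {es : List (EdgeRef V R)} {s : Store V R}
    (hes : es = (ys.flatMap s.comingEdges).filter fun e => e.label = r) (hnd : es.Nodup)
    (hedge : ∀ e ∈ es, s.edge e = some ⟨deg e, some (be e)⟩)
    (hdj : ∀ e ∈ es, ∃ a, s.blockEdge (be e) = some a ∧ a.departingBlockEdge = some (dj e))
    (hκ : ∀ x, κ x ≠ none → ∃ e ∈ es, e.origin = x)
    (hwf : BlocksWF True κ 0 [] sup s) {i b : ℕ} {x₀ x₁ : V} (hx₀ : s.vertexBlock x₀ = some b)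
    (hi : sup r x₀ = i) (hx₁ : sup r x₁ = i) (hx₁b : s.vertexBlock x₁ ≠ some b)
    {Q : Unit → Store V R → Prop}
    (hQ : ∀ em vb bm sbm Qm c P fr, (∀ e ∈ es, em e = some ⟨deg e, some (dj e)⟩) →
      (∀ e, e ∉ es → em e = s.edge e) →
      BlocksWF True (fun _ => none) 0 []
        (fun r' x => if r' = r ∧ s.vertexBlock x = some b then s.fresh else sup r' x)
        { s with
          edge := em, vertexBlock := vb, block := bm, superBlock := sbm, Q := Qm, choices := c,
          P := P, fresh := fr } →
      (∀ x x', vb x = vb x' ↔ s.vertexBlock x = s.vertexBlock x' ∧ κ x = κ x') → s.fresh < fr →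
      Q () { s with
          edge := em, vertexBlock := vb, block := bm, superBlock := sbm, Q := Qm, choices := c,
          P := P, fresh := fr }) :
    wp (sDoSplitting b ys i r) Q s := by
  unfold sDoSplitting
  refine wp_bind₃ (β := SuperBlock R) (γ := Unit) (δ := Unit).2
    (wp_separateBlock hwf hx₀ hi hx₁ hx₁b fun bm₀ sbm₀ Qm₀ c₀ hwf₀ => ?_)
  set sup' : R → V → ℕ :=
    fun r' x => if r' = r ∧ s.vertexBlock x = some b then s.fresh else sup r' x
  refine wp_forIn_comingEdges s.comingEdges es hes
    (fun pre s' => ∃ em vb bm sbm Qm c P fr, s' = { s with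
          edge := em, vertexBlock := vb, block := bm, superBlock := sbm, Q := Qm, choices := c,
          P := P, fresh := fr } ∧
      (∀ e ∈ pre, em e = some ⟨deg e, some (dj e)⟩) ∧ (∀ e, e ∉ pre → em e = s.edge e) ∧
      BlocksWF False κ 0 [] sup' s' ∧ Refines κ s.vertexBlock vb ∧ s.fresh < fr ∧
      ∀ e ∈ pre, ∀ b B, vb e.origin = some b → bm b = some B → B.departingBlocks = ∅) ?_ ?_ ?_ ?_
  · rintro pre s' ⟨em, vb, bm, sbm, Qm, c, P, fr, rfl, -⟩
    rfl
  · exact ⟨s.edge, s.vertexBlock, bm₀, sbm₀, Qm₀, c₀, s.P, s.fresh + 1, rfl, by simp, by simp,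
      hwf₀.weaken, Refines.refl _ _, Nat.lt_succ_self _, by simp⟩
  · rintro pre e suf s' hl ⟨em, vb, bm, sbm, Qm, c, P, fr, rfl, hem, hem', hwf', href, hfr, hdep⟩
    have hees : e ∈ es := by rw [hl]; simp
    have hepre : e ∉ pre := by
      rw [hl] at hnd
      exact fun hr => (List.disjoint_of_nodup_append hnd) hr (by simp)
    obtain ⟨a, ha, hadj⟩ := hdj e hees
    have hee : em e = some ⟨deg e, some (be e)⟩ := by rw [hem' e hepre, hedge e hees]
    obtain ⟨bx, hbx, hxb⟩ := hwf'.vertexBlock e.origin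
    obtain ⟨B, hB, hshs⟩ := hwf'.block bx hbx
    dsimp only at hbx hxb hB
    have hup1 : ∀ e' ∈ pre ++ [e],
        Function.update em e (some ⟨deg e, some (dj e)⟩) e' = some ⟨deg e', some (dj e')⟩ := by
      intro e' he'
      by_cases h : e' = e
      · subst h; simp
      · rw [Function.update_of_ne h]
        exact hem e' ((List.mem_append.1 he').resolve_right (by simpa using h))
    have hup2 : ∀ e', e' ∉ pre ++ [e] →
        Function.update em e (some ⟨deg e, some (dj e)⟩) e' = s.edge e' := by
      intro e' he'
      simp only [List.mem_append, List.mem_singleton, not_or] at he'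
      rw [Function.update_of_ne he'.2, hem' e' he'.1]
    simp only [wp_bind, wp_getEdge, hee, Option.some.injEq, exists_eq_left', wp_deref,
      wp_getBlockEdge, ha, hadj, wp_setEdge, wp_getVertexBlock, hxb, wp_getBlock, hB, wp_ite,
      wp_pure]
    -- The common continuation of two cases: the block kept some vertices, or one of its departing
    -- lists has just become its list of vertices.
    have hsplit : ∀ (bm' : ℕ → Option (Block V R)) (c' : ℕ → ℕ) (B' : Block V R),
        bm' bx = some B' → (∀ b, b ≠ bx → bm' b = bm b) → B'.vertices ≠ [] →
        BlocksWF False κ 0 [] sup' { s with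
          edge := em, vertexBlock := vb, block := bm', superBlock := sbm, Q := Qm, choices := c',
          P := P, fresh := fr } →
        wp (inAnyOrder B'.departingBlocks.keys) (fun l s' =>
          wp (forIn l PUnit.unit fun key _ => do
            let vl ← deref (B'.departingBlocks.lookup key)
            Block.create vl
            pure (ForInStep.yield PUnit.unit)) (fun _ s' => ∃ B₁, s'.block bx = some B₁ ∧
              (∃ em vb bm sbm Qm c P fr, { s' with
                block := Function.update s'.block bx
                  (some ⟨B₁.vertices, B₁.superBlocks, ∅⟩) } = { s with
                edge := em, vertexBlock := vb, block := bm, superBlock := sbm, Q := Qm,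
                choices := c, P := P, fresh := fr } ∧
              (∀ e₁ ∈ pre ++ [e], em e₁ = some ⟨deg e₁, some (dj e₁)⟩) ∧
              (∀ e', e' ∉ pre ++ [e] → em e' = s.edge e') ∧
              BlocksWF False κ 0 [] sup' { s' with
                block := Function.update s'.block bx
                  (some ⟨B₁.vertices, B₁.superBlocks, ∅⟩) } ∧
              Refines κ s.vertexBlock vb ∧ s.fresh < fr ∧
              ∀ e₁ ∈ pre ++ [e], ∀ b B, vb e₁.origin = some b → bm b = some B →
                B.departingBlocks = ∅)) s')
          { s with
            edge := Function.update em e (some ⟨deg e, some (dj e)⟩), vertexBlock := vb,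
            block := bm', superBlock := sbm, Q := Qm, choices := c', P := P, fresh := fr } := by
      intro bm' c' B' hB' hne' hverts hwf''
      refine wp_inAnyOrder fun ks c'' hks hmem => ?_
      have hwf₂ : BlocksWF False κ bx [] sup' { s with
          edge := Function.update em e (some ⟨deg e, some (dj e)⟩), vertexBlock := vb,
          block := bm', superBlock := sbm, Q := Qm, choices := c'', P := P, fresh := fr } :=
        hwf''.of_nil.congr rfl rfl rfl rfl rfl le_rfl
      refine wp_createBlocks hwf₂ hbx hB' hverts hks hmem ?_
      intro vb₁ bm₁ sbm₁ Qm₁ c₁ P₁ fr₁ hwf₁ href₁ hbm₁ hbP₁ hfr₁ hold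
      refine ⟨B', hbm₁, _, _, _, _, _, _, _, _, rfl, hup1, hup2,
        hwf₁.clear hbm₁ (fun k hk => (hmem k).2 hk), href.trans href₁, hfr.trans_le hfr₁, ?_⟩
      -- Such a block is `bx`, now emptied, or new, or unchanged. In the last case the edge was
      -- treated earlier, as the origin of `e` was in `bx`.
      intro e' he' b₂ B₂ hb₂ hB₂
      dsimp only at hb₂ hB₂
      by_cases hbb : b₂ = bx
      · subst hbb
        rw [Function.update_self] at hB₂
        rw [← Option.some.inj hB₂]
      · rw [Function.update_of_ne hbb] at hB₂
        rcases hold _ _ _ hb₂ hB₂ with h | h | ⟨h, h'⟩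
        · exact absurd h hbb
        · exact h
        · dsimp only at h h'
          rw [hne' _ hbb] at h'
          rcases List.mem_append.1 he' with he' | he'
          · exact hdep e' he' b₂ B₂ h h'
          · rw [List.mem_singleton.1 he', hxb] at h
            exact absurd (Option.some.inj h).symm hbb
    constructor
    · intro hkeys
      constructor
      · intro hverts
        refine wp_inAnyOrder fun ks c' hks hmem => ?_
        have hksne : ks ≠ [] := by
          rintro rfl
          refine hkeys (Finset.eq_empty_of_forall_notMem fun k hk => ?_)
          simpa using (hmem k).2 hk
        obtain ⟨key, tl, rfl⟩ := List.exists_cons_of_ne_nil hksne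
        have hkey : key ∈ B.departingBlocks.keys := (hmem key).1 (by simp)
        obtain ⟨vl, hvl⟩ := Option.isSome_iff_exists.1
          (Finmap.lookup_isSome.2 (Finmap.mem_keys.1 hkey))
        simp only [List.head?_cons, Option.some.injEq, exists_eq_left', hvl, wp_setBlock,
          Function.update_self]
        obtain ⟨⟨κ₀, -, hsh⟩, -⟩ := hshs
        obtain ⟨-, hvlne, -⟩ := hsh.departing key vl (by simpa using hvl)
        refine wp_mono (hsplit _ c' ⟨vl, B.superBlocks, B.departingBlocks.erase key⟩
          (Function.update_self _ _ _) (fun b hb => Function.update_of_ne hb _ _) hvlne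
          (hwf'.of_nil.pickKey hB hverts hvl).of_nil) ?_
        intro l s' h
        refine wp_mono h ?_
        rintro _ s' ⟨B₁, hB₁, h⟩
        exact ⟨B₁, hB₁, trivial, h⟩
      · intro hverts
        simp only [wp_setBlock]
        refine wp_mono (hsplit bm c B hB (fun _ _ => rfl) hverts hwf') ?_
        intro l s' h
        refine wp_mono h ?_
        rintro _ s' ⟨B₁, hB₁, h⟩
        exact ⟨B₁, hB₁, trivial, h⟩
    · intro hkeys
      rw [not_not] at hkeys
      refine ⟨trivial, _, _, _, _, _, _, _, _, rfl, hup1, hup2,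
        hwf'.congr rfl rfl rfl rfl rfl le_rfl, href, hfr, ?_⟩
      intro e' he' b₂ B₂ hb₂ hB₂
      rcases List.mem_append.1 he' with he' | he'
      · exact hdep e' he' b₂ B₂ hb₂ hB₂
      · rw [List.mem_singleton.1 he', hxb] at hb₂
        obtain rfl := Option.some.inj hb₂
        obtain rfl : B = B₂ := Option.some.inj (hB.symm.trans hB₂)
        refine Finmap.ext_lookup fun k => ?_
        rw [Finmap.lookup_empty]
        exact Finmap.lookup_eq_none.2 fun hk => by
          simpa [hkeys] using Finmap.mem_keys.2 hk
  · rintro s' ⟨em, vb, bm, sbm, Qm, c, P, fr, rfl, hem, hem', hwf', href, hfr, hdep⟩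
    -- A vertex with `κ x ≠ none` is the origin of an edge in `es`, so the last clause of the
    -- invariant applies to its block.
    obtain ⟨h1, h2⟩ := hwf'.finish (fun x b B hxb hB hκx => by
      obtain ⟨e, he, rfl⟩ := hκ x hκx
      exact hdep e he b B hxb hB) (fun b B k l hB hb hl => by
      obtain ⟨B', hB', ⟨κ₀, -, hsh⟩, -⟩ := hwf'.block b hb
      obtain rfl : B' = B := Option.some.inj (hB'.symm.trans hB)
      obtain ⟨-, hlne, -, hmem⟩ := hsh.departing k l (by simpa using hl)
      obtain ⟨x, hx⟩ := List.exists_mem_of_ne_nil _ hlne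
      exact ⟨x, ((hmem x).1 hx).1, by simp [((hmem x).1 hx).2]⟩)
    exact hQ em vb bm sbm Qm c P fr hem hem' h1
      (fun x x' => ⟨fun h => ⟨href.1 x x' h, h2 x x' h⟩, fun h => href.2 x x' h.1 h.2⟩) hfr

/-- The block-edges when the auxiliary information of the edges `pre` has been cleared. -/
structure ClearedWF (be dj : EdgeRef V R → ℕ) (es pre : List (EdgeRef V R))
    (bm bm' : ℕ → Option BlockEdge) : Prop where
  source : ∀ e ∈ es, ∃ a, bm (be e) = some a ∧ bm' (be e) =
    some ⟨a.map, if be e ∈ pre.map be then none else some (dj e), none⟩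
  departing : ∀ e ∈ es, ∃ a, bm (dj e) = some a ∧ bm' (dj e) =
    some ⟨a.map, none, if be e ∈ pre.map be then none else some (be e)⟩
  other : ∀ i, (∀ e ∈ es, be e ≠ i) → (∀ e ∈ es, dj e ≠ i) → bm' i = bm i

/-- At this stage the edge `e` already refers to `dj e`. The links between `be e` and `dj e`
determine each other, so the loop clears each pair when its first edge is met. -/
theorem wp_clearAuxiliaryInfo [DecidableEq V] [DecidableEq R]
    {be dj : EdgeRef V R → ℕ}
    {ys : List V} {r : R} {es : List (EdgeRef V R)} {s : Store V R}
    (hes : es = (ys.flatMap s.comingEdges).filter fun e => e.label = r)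
    (hedge : ∀ e ∈ es, ∃ d, s.edge e = some ⟨d, some (dj e)⟩)
    (hbe : ∀ e ∈ es, ∃ m m', s.blockEdge (be e) = some ⟨m, some (dj e), none⟩ ∧
      s.blockEdge (dj e) = some ⟨m', none, some (be e)⟩)
    (hne : ∀ e ∈ es, ∀ e' ∈ es, be e ≠ dj e')
    (hpr : ∀ x, s.processed x = true → ∃ e ∈ es, e.origin = x)
    {Q : Unit → Store V R → Prop}
    (hQ : ∀ bm, ClearedWF be dj es es s.blockEdge bm →
      Q () { s with processed := fun _ => false, blockEdge := bm }) :
    wp (clearAuxiliaryInfo ys r) Q s := by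
  have hiff : ∀ e ∈ es, ∀ e' ∈ es, be e = be e' ↔ dj e = dj e' := by
    intro e he e' he'
    obtain ⟨m, m', h1, h2⟩ := hbe e he
    obtain ⟨m₁, m₁', h1', h2'⟩ := hbe e' he'
    constructor
    · intro h
      rw [h, h1'] at h1
      exact (Option.some.inj (congrArg BlockEdge.departingBlockEdge (Option.some.inj h1))).symm
    · intro h
      rw [h, h2'] at h2
      exact (Option.some.inj (congrArg BlockEdge.sourceBlockEdge (Option.some.inj h2))).symm
  unfold clearAuxiliaryInfo
  refine wp_forIn_comingEdges s.comingEdges es hes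
    (fun pre s' => ∃ pr bm, s' = { s with processed := pr, blockEdge := bm } ∧
      (∀ x, pr x = true → x ∉ pre.map EdgeRef.origin ∧ s.processed x = true) ∧
      ClearedWF be dj es pre s.blockEdge bm) ?_ ?_ ?_ ?_
  · rintro pre s' ⟨pr, bm, rfl, -⟩
    rfl
  · refine ⟨s.processed, s.blockEdge, rfl, fun x hx => ⟨by simp, hx⟩, ?_, ?_, fun _ _ _ => rfl⟩
    · intro e he
      obtain ⟨m, m', h1, h2⟩ := hbe e he
      exact ⟨_, h1, by simp [h1]⟩
    · intro e he
      obtain ⟨m, m', h1, h2⟩ := hbe e he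
      exact ⟨_, h2, by simp [h2]⟩
  · rintro pre e suf s' hl ⟨pr, bm, rfl, hpr', hcl⟩
    have hees : e ∈ es := by rw [hl]; simp
    obtain ⟨d, hd⟩ := hedge e hees
    obtain ⟨a, ha, hsrc⟩ := hcl.source e hees
    obtain ⟨a', ha', hdep⟩ := hcl.departing e hees
    have hpr'' : ∀ x, Function.update pr e.origin false x = true →
        x ∉ (pre ++ [e]).map EdgeRef.origin ∧ s.processed x = true := by
      intro x hx
      by_cases hxe : x = e.origin
      · subst hxe; simp at hx
      · rw [Function.update_of_ne hxe] at hx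
        have := hpr' x hx
        refine ⟨?_, this.2⟩
        simp only [List.map_append, List.mem_append, not_or]
        exact ⟨this.1, by simpa using hxe⟩
    simp only [wp_bind, wp_setProcessed, wp_getEdge, hd, Option.some.injEq, exists_eq_left',
      wp_deref, wp_getBlockEdge, hdep]
    -- If an earlier edge had the same source block-edge, both references are already null and the
    -- body changes only a flag.
    by_cases hmem : be e ∈ pre.map be
    · simp only [hmem, if_true, wp_pure]
      refine ⟨trivial, _, _, rfl, hpr'', ?_⟩
      have hiff' : ∀ i, i ∈ (pre ++ [e]).map be ↔ i ∈ pre.map be := by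
        intro i
        simp only [List.map_append, List.mem_append, List.map_cons, List.map_nil,
          List.mem_singleton, or_iff_left_iff_imp]
        rintro rfl
        exact hmem
      constructor
      · simpa only [hiff'] using hcl.source
      · simpa only [hiff'] using hcl.departing
      · exact hcl.other
    · have hij : be e ≠ dj e := hne e hees e hees
      simp only [hmem, if_false, wp_bind, wp_getBlockEdge, hsrc, Option.some.injEq,
        exists_eq_left', wp_setBlockEdge, wp_pure, Function.update_of_ne hij.symm, hdep]
      refine ⟨trivial, _, _, rfl, hpr'', ?_⟩
      constructor
      · intro e' he'
        obtain ⟨a₁, ha₁, hs₁⟩ := hcl.source e' he'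
        refine ⟨a₁, ha₁, ?_⟩
        rw [Function.update_of_ne (hne e' he' e hees)]
        by_cases h : be e' = be e
        · rw [h] at ha₁ ⊢
          obtain rfl : a = a₁ := Option.some.inj (ha.symm.trans ha₁)
          simp
        · rw [Function.update_of_ne h, hs₁]
          have hmm : be e' ∈ (pre ++ [e]).map be ↔ be e' ∈ pre.map be := by simp [h]
          simp only [hmm]
      · intro e' he'
        obtain ⟨a₁, ha₁, hs₁⟩ := hcl.departing e' he'
        refine ⟨a₁, ha₁, ?_⟩
        by_cases h : be e' = be e
        · have h' := (hiff e' he' e hees).1 h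
          rw [h'] at ha₁ ⊢
          obtain rfl : a' = a₁ := Option.some.inj (ha'.symm.trans ha₁)
          simp [h]
        · have h' := fun hc => h ((hiff e' he' e hees).2 hc)
          rw [Function.update_of_ne h', Function.update_of_ne (hne e hees e' he').symm, hs₁]
          have hmm : be e' ∈ (pre ++ [e]).map be ↔ be e' ∈ pre.map be := by simp [h]
          simp only [hmm]
      · intro i hi hi'
        rw [Function.update_of_ne (hi' e hees).symm, Function.update_of_ne (hi e hees).symm]
        exact hcl.other i hi hi'
  · rintro s' ⟨pr, bm, rfl, hpr', hcl⟩
    -- Only origins of edges in `es` were flagged, and all of them have been visited.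
    have : pr = fun _ => false := by
      funext x
      by_contra hx
      rw [Bool.not_eq_false] at hx
      obtain ⟨h1, h2⟩ := hpr' x hx
      obtain ⟨e, he, rfl⟩ := hpr x h2
      exact h1 (List.mem_map_of_mem he)
    rw [this]
    exact hQ bm hcl

end SCompCB

/-! ### Counting edges into classes of vertices. -/

namespace FuzzyGraph

variable {V S R : Type}

/-- The degree of an edge. -/
def degree (G : FuzzyGraph V S R) (e : SCompCB.EdgeRef V R) : unitInterval :=
  G.E e.origin e.label e.dest

/-- The edges of positive degree. -/
def edges (G : FuzzyGraph V S R) : Set (SCompCB.EdgeRef V R) := {e | 0 < G.degree e}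

/-- The edges of label `r` from `x` to vertices in the class `i`. -/
def edgesInto (G : FuzzyGraph V S R) (sup : R → V → ℕ) (x : V) (r : R) (i : ℕ) :
    Set (SCompCB.EdgeRef V R) :=
  {e | e ∈ G.edges ∧ e.origin = x ∧ e.label = r ∧ sup r e.dest = i}

/-- The number of these edges that have the degree `d`. -/
noncomputable def count (G : FuzzyGraph V S R) (sup : R → V → ℕ) (x : V) (r : R) (i : ℕ)
    (d : unitInterval) : ℕ := {e ∈ G.edgesInto sup x r i | G.degree e = d}.ncard

/-- The bijection of successors induces one of edges. It preserves the degree, and also the class of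
the destination because `sup r` is constant on `Z`-related vertices. -/
theorem IsSBisimulation.count_eq [Finite V] [Finite R] {G : FuzzyGraph V S R} {Z : V → V → Prop}
    (hZ : G.IsSBisimulation Z) {sup : R → V → ℕ} (hsup : ∀ r x x', Z x x' → sup r x = sup r x')
    {x x' : V} (h : Z x x') (r : R) (i : ℕ) (d : unitInterval) :
    G.count sup x r i d = G.count sup x' r i d := by
  obtain ⟨f, hf⟩ := hZ.succs_equiv x x' r h
  have hsucc : ∀ e ∈ {e ∈ G.edgesInto sup x r i | G.degree e = d}, e.dest ∈ G.succs x r := by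
    rintro ⟨x₁, r₁, y⟩ ⟨⟨h1, rfl, rfl, -⟩, -⟩
    exact h1
  refine Set.ncard_congr (fun e he => (x', r, (f ⟨e.dest, hsucc e he⟩ : V))) ?_ ?_ ?_
  · rintro ⟨x₁, r₁, y⟩ ⟨⟨h1, rfl, rfl, h2⟩, h3⟩
    obtain ⟨hy, he⟩ := hf ⟨y, h1⟩
    refine ⟨⟨(f ⟨y, h1⟩).2, rfl, rfl, (hsup _ _ _ hy).symm.trans h2⟩, he.symm.trans h3⟩
  · rintro ⟨x₁, r₁, y⟩ ⟨x₂, r₂, y₂⟩ ⟨⟨h1, rfl, rfl, h2⟩, h3⟩ ⟨⟨h1', h4, h5, h2'⟩, h3'⟩ heq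
    have := f.injective (Subtype.ext (congrArg (fun e : V × R × V => e.2.2) heq))
    have h6 : y = y₂ := congrArg Subtype.val this
    change x₂ = x₁ at h4
    change r₂ = r₁ at h5
    rw [h4, h5, h6]
  · rintro ⟨x₁, r₁, y⟩ ⟨⟨h1, rfl, rfl, h2⟩, h3⟩
    obtain ⟨⟨z, hz⟩, hzy⟩ := f.surjective ⟨y, h1⟩
    obtain ⟨hy, he⟩ := hf ⟨z, hz⟩
    rw [hzy] at hy he
    refine ⟨(x, r₁, z), ⟨⟨hz, rfl, rfl, (hsup _ _ _ hy).trans h2⟩, he.trans h3⟩,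
      congrArg (fun w : G.succs x₁ r₁ => ((x₁, r₁, (w : V)) : SCompCB.EdgeRef V R)) hzy⟩

end FuzzyGraph

/-! ### Effect of separating a block on counts and block-edges. -/

namespace SCompCB

variable {V S R : Type}

/-- Consistency of the edges and block-edges: `be e` is the block-edge of the edge `e`. -/
structure EdgesWF (G : FuzzyGraph V S R) (be : EdgeRef V R → ℕ) (sup : R → V → ℕ)
    (em : EdgeRef V R → Option Edge) (bm : ℕ → Option BlockEdge) (fr : ℕ) : Prop where
  edge : ∀ e ∈ G.edges, em e = some ⟨G.degree e, some (be e)⟩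
  lt : ∀ e ∈ G.edges, be e < fr
  eq_iff : ∀ e ∈ G.edges, ∀ e' ∈ G.edges, be e = be e' ↔
    e.origin = e'.origin ∧ e.label = e'.label ∧ sup e.label e.dest = sup e'.label e'.dest
  blockEdge : ∀ e ∈ G.edges, ∃ m, bm (be e) = some ⟨m, none, none⟩ ∧
    Represents G.degree m {e' | e' ∈ G.edges ∧ be e' = be e}

/-- The super-blocks of label `r` after the vertices with the block `b` have got the new super-block
`f` of label `r`. -/
noncomputable def separate (sup : R → V → ℕ) (vb : V → Option ℕ) (b : ℕ) (r : R) (f : ℕ) :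
    R → V → ℕ := open Classical in
  fun r' x => if r' = r ∧ vb x = some b then f else sup r' x

section separate

variable {G : FuzzyGraph V S R} {sup : R → V → ℕ} {vb : V → Option ℕ} {b i f : ℕ} {r : R}

theorem separate_of_ne {r' : R} (hr : r' ≠ r) (x : V) :
    separate sup vb b r f r' x = sup r' x := if_neg fun h => hr h.1

theorem separate_of_notMem {r' : R} {x : V} (hx : vb x ≠ some b) :
    separate sup vb b r f r' x = sup r' x := if_neg fun h => hx h.2

theorem separate_of_mem {x : V} (hx : vb x = some b) :
    separate sup vb b r f r x = f := if_pos ⟨rfl, hx⟩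

theorem separate_eq_new (hf : ∀ x, sup r x < f) {x : V} :
    separate sup vb b r f r x = f ↔ vb x = some b := by
  by_cases hx : vb x = some b
  · simp [separate_of_mem hx, hx]
  · simp [separate_of_notMem hx, hx, (hf x).ne]

theorem separate_eq_old (hi : i < f) {x : V} :
    separate sup vb b r f r x = i ↔ vb x ≠ some b ∧ sup r x = i := by
  by_cases hx : vb x = some b
  · simp [separate_of_mem hx, hx, hi.ne']
  · simp [separate_of_notMem hx, hx]

theorem count_separate_of_ne {r' : R} (hr : r' ≠ r) (x : V) (j : ℕ) (d : unitInterval) :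
    G.count (separate sup vb b r f) x r' j d = G.count sup x r' j d := by
  simp only [FuzzyGraph.count, FuzzyGraph.edgesInto, separate_of_ne hr]

/-- The block `b` lies entirely in the class `i` and moves to `f`; every other class keeps its
vertices. -/
theorem count_separate_of_ne_ne (hvb : ∀ x, vb x = some b → sup r x = i)
    {j : ℕ} (hjf : j ≠ f) (hji : j ≠ i) (x : V) (d : unitInterval) :
    G.count (separate sup vb b r f) x r j d = G.count sup x r j d := by
  have : ∀ y, separate sup vb b r f r y = j ↔ sup r y = j := by
    intro y
    by_cases hy : vb y = some b
    · rw [separate_of_mem hy, hvb y hy]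
      exact iff_of_false hjf.symm hji.symm
    · rw [separate_of_notMem hy]
  simp only [FuzzyGraph.count, FuzzyGraph.edgesInto, this]

/-- The old class `i` is the disjoint union of the new classes `i` and `f`. This identity lets the
sorting by the remaining edges alone control the edges into the separated block too. -/
theorem count_separate_add [Finite V] [Finite R] (hf : ∀ x, sup r x < f)
    (hvb : ∀ x, vb x = some b → sup r x = i) (hi : i < f) (x : V) (d : unitInterval) :
    G.count (separate sup vb b r f) x r i d + G.count (separate sup vb b r f) x r f d =
      G.count sup x r i d := by
  have hdisj : Disjoint {e ∈ G.edgesInto (separate sup vb b r f) x r i | G.degree e = d}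
      {e ∈ G.edgesInto (separate sup vb b r f) x r f | G.degree e = d} := by
    rw [Set.disjoint_left]
    rintro e ⟨⟨-, -, -, h⟩, -⟩ ⟨⟨-, -, -, h'⟩, -⟩
    exact hi.ne (h.symm.trans h')
  unfold FuzzyGraph.count
  rw [← Set.ncard_union_eq hdisj (Set.toFinite _) (Set.toFinite _)]
  congr 1
  ext e
  simp only [FuzzyGraph.edgesInto, Set.mem_union, Set.mem_ofPred_eq, separate_eq_new hf,
    separate_eq_old hi]
  by_cases hy : vb e.dest = some b
  · simp only [hy, ne_eq, not_true, false_and, and_false, false_or, and_true, hvb _ hy]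
  · simp only [hy, ne_eq, not_false_eq_true, true_and, and_false, false_and, or_false]

/-- What remains of the block-edge of an edge to the block `b`. -/
theorem edgesInto_separate_old (hvb : ∀ x, vb x = some b → sup r x = i)
    (hi : i < f) {be : EdgeRef V R → ℕ} {em : EdgeRef V R → Option Edge}
    {bm : ℕ → Option BlockEdge} {fr : ℕ} (h : EdgesWF G be sup em bm fr)
    {es : List (EdgeRef V R)}
    (hes : ∀ e, e ∈ es ↔ e ∈ G.edges ∧ e.label = r ∧ vb e.dest = some b) {e : EdgeRef V R}
    (he : e ∈ es) :
    {e' | e' ∈ G.edges ∧ be e' = be e ∧ e' ∉ es} =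
      G.edgesInto (separate sup vb b r f) e.origin r i := by
  obtain ⟨heA, her, heb⟩ := (hes e).1 he
  ext e'
  simp only [FuzzyGraph.edgesInto, Set.mem_ofPred_eq]
  refine and_congr_right fun he' => ?_
  rw [h.eq_iff e' he' e heA, hes, separate_eq_old hi, her, hvb _ heb]
  constructor
  · rintro ⟨⟨h1, h2, h3⟩, h4⟩
    exact ⟨h1, h2, fun h5 => h4 ⟨he', h2, h5⟩, h2 ▸ h3⟩
  · rintro ⟨h1, h2, h3, h4⟩
    exact ⟨⟨h1, h2, by rw [h2, h4]⟩, fun h5 => h3 h5.2.2⟩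

end separate

/-- The edges after a split. -/
theorem EdgesWF.split {G : FuzzyGraph V S R} {sup : R → V → ℕ} {vb : V → Option ℕ} {b i f fr' : ℕ}
    {r : R} {be dj : EdgeRef V R → ℕ} {em em' : EdgeRef V R → Option Edge}
    {bm₀ bm bm' : ℕ → Option BlockEdge} {fr : ℕ} (h : EdgesWF G be sup em bm₀ fr)
    {es : List (EdgeRef V R)}
    (hes : ∀ e, e ∈ es ↔ e ∈ G.edges ∧ e.label = r ∧ vb e.dest = some b)
    (hf : ∀ x, sup r x < f) (hvb : ∀ x, vb x = some b → sup r x = i)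
    {m m' : EdgeRef V R → DegreeMap}
    (hdj : ∀ e ∈ es, bm (be e) = some ⟨m e, some (dj e), none⟩ ∧ fr ≤ dj e ∧ dj e < fr' ∧
      bm (dj e) = some ⟨m' e, none, some (be e)⟩ ∧
      Represents G.degree (m e) {e' | e' ∈ G.edges ∧ be e' = be e ∧ e' ∉ es} ∧
      Represents G.degree (m' e) {e' | e' ∈ G.edges ∧ be e' = be e ∧ e' ∈ es})
    (hother : ∀ e ∈ G.edges, (∀ e' ∈ es, be e' ≠ be e) → ∃ m, bm (be e) = some ⟨m, none, none⟩ ∧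
      Represents G.degree m {e' | e' ∈ G.edges ∧ be e' = be e ∧ e' ∉ es})
    (hfr : fr ≤ fr') (hcl : ClearedWF be dj es es bm bm')
    (hem : ∀ e ∈ es, em' e = some ⟨G.degree e, some (dj e)⟩) (hem' : ∀ e, e ∉ es → em' e = em e) :
    ∃ be', EdgesWF G be' (separate sup vb b r f) em' bm' fr' := by
  classical
  have hesA : ∀ e ∈ es, e ∈ G.edges := fun e he => ((hes e).1 he).1
  have hdjiff : ∀ e ∈ es, ∀ e' ∈ es, dj e = dj e' ↔ be e = be e' := by
    intro e he e' he'
    obtain ⟨h1, -, -, h2, -⟩ := hdj e he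
    obtain ⟨h1', -, -, h2', -⟩ := hdj e' he'
    constructor
    · intro h
      rw [h, h2'] at h2
      exact (Option.some.inj (congrArg BlockEdge.sourceBlockEdge (Option.some.inj h2))).symm
    · intro h
      rw [h, h1'] at h1
      exact (Option.some.inj (congrArg BlockEdge.departingBlockEdge (Option.some.inj h1))).symm
  have hne : ∀ e ∈ es, ∀ e' ∈ G.edges, dj e ≠ be e' := fun e he e' he' =>
    ((h.lt e' he').trans_le (hdj e he).2.1).ne'
  -- Edges into the separated block use the departing block-edge; all others keep theirs.
  refine ⟨fun e => if e ∈ es then dj e else be e, ?_, ?_, ?_, ?_⟩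
  · intro e he
    by_cases hee : e ∈ es
    · simp only [hee, if_true, hem e hee]
    · simp only [hee, if_false, hem' e hee, h.edge e he]
  · intro e he
    by_cases hee : e ∈ es
    · simp only [hee, if_true, (hdj e hee).2.2.1]
    · simp only [hee, if_false]
      exact (h.lt e he).trans_le hfr
  · have hmix : ∀ e ∈ es, ∀ e' ∈ G.edges, e' ∉ es → ¬ (e.origin = e'.origin ∧ e.label = e'.label ∧
        separate sup vb b r f e.label e.dest = separate sup vb b r f e'.label e'.dest) := by
      rintro e he e' he' hee' ⟨-, h2, h3⟩
      obtain ⟨-, her, heb⟩ := (hes e).1 he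
      rw [← h2, her, separate_of_mem heb] at h3
      exact hee' ((hes e').2 ⟨he', h2.symm.trans her, (separate_eq_new hf).1 h3.symm⟩)
    intro e he e' he'
    by_cases hee : e ∈ es <;> by_cases hee' : e' ∈ es
    · obtain ⟨-, her, heb⟩ := (hes e).1 hee
      obtain ⟨-, her', heb'⟩ := (hes e').1 hee'
      simp only [hee, hee', if_true, hdjiff e hee e' hee', h.eq_iff e he e' he', her, her',
        separate_of_mem heb, separate_of_mem heb', hvb _ heb, hvb _ heb']
    · simp only [hee, hee', if_true, if_false]
      exact iff_of_false (hne e hee e' he') (hmix e hee e' he' hee')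
    · simp only [hee, hee', if_true, if_false]
      exact iff_of_false (hne e' hee' e he).symm fun hc =>
        hmix e' hee' e he hee ⟨hc.1.symm, hc.2.1.symm, hc.2.2.symm⟩
    · have hsep : ∀ e ∈ G.edges, e ∉ es → separate sup vb b r f e.label e.dest =
          sup e.label e.dest := by
        intro e he hee
        by_cases her : e.label = r
        · exact separate_of_notMem fun hc => hee ((hes e).2 ⟨he, her, hc⟩)
        · exact separate_of_ne her _
      simp only [hee, hee', if_false, h.eq_iff e he e' he', hsep e he hee, hsep e' he' hee']
  · intro e he
    by_cases hee : e ∈ es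
    · obtain ⟨-, -, -, h2, -, h3⟩ := hdj e hee
      obtain ⟨a, ha, ha'⟩ := hcl.departing e hee
      rw [h2] at ha
      obtain rfl := Option.some.inj ha
      rw [if_pos (List.mem_map_of_mem hee)] at ha'
      simp only [hee, if_true]
      refine ⟨m' e, ha', ?_⟩
      convert h3 using 1
      ext e'
      simp only [Set.mem_ofPred_eq]
      refine and_congr_right fun he' => ?_
      by_cases hee' : e' ∈ es
      · simp only [hee', if_true, and_true, hdjiff e' hee' e hee]
      · simp only [hee', if_false, and_false, iff_false]
        exact (hne e hee e' he').symm
    -- Either no edge left this block-edge, and it was not touched, or it is the source for some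
    -- edge in `es`, and its departing reference has been cleared.
    · have key : ∃ m, bm' (be e) = some ⟨m, none, none⟩ ∧
          Represents G.degree m {e' | e' ∈ G.edges ∧ be e' = be e ∧ e' ∉ es} := by
        by_cases hc : ∀ e' ∈ es, be e' ≠ be e
        · obtain ⟨m₁, h1, h2⟩ := hother e he hc
          refine ⟨m₁, ?_, h2⟩
          rw [hcl.other (be e) hc fun e' he' => hne e' he' e he, h1]
        · push Not at hc
          obtain ⟨e₁, he₁, hb⟩ := hc
          obtain ⟨h1, -, -, -, h2, -⟩ := hdj e₁ he₁
          obtain ⟨a, ha, ha'⟩ := hcl.source e₁ he₁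
          rw [h1] at ha
          obtain rfl := Option.some.inj ha
          rw [if_pos (List.mem_map_of_mem he₁), hb] at ha'
          rw [hb] at h2
          exact ⟨m e₁, ha', h2⟩
      obtain ⟨m₁, h1, h2⟩ := key
      simp only [hee, if_false]
      refine ⟨m₁, h1, ?_⟩
      convert h2 using 1
      ext e'
      simp only [Set.mem_ofPred_eq]
      refine and_congr_right fun he' => ?_
      by_cases hee' : e' ∈ es
      · simp only [hee', if_true, not_true, and_false, iff_false]
        exact hne e' hee' e he
      · simp only [hee', if_false, not_false_eq_true, and_true]

end SCompCB

/-! ### The invariant and its preservation by a split. -/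

namespace SCompCB

variable {V S R : Type}

/-- The invariant of the algorithm: the objects are consistent, the partition is at least as coarse
as `Z`, and it is stable with respect to the super-blocks. -/
structure Inv (G : FuzzyGraph V S R) (Z : V → V → Prop) (sup : R → V → ℕ) (s : Store V R) :
    Prop where
  processed : ∀ x, s.processed x = false
  coming_nodup : ∀ y, (s.comingEdges y).Nodup
  mem_coming : ∀ y e, e ∈ s.comingEdges y ↔ e.dest = y ∧ e ∈ G.edges
  edges : ∃ be, EdgesWF G be sup s.edge s.blockEdge s.fresh
  blocks : BlocksWF True (fun _ => none) 0 [] sup s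
  stable : ∀ x x', s.vertexBlock x = s.vertexBlock x' →
    G.L x = G.L x' ∧ ∀ r i d, G.count sup x r i d = G.count sup x' r i d
  coarse : ∀ x x', Z x x' → s.vertexBlock x = s.vertexBlock x'

theorem Inv.block_vertices {G : FuzzyGraph V S R} {Z : V → V → Prop} {sup : R → V → ℕ}
    {s : Store V R} (h : Inv G Z sup s) {b : ℕ} (hb : b ∈ s.P) :
    ∃ B, s.block b = some B ∧ B.vertices.Nodup ∧
      ∀ x, x ∈ B.vertices ↔ s.vertexBlock x = some b := by
  obtain ⟨B, hB, ⟨κ₀, hκ₀, hsh⟩, -⟩ := h.blocks.block b hb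
  obtain rfl := hκ₀ trivial
  exact ⟨B, hB, hsh.nodup, fun x => by simpa using hsh.mem_verts x⟩

theorem BlocksWF.of_sup_eq {p : Prop} {κ : V → Option DegreeMap} {bx : ℕ} {kp : List DegreeMap}
    {sup sup' : R → V → ℕ} {s : Store V R} (h : BlocksWF p κ bx kp sup s) (hsup : sup = sup') :
    BlocksWF p κ bx kp sup' s := hsup ▸ h

/-- The key `κ x` is the map of the edges from `x` into the rest of the super-block if `x` has an
edge into the separated block, and `none` otherwise. Within an old block, equal keys amount to equal
counts into both parts. -/
theorem wp_sSplit [Finite V] [Fintype R] [DecidableEq V] [DecidableEq R] {G : FuzzyGraph V S R}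
    {Z : V → V → Prop} (hZ : G.IsSBisimulation Z) {sup : R → V → ℕ} {s : Store V R}
    (h : Inv G Z sup s) {r : R} {i b : ℕ} {x₀ x₁ : V} (hx₀ : s.vertexBlock x₀ = some b)
    (hi : sup r x₀ = i) (hx₁ : sup r x₁ = i) (hx₁b : s.vertexBlock x₁ ≠ some b) :
    wp (sSplit b i r)
      (fun _ s' => ∃ f, s.fresh ≤ f ∧ Inv G Z (separate sup s.vertexBlock b r f) s') s := by
  classical
  obtain ⟨be, hE⟩ := h.edges
  obtain ⟨B, hB, hBnd, hBmem⟩ := h.block_vertices (h.blocks.mem_P hx₀)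
  have hlt : ∀ r x, sup r x < s.fresh := fun r x => h.blocks.super.lt ⟨x, rfl⟩
  have hvb : ∀ x, s.vertexBlock x = some b → sup r x = i := fun x hx =>
    (h.blocks.sup_eq (hx.trans hx₀.symm) r).trans hi
  have hilt : i < s.fresh := hi ▸ hlt r x₀
  obtain ⟨es, hes⟩ : ∃ es, es = (B.vertices.flatMap s.comingEdges).filter fun e => e.label = r :=
    ⟨_, rfl⟩
  have hmem : ∀ e, e ∈ es ↔ e ∈ G.edges ∧ e.label = r ∧ s.vertexBlock e.dest = some b := by
    intro e
    rw [hes]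
    simp only [List.mem_filter, List.mem_flatMap, decide_eq_true_eq, h.mem_coming, hBmem]
    constructor
    · rintro ⟨⟨y, hy, rfl, he⟩, hr⟩
      exact ⟨he, hr, hy⟩
    · rintro ⟨he, hr, hy⟩
      exact ⟨⟨_, hy, rfl, he⟩, hr⟩
  have hnd : es.Nodup := by
    rw [hes]
    refine List.Nodup.filter _ (List.nodup_flatMap.2 ⟨fun y _ => h.coming_nodup y, ?_⟩)
    refine List.Pairwise.imp ?_ hBnd
    intro y y' hyy e he he'
    exact hyy (((h.mem_coming y e).1 he).1.symm.trans ((h.mem_coming y' e).1 he').1)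
  have hesA : ∀ e ∈ es, e ∈ G.edges := fun e he => ((hmem e).1 he).1
  simp only [sSplit, wp_bind, wp_getBlock, hB, Option.some.injEq, exists_eq_left']
  refine wp_computeBlockEdges hes hnd hesA hE.edge hE.lt hE.blockEdge fun bm f hdep => ?_
  have hdj : ∀ e ∈ es, ∃ j m m', bm (be e) = some ⟨m, some j, none⟩ ∧ s.fresh ≤ j ∧ j < f ∧
      bm j = some ⟨m', none, some (be e)⟩ ∧
      Represents G.degree m {e' | e' ∈ G.edges ∧ be e' = be e ∧ e' ∉ es} ∧
      Represents G.degree m' {e' | e' ∈ G.edges ∧ be e' = be e ∧ e' ∈ es} := by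
    intro e he
    obtain ⟨m, dep, h1, h2, h3⟩ := hdep.blockEdge e (hesA e he)
    rcases h3 with ⟨h3, -⟩ | ⟨-, j, m', rfl, h3, h4, h5, h6⟩
    · exact absurd rfl (h3 e he)
    · exact ⟨j, m, m', h1, h3, h4, h5, h2, h6⟩
  choose! dj m m' hdj using hdj
  have hother : ∀ e ∈ G.edges, (∀ e' ∈ es, be e' ≠ be e) → ∃ m, bm (be e) = some ⟨m, none, none⟩ ∧
      Represents G.degree m {e' | e' ∈ G.edges ∧ be e' = be e ∧ e' ∉ es} := by
    intro e he hc
    obtain ⟨m, dep, h1, h2, h3⟩ := hdep.blockEdge e he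
    rcases h3 with ⟨-, rfl⟩ | ⟨⟨e', he', hb⟩, -⟩
    · exact ⟨m, h1, h2⟩
    · exact absurd hb (hc e' he')
  -- All edges in `es` have the label `r` and end in the super-block `i`, so those with the same
  -- origin share their block-edge. Thus the remaining map is a function of the origin.
  have hm : ∀ e ∈ es, ∀ e' ∈ es, e.origin = e'.origin → m e = m e' := by
    intro e he e' he' ho
    obtain ⟨heA, her, heb⟩ := (hmem e).1 he
    obtain ⟨heA', her', heb'⟩ := (hmem e').1 he'
    have hbe : be e = be e' :=
      (hE.eq_iff e heA e' heA').2 ⟨ho, her.trans her'.symm, by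
        rw [her, her', hvb _ heb, hvb _ heb']⟩
    have h1 := (hdj e he).1
    rw [hbe, (hdj e' he').1] at h1
    exact (congrArg BlockEdge.map (Option.some.inj h1)).symm
  obtain ⟨κ, hκ⟩ : ∃ κ : V → Option DegreeMap,
      κ = fun x => if hx : ∃ e ∈ es, e.origin = x then some (m hx.choose) else none := ⟨_, rfl⟩
  have hκ1 : ∀ e ∈ es, κ e.origin = some (m e) := by
    intro e he
    have hx : ∃ e' ∈ es, e'.origin = e.origin := ⟨e, he, rfl⟩
    rw [hκ]
    simp only [dif_pos hx]
    exact congrArg some (hm _ hx.choose_spec.1 e he hx.choose_spec.2)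
  have hκ2 : ∀ x, (¬ ∃ e ∈ es, e.origin = x) → κ x = none := by
    intro x hx
    rw [hκ]
    exact dif_neg hx
  refine wp_sComputeSubblocks (deg := G.degree) (be := be) (κ := κ) (sup := sup)
    (s := { s with blockEdge := bm, fresh := f }) hes (fun e he => hE.edge e (hesA e he)) (fun e he => ⟨_, (hdj e he).1, hκ1 e he⟩)
    (fun x hx => hκ2 x fun ⟨e, he, hex⟩ => hx e he hex) h.processed
    (h.blocks.congr rfl rfl rfl rfl rfl hdep.le) fun blk pr c hwf hpr => ?_
  refine wp_sDoSplitting (deg := G.degree) (be := be) (dj := dj)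
    (s := { s with blockEdge := bm, fresh := f, block := blk, processed := pr, choices := c })
    hes hnd (fun e he => hE.edge e (hesA e he)) (fun e he => ⟨_, (hdj e he).1, rfl⟩)
    (fun x hx => by
      by_contra hc
      exact hx (hκ2 x hc)) hwf hx₀ hi hx₁ hx₁b ?_
  intro em vb blk' sbm Qm c' P fr hem hem' hwf' hvbiff hfr
  dsimp only at hfr hvbiff
  refine wp_clearAuxiliaryInfo (be := be) (dj := dj)
    (s := { s with
      blockEdge := bm, processed := pr, edge := em, vertexBlock := vb, block := blk',
      superBlock := sbm, Q := Qm, choices := c', P := P, fresh := fr })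
    hes (fun e he => ⟨_, hem e he⟩)
    (fun e he => ⟨m e, m' e, (hdj e he).1, (hdj e he).2.2.2.1⟩)
    (fun e he e' he' => ((hE.lt e (hesA e he)).trans_le (hdj e' he').2.1).ne) hpr
    fun bm' hcl => ?_
  have hltf : ∀ x, sup r x < f := fun x => (hlt r x).trans_le hdep.le
  have hif : i < f := hilt.trans_le hdep.le
  have hno : ∀ x, (¬ ∃ e ∈ es, e.origin = x) → ∀ d,
      G.count (separate sup s.vertexBlock b r f) x r f d = 0 := by
    intro x hx d
    unfold FuzzyGraph.count
    convert Set.ncard_empty (EdgeRef V R)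
    ext e
    simp only [FuzzyGraph.edgesInto, Set.mem_ofPred_eq, Set.mem_empty_iff_false, iff_false]
    rintro ⟨⟨h1, h2, h3, h4⟩, -⟩
    exact hx ⟨e, (hmem e).2 ⟨h1, h3, (separate_eq_new hltf).1 h4⟩, h2⟩
  have hyes : ∀ e ∈ es,
      G.count (separate sup s.vertexBlock b r f) e.origin r f (G.degree e) ≠ 0 := by
    intro e he
    obtain ⟨h1, h2, h3⟩ := (hmem e).1 he
    exact Set.ncard_ne_zero_of_mem (a := e)
      ⟨⟨h1, rfl, h2, (separate_eq_new hltf).2 h3⟩, rfl⟩ (Set.toFinite _)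
  -- The remaining map of the block-edge represents the edges into the new, smaller class `i`, so
  -- equality of maps becomes equality of counts.
  have hmiff : ∀ e ∈ es, ∀ e' ∈ es, m e = m e' ↔ ∀ d,
      G.count (separate sup s.vertexBlock b r f) e.origin r i d =
        G.count (separate sup s.vertexBlock b r f) e'.origin r i d := by
    intro e he e' he'
    have h1 := (hdj e he).2.2.2.2.1
    have h2 := (hdj e' he').2.2.2.2.1
    rw [edgesInto_separate_old hvb hif hE hmem he] at h1
    rw [edgesInto_separate_old hvb hif hE hmem he'] at h2
    exact h1.eq_iff h2
  have hadd := fun x d => count_separate_add (G := G) (r := r) hltf hvb hif x d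
  -- The new super-block is the first object created after ComputeBlockEdges, hence its reference is
  -- the counter `f` reached there.
  refine ⟨f, hdep.le, fun _ => rfl, h.coming_nodup, h.mem_coming, ?_, ?_, ?_, ?_⟩
  · exact hE.split hmem hltf hvb hdj hother hdep.le hcl hem hem' |>.imp
      fun be' hbe' => ⟨hbe'.edge, fun e he => (hbe'.lt e he).trans hfr, hbe'.eq_iff, hbe'.blockEdge⟩
  · refine BlocksWF.congr (hwf'.of_sup_eq ?_) rfl rfl rfl rfl rfl le_rfl
    funext r' x
    -- The two functions differ only in their decidability instances; `separate` uses the classical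
    -- one.
    by_cases hc : r' = r ∧ s.vertexBlock x = some b
    · exact (if_pos hc).trans (if_pos hc).symm
    · exact (if_neg hc).trans (if_neg hc).symm
  · intro x x' hxx
    obtain ⟨hxx', hκxx⟩ := (hvbiff x x').1 hxx
    obtain ⟨hL, hcount⟩ := h.stable x x' hxx'
    -- Two vertices with edges into `b` have equal remaining maps. Two without such edges have their
    -- whole old count in the rest of the class. A mixed pair has different keys.
    have hold : ∀ d, G.count (separate sup s.vertexBlock b r f) x r i d =
        G.count (separate sup s.vertexBlock b r f) x' r i d := by
      by_cases hx : ∃ e ∈ es, e.origin = x <;> by_cases hx' : ∃ e ∈ es, e.origin = x'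
      · obtain ⟨e, he, rfl⟩ := hx
        obtain ⟨e', he', rfl⟩ := hx'
        rw [hκ1 e he, hκ1 e' he', Option.some.injEq] at hκxx
        exact (hmiff e he e' he').1 hκxx
      · obtain ⟨e, he, rfl⟩ := hx
        rw [hκ1 e he, hκ2 x' hx'] at hκxx
        cases hκxx
      · obtain ⟨e', he', rfl⟩ := hx'
        rw [hκ1 e' he', hκ2 x hx] at hκxx
        cases hκxx
      · intro d
        have h1 := hadd x d
        have h2 := hadd x' d
        rw [hno x hx, hcount] at h1
        rw [hno x' hx'] at h2
        omega
    refine ⟨hL, fun r' j d => ?_⟩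
    by_cases hr : r' = r
    · subst hr
      by_cases hji : j = i
      · rw [hji]
        exact hold d
      · by_cases hjf : j = f
        -- The counts into the new class are obtained by subtraction, as the sums and the counts
        -- into the rest agree.
        · have h1 := hadd x d
          have h2 := hadd x' d
          have h3 := hold d
          rw [hcount] at h1
          rw [hjf]
          omega
        · rw [count_separate_of_ne_ne hvb hjf hji, count_separate_of_ne_ne hvb hjf hji]
          exact hcount _ _ _
    · rw [count_separate_of_ne hr, count_separate_of_ne hr]
      exact hcount _ _ _
  · intro x x' hxx
    refine (hvbiff x x').2 ⟨h.coarse x x' hxx, ?_⟩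
    -- Each new super-block is still a union of old blocks, and `Z` does not leave these; so the new
    -- counts agree on `Z`-related vertices.
    have hcount := hZ.count_eq (sup := separate sup s.vertexBlock b r f) (fun r' y y' hyy => by
      have h1 := h.coarse y y' hyy
      unfold separate
      rw [h1, h.blocks.sup_eq h1 r']) hxx r
    by_cases hx : ∃ e ∈ es, e.origin = x <;> by_cases hx' : ∃ e ∈ es, e.origin = x'
    · obtain ⟨e, he, rfl⟩ := hx
      obtain ⟨e', he', rfl⟩ := hx'
      rw [hκ1 e he, hκ1 e' he', Option.some.injEq]
      exact (hmiff e he e' he').2 fun d => hcount i d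
    · obtain ⟨e, he, rfl⟩ := hx
      exact absurd ((hcount f _).trans (hno x' hx' _)) (hyes e he)
    · obtain ⟨e', he', rfl⟩ := hx'
      exact absurd ((hcount f _).symm.trans (hno x hx _)) (hyes e' he')
    · rw [hκ2 x hx, hκ2 x' hx']

end SCompCB

namespace SCompCB

variable {V S R : Type}

/-! ### Initialization -/

theorem wp_createEdges [DecidableEq V] [DecidableEq R] {G : FuzzyGraph V S R}
    {es : List (EdgeRef V R)} (hnd : es.Nodup) {s : Store V R} (hs : s.comingEdges = fun _ => [])
    {Q : PUnit → Store V R → Prop}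
    (hQ : ∀ em CE c, (∀ e ∈ es, em e = some ⟨G.degree e, none⟩) → (∀ y, (CE y).Nodup) →
      (∀ y e, e ∈ CE y ↔ e.dest = y ∧ e ∈ es) →
      Q ⟨⟩ { s with edge := em, comingEdges := CE, choices := c }) :
    wp (forIn es PUnit.unit fun e _ => do
      Edge.new e.label e.origin e.dest (G.E e.origin e.label e.dest) none
      pure (ForInStep.yield PUnit.unit)) Q s := by
  refine wp_forIn (fun pre _ s' => ∃ em CE c,
    s' = { s with edge := em, comingEdges := CE, choices := c } ∧
    (∀ e ∈ pre, em e = some ⟨G.degree e, none⟩) ∧ (∀ y, (CE y).Nodup) ∧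
    ∀ y e, e ∈ CE y ↔ e.dest = y ∧ e ∈ pre) ?_ ?_ ?_
  · exact ⟨_, _, _, rfl, by simp, by simp [hs], by simp [hs]⟩
  · rintro pre e suf _ s' hl ⟨em, CE, c, rfl, h1, h2, h3⟩
    have hepre : e ∉ pre := by
      rw [hl] at hnd
      exact fun hr => (List.disjoint_of_nodup_append hnd) hr (by simp)
    have hee : (e.origin, e.label, e.dest) = e := rfl
    simp only [Edge.new, wp_bind, wp_setEdge, wp_get, hee]
    refine wp_add fun l c' hl' => ?_
    simp only [wp_modify, wp_pure]
    refine ⟨⟨⟩, trivial, _, _, _, rfl, ?_, ?_, ?_⟩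
    · intro e' he'
      by_cases h : e' = e
      · subst h
        rw [Function.update_self]
        rfl
      · rw [Function.update_of_ne h]
        exact h1 e' ((List.mem_append.1 he').resolve_right (by simpa using h))
    · intro y
      by_cases hy : y = e.dest
      · subst hy
        rw [Function.update_self, hl'.nodup_iff, List.nodup_cons]
        exact ⟨fun h => hepre ((h3 _ _).1 h).2, h2 _⟩
      · rw [Function.update_of_ne hy]
        exact h2 y
    · intro y e'
      by_cases hy : y = e.dest
      · subst hy
        rw [Function.update_self, hl'.mem_iff, List.mem_cons, h3, List.mem_append,
          List.mem_singleton]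
        constructor
        · rintro (rfl | ⟨h, h'⟩)
          · exact ⟨rfl, Or.inr rfl⟩
          · exact ⟨h, Or.inl h'⟩
        · rintro ⟨h, h' | rfl⟩
          · exact Or.inr ⟨h, h'⟩
          · exact Or.inl rfl
      · rw [Function.update_of_ne hy, h3, List.mem_append, List.mem_singleton]
        constructor
        · exact fun h => ⟨h.1, Or.inl h.2⟩
        · rintro ⟨h, h' | rfl⟩
          · exact ⟨h, h'⟩
          · exact absurd h.symm hy
  · rintro _ s' ⟨em, CE, c, rfl, h1, h2, h3⟩
    exact hQ em CE c h1 h2 h3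

/-- No blocks exist yet, so the membership relation is empty and every super-block is simple. -/
theorem wp_createSuperBlocks [DecidableEq R] {rs : List R} (hnd : rs.Nodup) (hrs : ∀ r, r ∈ rs)
    {s : Store V R} {Q : (R → Option ℕ) → Store V R → Prop}
    (hQ : ∀ (σ : R → ℕ) sbm Qm c fr,
      SuperWF (fun r i => i = σ r) (fun _ _ _ => False) sbm Qm fr →
      Q (fun r => some (σ r)) { s with superBlock := sbm, Q := Qm, choices := c, fresh := fr }) :
    wp (forIn rs (fun _ => none) fun r msb => do
      SuperPartition.new r
      let sb ← SuperBlock.new r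
      pure (ForInStep.yield (Function.update msb r (some sb)))) Q s := by
  refine wp_forIn (fun pre msb s' => ∃ sbm Qm c fr,
    s' = { s with superBlock := sbm, Q := Qm, choices := c, fresh := fr } ∧
    ∀ r ∈ pre, ∃ i, msb r = some i ∧ i < fr ∧ sbm i = some ⟨[], r⟩ ∧ Qm r = some ⟨[], [i]⟩) ?_ ?_ ?_
  · exact ⟨_, _, _, _, rfl, by simp⟩
  · rintro pre r suf msb s' hl ⟨sbm, Qm, c, fr, rfl, h⟩
    have hrpre : r ∉ pre := by
      rw [hl] at hnd
      exact fun hr => (List.disjoint_of_nodup_append hnd) hr (by simp)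
    simp only [wp_bind, SuperPartition.new, wp_setSuperPartition]
    refine wp_newSuperBlock (q := ⟨[], []⟩) (Function.update_self _ _ _) fun l c' hl' => ?_
    rw [wp_pure]
    obtain rfl : l = [fr] := List.perm_singleton.1 hl'
    refine ⟨_, rfl, _, _, _, _, rfl, fun r' hr' => ?_⟩
    by_cases hr : r' = r
    · subst hr
      exact ⟨fr, by simp, Nat.lt_succ_self _, by simp, by simp⟩
    · obtain ⟨i, h1, h2, h3, h4⟩ := h r' ((List.mem_append.1 hr').resolve_right (by simpa using hr))
      exact ⟨i, by simp [hr, h1], Nat.lt_succ_of_lt h2, by simp [h2.ne, h3], by simp [hr, h4]⟩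
  · rintro msb s' ⟨sbm, Qm, c, fr, rfl, h⟩
    choose σ h1 h2 h3 h4 using fun r => h r (hrs r)
    obtain rfl : msb = fun r => some (σ r) := funext h1
    refine hQ σ sbm Qm c fr fun r => ⟨_, h4 r, by simp, by simp, ?_⟩
    rintro i rfl
    exact ⟨h2 r, [], h3 r, List.nodup_nil, by simp, by simp⟩

/-- Each pair gets a fresh reference. The resulting injectivity makes equality of block-edges mean
equality of origin and label. -/
theorem wp_createBlockEdges [DecidableEq V] [DecidableEq R] {xs : List (V × R)}
    (hxs : ∀ xr, xr ∈ xs)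
    {s : Store V R} {Q : (V × R → Option ℕ) → Store V R → Prop}
    (hQ : ∀ β bm fr, s.fresh ≤ fr → Function.Injective β → (∀ xr, β xr < fr) →
      (∀ xr, bm (β xr) = some ⟨∅, none, none⟩) →
      Q (fun xr => some (β xr)) { s with blockEdge := bm, fresh := fr }) :
    wp (forIn xs (fun _ => none) fun xr blockEdges => do
      let i ← BlockEdge.new none
      pure (ForInStep.yield (Function.update blockEdges xr (some i)))) Q s := by
  refine wp_forIn (fun pre β s' => ∃ bm fr, s' = { s with blockEdge := bm, fresh := fr } ∧
    s.fresh ≤ fr ∧ (∀ xr ∈ pre, ∃ i, β xr = some i ∧ i < fr ∧ bm i = some ⟨∅, none, none⟩) ∧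
    ∀ xr ∈ pre, ∀ xr' ∈ pre, β xr = β xr' → xr = xr') ?_ ?_ ?_
  · exact ⟨_, _, rfl, le_rfl, by simp, by simp⟩
  · rintro pre xr suf β s' - ⟨bm, fr, rfl, hfr, h1, h2⟩
    simp only [wp_bind, BlockEdge.new, wp_newRef, wp_setBlockEdge, wp_pure]
    have hmem : ∀ x' ∈ pre ++ [xr], x' ≠ xr → x' ∈ pre := fun x' hx' hne =>
      (List.mem_append.1 hx').resolve_right (by simpa using hne)
    refine ⟨_, rfl, _, _, rfl, Nat.le_succ_of_le hfr, fun x' hx' => ?_, fun x' hx' x'' hx'' => ?_⟩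
    · by_cases hx : x' = xr
      · subst hx
        exact ⟨fr, by simp, Nat.lt_succ_self _, by simp⟩
      · obtain ⟨i, h3, h4, h5⟩ := h1 x' (hmem x' hx' hx)
        exact ⟨i, by simp [hx, h3], Nat.lt_succ_of_lt h4, by simp [h4.ne, h5]⟩
    · have hne : ∀ x ∈ pre, β x ≠ some fr := by
        intro x hx hc
        obtain ⟨i, h3, h4, -⟩ := h1 x hx
        rw [h3] at hc
        exact h4.ne (Option.some.inj hc)
      by_cases hx : x' = xr <;> by_cases hy : x'' = xr
      · exact fun _ => hx.trans hy.symm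
      · rw [hx, Function.update_self, Function.update_of_ne hy]
        exact fun h => absurd h.symm (hne x'' (hmem _ hx'' hy))
      · rw [hy, Function.update_self, Function.update_of_ne hx]
        exact fun h => absurd h (hne x' (hmem _ hx' hx))
      · rw [Function.update_of_ne hx, Function.update_of_ne hy]
        exact h2 x' (hmem _ hx' hx) x'' (hmem _ hx'' hy)
  · rintro β s' ⟨bm, fr, rfl, hfr, h1, h2⟩
    choose β' h3 h4 h5 using fun xr => h1 xr (hxs xr)
    obtain rfl : β = fun xr => some (β' xr) := funext h3
    exact hQ β' bm fr hfr (fun x y h => h2 x (hxs x) y (hxs y) (congrArg some h)) h4 h5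

theorem wp_pushEdges [Finite V] [Finite R] [DecidableEq V] [DecidableEq R] {G : FuzzyGraph V S R}
    {es : List (EdgeRef V R)} (hnd : es.Nodup) {s : Store V R}
    (hedge : ∀ e ∈ es, s.edge e = some ⟨G.degree e, none⟩) {β : V × R → ℕ}
    (hβ : Function.Injective β) (hbm : ∀ xr, s.blockEdge (β xr) = some ⟨∅, none, none⟩)
    {Q : PUnit → Store V R → Prop}
    (hQ : ∀ em bm, (∀ e ∈ es, em e = some ⟨G.degree e, some (β (e.origin, e.label))⟩) →
      (∀ xr, ∃ m, bm (β xr) = some ⟨m, none, none⟩ ∧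
        Represents G.degree m {e | e ∈ es ∧ (e.origin, e.label) = xr}) →
      Q ⟨⟩ { s with edge := em, blockEdge := bm }) :
    wp (forIn es PUnit.unit fun e _ => do
      let i ← deref (some (β (e.origin, e.label)))
      let a ← getEdge e
      setEdge e { a with blockEdge := some i }
      BlockEdge.pushKey i a.degree
      pure (ForInStep.yield PUnit.unit)) Q s := by
  refine wp_forIn (fun pre _ s' => ∃ em bm, s' = { s with edge := em, blockEdge := bm } ∧
    (∀ e ∈ pre, em e = some ⟨G.degree e, some (β (e.origin, e.label))⟩) ∧
    (∀ e, e ∉ pre → em e = s.edge e) ∧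
    ∀ xr, ∃ m, bm (β xr) = some ⟨m, none, none⟩ ∧
        Represents G.degree m {e | e ∈ pre ∧ (e.origin, e.label) = xr}) ?_ ?_ ?_
  · refine ⟨_, _, rfl, by simp, fun _ _ => rfl, fun xr => ⟨∅, hbm xr, ?_⟩⟩
    convert represents_empty G.degree
    ext e
    simp
  · rintro pre e suf _ s' hl ⟨em, bm, rfl, h1, h2, h3⟩
    have hees : e ∈ es := by rw [hl]; simp
    have hepre : e ∉ pre := by
      rw [hl] at hnd
      exact fun hr => (List.disjoint_of_nodup_append hnd) hr (by simp)
    have hee : em e = some ⟨G.degree e, none⟩ := by rw [h2 e hepre, hedge e hees]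
    obtain ⟨m, hm, hr⟩ := h3 (e.origin, e.label)
    simp only [wp_bind, wp_deref, Option.some.injEq, exists_eq_left', wp_getEdge, hee, wp_setEdge]
    refine wp_pushKey hm hr (fun h => hepre h.1) fun m' hm' => ?_
    rw [wp_pure]
    refine ⟨⟨⟩, rfl, _, _, rfl, ?_, ?_, ?_⟩
    · intro e' he'
      by_cases h : e' = e
      · subst h; simp
      · dsimp only
        rw [Function.update_of_ne h]
        exact h1 e' ((List.mem_append.1 he').resolve_right (by simpa using h))
    · intro e' he'
      simp only [List.mem_append, List.mem_singleton, not_or] at he'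
      dsimp only
      rw [Function.update_of_ne he'.2, h2 e' he'.1]
    · intro xr
      by_cases hx : xr = (e.origin, e.label)
      · subst hx
        refine ⟨m', by simp, ?_⟩
        convert hm' using 1
        ext e'
        simp only [Set.mem_ofPred_eq, Set.mem_insert_iff, List.mem_append, List.mem_singleton]
        constructor
        · rintro ⟨h | h, h'⟩
          · exact Or.inr ⟨h, h'⟩
          · exact Or.inl h
        · rintro (rfl | ⟨h, h'⟩)
          · exact ⟨Or.inr rfl, rfl⟩
          · exact ⟨Or.inl h, h'⟩
      · obtain ⟨m₁, hm₁, hr₁⟩ := h3 xr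
        refine ⟨m₁, ?_, ?_⟩
        · rw [Function.update_of_ne (fun h => hx (hβ h))]
          exact hm₁
        · convert hr₁ using 1
          ext e'
          simp only [Set.mem_ofPred_eq, List.mem_append, List.mem_singleton]
          constructor
          · rintro ⟨h | rfl, h'⟩
            · exact ⟨h, h'⟩
            · exact absurd h'.symm hx
          · exact fun h => ⟨Or.inl h.1, h.2⟩
  · rintro _ s' ⟨em, bm, rfl, h1, -, h3⟩
    exact hQ em bm h1 h3

/-- The lists in `𝕏` are the equivalence classes of their members. -/
structure AreClasses (eqv : V → V → Prop) (𝕏 : List (List V)) : Prop where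
  ne_nil : ∀ X ∈ 𝕏, X ≠ []
  rel : ∀ X ∈ 𝕏, ∀ x ∈ X, ∀ y ∈ X, eqv x y
  pairwise : 𝕏.Pairwise fun X Y => ∀ x ∈ X, ∀ y ∈ Y, ¬ eqv x y

/-- Since `eqv` is an equivalence, one equivalent member of a list speaks for the whole list. The
permutation of the concatenations ensures that no vertex is lost or duplicated. -/
theorem wp_insertIntoClass {eqv : V → V → Prop} {_ : DecidableRel eqv} (he : Equivalence eqv) {x : V}
    {𝕏 : List (List V)} (h : AreClasses eqv 𝕏) {s : Store V R}
    {Q : List (List V) → Store V R → Prop}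
    (hQ : ∀ 𝕏' c, AreClasses eqv 𝕏' → 𝕏'.flatten.Perm (x :: 𝕏.flatten) →
      Q 𝕏' { s with choices := c }) : wp (insertIntoClass eqv x 𝕏) Q s := by
  induction 𝕏 generalizing s Q with
  | nil =>
    rw [insertIntoClass, wp_pure]
    exact hQ _ s.choices ⟨by simp, by simpa using he.refl x, by simp⟩ (by simp)
  | cons X 𝕏 ih =>
    obtain ⟨h1, h2, h3⟩ := h
    rw [List.pairwise_cons] at h3
    rw [insertIntoClass, wp_ite]
    constructor
    · intro hany
      obtain ⟨x', hx', hxx⟩ := List.any_eq_true.1 hany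
      have hxx := of_decide_eq_true hxx
      have hxX : ∀ y ∈ X, eqv x y := fun y hy =>
        he.trans hxx (h2 X (by simp) x' hx' y hy)
      simp only [wp_bind, wp_pure]
      refine wp_add fun X' c hX' => hQ _ c ⟨?_, ?_, ?_⟩ ?_
      · intro Y hY
        rcases List.mem_cons.1 hY with rfl | hY
        · rintro rfl
          simpa using hX'.length_eq
        · exact h1 Y (by simp [hY])
      · intro Y hY
        rcases List.mem_cons.1 hY with rfl | hY
        · intro y hy z hz
          rcases List.mem_cons.1 (hX'.mem_iff.1 hy) with rfl | hy <;>
            rcases List.mem_cons.1 (hX'.mem_iff.1 hz) with rfl | hz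
          · exact he.refl _
          · exact hxX z hz
          · exact he.symm (hxX y hy)
          · exact h2 X (by simp) y hy z hz
        · exact h2 Y (by simp [hY])
      · refine List.pairwise_cons.2 ⟨fun Y hY y hy z hz => ?_, h3.2⟩
        rcases List.mem_cons.1 (hX'.mem_iff.1 hy) with rfl | hy
        · exact fun hc => h3.1 Y hY x' hx' z hz (he.trans (he.symm hxx) hc)
        · exact h3.1 Y hY y hy z hz
      · simpa using hX'.append_right 𝕏.flatten
    · intro hany
      have hxX : ∀ y ∈ X, ¬ eqv x y := fun y hy hc =>
        hany (List.any_eq_true.2 ⟨y, hy, decide_eq_true hc⟩)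
      simp only [wp_bind, wp_pure]
      refine ih ⟨fun Y hY => h1 Y (by simp [hY]), fun Y hY => h2 Y (by simp [hY]), h3.2⟩
        fun 𝕏' c h𝕏 hp => hQ _ c ⟨?_, ?_, ?_⟩ ?_
      · intro Y hY
        rcases List.mem_cons.1 hY with rfl | hY
        · exact h1 Y (by simp)
        · exact h𝕏.ne_nil Y hY
      · intro Y hY
        rcases List.mem_cons.1 hY with rfl | hY
        · exact h2 Y (by simp)
        · exact h𝕏.rel Y hY
      · refine List.pairwise_cons.2 ⟨fun Y hY y hy z hz hc => ?_, h𝕏.pairwise⟩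
        have hz' := hp.mem_iff.1 (List.mem_flatten.2 ⟨Y, hY, hz⟩)
        rcases List.mem_cons.1 hz' with rfl | hz'
        · exact hxX y hy (he.symm hc)
        · obtain ⟨Y', hY', hz'⟩ := List.mem_flatten.1 hz'
          exact h3.1 Y' hY' y hy z hz' hc
      · rw [List.flatten_cons, List.flatten_cons]
        exact (hp.append_left X).trans List.perm_middle

theorem wp_classify {eqv : V → V → Prop} {_ : DecidableRel eqv} (he : Equivalence eqv) {xs : List V}
    {s : Store V R} {Q : List (List V) → Store V R → Prop}
    (hQ : ∀ 𝕏 c, AreClasses eqv 𝕏 → 𝕏.flatten.Perm xs → Q 𝕏 { s with choices := c }) :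
    wp (forIn xs [] fun x 𝕏 => do
      let 𝕏 ← insertIntoClass eqv x 𝕏
      pure (ForInStep.yield 𝕏)) Q s := by
  refine wp_forIn (fun pre 𝕏 s' => ∃ c, s' = { s with choices := c } ∧ AreClasses eqv 𝕏 ∧
    𝕏.flatten.Perm pre) ?_ ?_ ?_
  · exact ⟨_, rfl, ⟨by simp, by simp, by simp⟩, by simp⟩
  · rintro pre x suf 𝕏 s' - ⟨c, rfl, h1, h2⟩
    rw [wp_bind]
    refine wp_insertIntoClass he h1 fun 𝕏' c' h3 h4 => ?_
    rw [wp_pure]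
    refine ⟨_, rfl, _, rfl, h3, h4.trans ((h2.cons x).trans ?_)⟩
    simpa using (List.perm_append_comm (l₁ := [x]) (l₂ := pre))
  · rintro 𝕏 s' ⟨c, rfl, h1, h2⟩
    exact hQ 𝕏 c h1 h2

/-- All blocks enter the single super-block `σ r` of each label, so `sup r` is constant. -/
theorem wp_createInitialBlocks [Nonempty V] [Fintype R] [DecidableEq V] [DecidableEq R]
    {eqv : V → V → Prop} {𝕏 : List (List V)} (h : AreClasses eqv 𝕏) (he : Equivalence eqv)
    (hnd : 𝕏.flatten.Nodup) (hmem : ∀ x, x ∈ 𝕏.flatten) {σ : R → ℕ} {s : Store V R}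
    (hwf : SuperWF (fun r i => i = σ r) (fun _ _ _ => False) s.superBlock s.Q s.fresh)
    (hP : s.P = []) {Q : PUnit → Store V R → Prop}
    (hQ : ∀ vb bm sbm Qm c P fr, s.fresh ≤ fr →
      BlocksWF True (fun _ => none) 0 [] (fun r _ => σ r) { s with
        vertexBlock := vb, block := bm, superBlock := sbm, Q := Qm, choices := c, P := P,
        fresh := fr } → (∀ x x', vb x = vb x' ↔ eqv x x') →
      Q ⟨⟩ { s with
        vertexBlock := vb, block := bm, superBlock := sbm, Q := Qm, choices := c, P := P,
        fresh := fr }) :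
    wp (forIn 𝕏 PUnit.unit fun X _ => do
      Block.new X fun r => some (σ r)
      pure (ForInStep.yield PUnit.unit)) Q s := by
  refine wp_forIn (fun pre _ s' => ∃ vb bm sbm Qm c P fr, s' = { s with
      vertexBlock := vb, block := bm, superBlock := sbm, Q := Qm, choices := c, P := P,
      fresh := fr } ∧ s.fresh ≤ fr ∧ P.Nodup ∧ (∀ b ∈ P, b < fr) ∧
      (∀ x ∈ pre.flatten, ∃ b ∈ P, vb x = some b) ∧
      (∀ b ∈ P, ∃ X ∈ pre, bm b = some ⟨X, fun r => some (σ r), ∅⟩ ∧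
        ∀ x ∈ pre.flatten, vb x = some b ↔ x ∈ X) ∧
      SuperWF (fun r i => i = σ r) (fun r i b => i = σ r ∧ b ∈ P) sbm Qm fr) ?_ ?_ ?_
  · refine ⟨_, _, _, _, _, _, _, rfl, le_rfl, by simp [hP], by simp [hP], by simp, by simp [hP], ?_⟩
    exact hwf.mono (fun _ _ => Iff.rfl) (by simp [hP]) le_rfl
  · rintro pre X suf _ s' hl ⟨vb, bm, sbm, Qm, c, P, fr, rfl, hfr, h1, h2, h3, h4, h5⟩
    have hdisj : ∀ x ∈ pre.flatten, x ∉ X := by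
      intro x hx hxX
      rw [hl, List.flatten_append, List.flatten_cons] at hnd
      exact (List.disjoint_of_nodup_append hnd) hx (by simp [hxX])
    rw [wp_bind]
    refine wp_newBlock h5 (fun _ => rfl) ?_ ?_
    · rintro r i - ⟨-, hb⟩
      exact lt_irrefl _ (h2 _ hb)
    · intro sbm' Qm' c' P' hP' hwf'
      rw [wp_pure]
      refine ⟨⟨⟩, rfl, _, _, _, _, _, _, _, rfl, Nat.le_succ_of_le hfr, ?_, ?_, ?_, ?_, ?_⟩
      · exact hP'.nodup_iff.2 (List.nodup_cons.2 ⟨fun hf => lt_irrefl _ (h2 _ hf), h1⟩)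
      · intro b hb
        rcases List.mem_cons.1 (hP'.mem_iff.1 hb) with rfl | hb
        · exact Nat.lt_succ_self _
        · exact Nat.lt_succ_of_lt (h2 b hb)
      · intro x hx
        dsimp only
        split_ifs with hxX
        · exact ⟨fr, hP'.mem_iff.2 (by simp), rfl⟩
        · obtain ⟨b, hb, hxb⟩ := h3 x (by simpa [hxX] using hx)
          exact ⟨b, hP'.mem_iff.2 (by simp [hb]), hxb⟩
      · intro b hb
        rcases List.mem_cons.1 (hP'.mem_iff.1 hb) with rfl | hb
        · refine ⟨X, by simp, Function.update_self _ _ _, fun x hx => ?_⟩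
          dsimp only
          split_ifs with hxX
          · simp [hxX]
          · obtain ⟨b', hb', hxb⟩ := h3 x (by simpa [hxX] using hx)
            simp only [hxX, iff_false, hxb, Option.some.injEq]
            exact (h2 b' hb').ne
        · obtain ⟨Y, hY, hbY, hvY⟩ := h4 b hb
          have hbf : b ≠ fr := (h2 b hb).ne
          refine ⟨Y, by simp [hY], by simp [hbf, hbY], fun x hx => ?_⟩
          dsimp only
          split_ifs with hxX
          · refine iff_of_false (by simpa using hbf.symm) fun hxY => ?_
            exact hdisj x (List.mem_flatten.2 ⟨Y, hY, hxY⟩) hxX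
          · exact hvY x (by simpa [hxX] using hx)
      · refine hwf'.mono (fun _ _ => Iff.rfl) (fun r i b _ => ?_) le_rfl
        rw [hP'.mem_iff, List.mem_cons]
        dsimp only
        tauto
  · rintro _ s' ⟨vb, bm, sbm, Qm, c, P, fr, rfl, hfr, h1, h2, h3, h4, h5⟩
    refine hQ vb bm sbm Qm c P fr hfr ⟨h1, h2, fun x => h3 x (hmem x), ?_, ?_⟩ ?_
    · intro b hb
      obtain ⟨X, hX, hbX, hvX⟩ := h4 b hb
      have hXnd : X.Nodup := (List.nodup_flatten.1 hnd).1 X hX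
      obtain ⟨x, hx⟩ := List.exists_mem_of_ne_nil _ (h.ne_nil X hX)
      refine ⟨_, hbX, ⟨none, fun _ => rfl, ⟨x, (hvX x (hmem x)).2 hx⟩, hXnd, fun x => ?_, ?_, ?_⟩,
        fun _ _ _ => rfl⟩
      · simpa using (hvX x (hmem x)).symm
      · simp
      · exact fun _ _ hc => absurd rfl hc
    · refine h5.mono (fun r i => ?_) (fun r i b _ => ?_) le_rfl
      -- A vertex must exist here: `BlocksWF` recognizes super-blocks only as values of `sup r`.
      · rw [exists_const, eq_comm]
      · constructor
        · rintro ⟨rfl, hb⟩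
          obtain ⟨X, hX, hbX, hvX⟩ := h4 b hb
          obtain ⟨x, hx⟩ := List.exists_mem_of_ne_nil _ (h.ne_nil X hX)
          exact ⟨x, (hvX x (hmem x)).2 hx, rfl⟩
        · rintro ⟨x, hx, rfl⟩
          obtain ⟨b', hb', hxb⟩ := h3 x (hmem x)
          obtain rfl : b' = b := Option.some.inj (hxb.symm.trans hx)
          exact ⟨rfl, hb'⟩
    · intro x x'
      obtain ⟨b, hb, hxb⟩ := h3 x (hmem x)
      obtain ⟨X, hX, hbX, hvX⟩ := h4 b hb
      have hxX := (hvX x (hmem x)).1 hxb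
      constructor
      · intro hxx
        exact h.rel X hX x hxX x' ((hvX x' (hmem x')).1 (hxx ▸ hxb))
      · intro hxx
        obtain ⟨b', hb', hxb'⟩ := h3 x' (hmem x')
        obtain ⟨X', hX', hbX', hvX'⟩ := h4 b' hb'
        have hxX' := (hvX' x' (hmem x')).1 hxb'
        have hXX : X = X' := by
          by_contra hne
          -- Symmetry turns the ordered condition in `Pairwise` into one for any two different
          -- lists.
          have : Std.Symm fun X Y : List V => ∀ x ∈ X, ∀ y ∈ Y, ¬ eqv x y :=
            ⟨fun Y Y' hY y hy y' hy' hc => hY y' hy' y hy (he.symm hc)⟩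
          exact h.pairwise.forall hX hX' hne x hxX x' hxX' hxx
        rw [hxb, ← (hvX x' (hmem x')).2 (hXX ▸ hxX')]

end SCompCB

/-! ### The invariant after initialization. -/

namespace SCompCB

variable {V S R : Type}

/-- With constant `sup r`, the block-edge of `(x, r)` holds the counts of all `r`-edges from `x`.
Equal labels and maps thus give stability, and s-bisimilar vertices have both in common. -/
theorem wp_sInitialize [Fintype V] [Nonempty V] [Fintype R] [DecidableEq V] [DecidableEq R]
    (G : FuzzyGraph V S R) {Z : V → V → Prop} (hZ : G.IsSBisimulation Z) (c : ℕ → ℕ) :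
    wp (sInitialize G) (fun _ s => ∃ sup, Inv G Z sup s) (Store.initial V R c) := by
  unfold sInitialize
  rw [wp_bind]
  refine wp_inAnyOrder fun vs c₁ hvs hvsmem => ?_
  rw [wp_bind]
  refine wp_inAnyOrder fun es c₂ hes hesmem => ?_
  have hesG : ∀ e, e ∈ es ↔ e ∈ G.edges := by
    intro e
    rw [hesmem, Finset.mem_filter]
    exact and_iff_right (Finset.mem_univ _)
  rw [wp_bind]
  refine wp_createEdges hes rfl fun em CE c₃ hem hCE hCEmem => ?_
  simp only [wp_bind, wp_modify]
  refine wp_inAnyOrder fun rs c₄ hrs hrsmem => ?_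
  refine wp_createSuperBlocks hrs (fun r => (hrsmem r).2 (Finset.mem_univ r))
    fun σ sbm Qm c₅ fr hwf => ?_
  refine wp_inAnyOrder fun xs c₆ hxs hxsmem => ?_
  refine wp_createBlockEdges (fun x => (hxsmem x).2 (Finset.mem_univ x))
    fun β bm fr' hfr hβ hβlt hbm => ?_
  refine wp_pushEdges hes hem hβ hbm fun em' bm' hem' hbm' => ?_
  rw [wp_get]
  choose mp hmp hmprep using hbm'
  have hsets : ∀ x r, {e | e ∈ es ∧ (e.origin, e.label) = (x, r)} =
      G.edgesInto (fun r _ => σ r) x r (σ r) := by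
    intro x r
    ext e
    simp only [FuzzyGraph.edgesInto, Set.mem_ofPred_eq, hesG, Prod.mk.injEq]
    constructor
    · rintro ⟨h1, h2, h3⟩
      exact ⟨h1, h2, h3, trivial⟩
    · rintro ⟨h1, h2, h3, -⟩
      exact ⟨h1, h2, h3⟩
  have hmap : ∀ x x' r, mp (x, r) = mp (x', r) ↔ ∀ d,
      G.count (fun r _ => σ r) x r (σ r) d = G.count (fun r _ => σ r) x' r (σ r) d := by
    intro x x' r
    have h1 := hmprep (x, r)
    have h2 := hmprep (x', r)
    rw [hsets] at h1 h2
    exact h1.eq_iff h2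
  have hmapOf : ∀ x r, ((some (β (x, r))).bind fun i => (bm' i).map BlockEdge.map) =
      some (mp (x, r)) := fun x r => by rw [Option.bind_some, hmp (x, r)]; rfl
  dsimp only
  have he : Equivalence fun x x' => G.L x = G.L x' ∧ ∀ r, mp (x, r) = mp (x', r) :=
    ⟨fun x => ⟨rfl, fun _ => rfl⟩, fun h => ⟨h.1.symm, fun r => (h.2 r).symm⟩,
      fun h h' => ⟨h.1.trans h'.1, fun r => (h.2 r).trans (h'.2 r)⟩⟩
  -- The program compares optional maps; every lookup succeeds, so this is a comparison of the maps
  -- themselves.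
  have heqv : (fun x x' => G.L x = G.L x' ∧ ∀ r,
      ((some (β (x, r))).bind fun i => (bm' i).map BlockEdge.map) =
        (some (β (x', r))).bind fun i => (bm' i).map BlockEdge.map) =
      fun x x' => G.L x = G.L x' ∧ ∀ r, mp (x, r) = mp (x', r) := by
    simp only [hmapOf, Option.some.injEq]
  refine wp_classify (heqv ▸ he) fun 𝕏 c₇ h𝕏 hperm => ?_
  rw [heqv] at h𝕏
  refine wp_foldlM_add fun 𝕏' c₈ hp => ?_
  rw [List.nil_append] at hp
  have h𝕏' : AreClasses (fun x x' => G.L x = G.L x' ∧ ∀ r, mp (x, r) = mp (x', r)) 𝕏' :=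
    ⟨fun X hX => h𝕏.ne_nil X (hp.mem_iff.1 hX), fun X hX => h𝕏.rel X (hp.mem_iff.1 hX),
      (hp.pairwise_iff fun h x hx y hy hc => h y hy x hx (he.symm hc)).2 h𝕏.pairwise⟩
  have hflat := hp.flatten.trans hperm
  refine wp_createInitialBlocks h𝕏' he (hflat.nodup_iff.2 hvs)
    (fun x => hflat.mem_iff.2 ((hvsmem x).2 (Finset.mem_univ x)))
    (hwf.mono (fun _ _ => Iff.rfl) (fun _ _ _ _ => Iff.rfl) hfr) rfl
    fun vb bm₂ sbm₂ Qm₂ c₉ P fr₂ hfr₂ hblocks hvb => ?_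
  rw [wp_pure]
  refine ⟨fun r _ => σ r, fun _ => rfl, hCE, fun y e => ?_,
    ⟨fun e => β (e.origin, e.label), ?_, ?_, ?_, ?_⟩, hblocks, ?_, ?_⟩
  · rw [← hesG]
    exact hCEmem y e
  · exact fun e heG => hem' e ((hesG e).2 heG)
  · exact fun e _ => (hβlt _).trans_le hfr₂
  · intro e _ e' _
    rw [hβ.eq_iff, Prod.mk.injEq]
    refine and_congr_right fun _ => ⟨fun h => ⟨h, congrArg σ h⟩, fun h => h.1⟩
  · intro e _
    refine ⟨_, hmp _, ?_⟩
    have := hmprep (e.origin, e.label)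
    simp only [hesG] at this
    simpa only [hβ.eq_iff] using this
  · intro x x' hxx
    obtain ⟨hL, hm⟩ := (hvb x x').1 hxx
    refine ⟨hL, fun r i d => ?_⟩
    -- A number other than `σ r` names no class, and all counts into it are zero.
    by_cases hi : i = σ r
    · rw [hi]
      exact (hmap x x' r).1 (hm r) d
    · have hempty : ∀ x, G.edgesInto (fun r _ => σ r) x r i = ∅ := fun x =>
        Set.eq_empty_of_forall_notMem fun e hee => hi hee.2.2.2.symm
      simp only [FuzzyGraph.count, hempty]
  · intro x x' hxx
    exact (hvb x x').2 ⟨hZ.label_eq x x' hxx, fun r => (hmap x x' r).2 fun d =>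
      hZ.count_eq (fun _ _ _ _ => rfl) hxx r (σ r) d⟩

end SCompCB

/-! ### The largest s-bisimulation, and bijections from equal fibre sizes. -/

namespace FuzzyGraph

variable {V S R : Type} {G : FuzzyGraph V S R}

theorem isSBisimulation_eq [Nonempty V] : G.IsSBisimulation Eq :=
  ⟨⟨Classical.arbitrary V, _, rfl⟩, fun _ _ h => congrArg G.L h, by
    rintro x _ r rfl
    exact ⟨Equiv.refl _, fun _ => ⟨rfl, rfl⟩⟩⟩

theorem IsSBisimulation.flip {Z : V → V → Prop} (h : G.IsSBisimulation Z) :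
    G.IsSBisimulation (Function.swap Z) where
  nonempty := by
    obtain ⟨x, x', hx⟩ := h.nonempty
    exact ⟨x', x, hx⟩
  label_eq x x' hx := (h.label_eq x' x hx).symm
  succs_equiv x x' r hx := by
    obtain ⟨f, hf⟩ := h.succs_equiv x' x r hx
    refine ⟨f.symm, fun y => ?_⟩
    have := hf (f.symm y)
    rw [f.apply_symm_apply] at this
    exact ⟨this.1, this.2.symm⟩

theorem IsSBisimulation.comp {Z Z' : V → V → Prop} (h : G.IsSBisimulation Z)
    (h' : G.IsSBisimulation Z') (hne : ∃ x y, Relation.Comp Z Z' x y) :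
    G.IsSBisimulation (Relation.Comp Z Z') where
  nonempty := hne
  label_eq := by
    rintro x y ⟨z, hxz, hzy⟩
    exact (h.label_eq x z hxz).trans (h'.label_eq z y hzy)
  succs_equiv := by
    rintro x y r ⟨z, hxz, hzy⟩
    obtain ⟨f, hf⟩ := h.succs_equiv x z r hxz
    obtain ⟨g, hg⟩ := h'.succs_equiv z y r hzy
    exact ⟨f.trans g, fun w => ⟨⟨f w, (hf w).1, (hg (f w)).1⟩, (hf w).2.trans (hg (f w)).2⟩⟩

variable (G) in
/-- The union of all s-bisimulations. -/
def bisimilar (x x' : V) : Prop := ∃ Z, G.IsSBisimulation Z ∧ Z x x'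

theorem isLargestSBisimulation_bisimilar [Nonempty V] : G.IsLargestSBisimulation G.bisimilar := by
  refine ⟨⟨?_, ?_, ?_⟩, fun Z hZ x x' h => ⟨Z, hZ, h⟩⟩
  · exact ⟨Classical.arbitrary V, _, Eq, isSBisimulation_eq, rfl⟩
  · rintro x x' ⟨Z, hZ, h⟩
    exact hZ.label_eq x x' h
  · rintro x x' r ⟨Z, hZ, h⟩
    obtain ⟨f, hf⟩ := hZ.succs_equiv x x' r h
    exact ⟨f, fun y => ⟨⟨Z, hZ, (hf y).1⟩, (hf y).2⟩⟩

theorem equivalence_bisimilar [Nonempty V] : Equivalence G.bisimilar where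
  refl x := ⟨Eq, isSBisimulation_eq, rfl⟩
  symm := by
    rintro x y ⟨Z, hZ, h⟩
    exact ⟨_, hZ.flip, h⟩
  trans := by
    rintro x y z ⟨Z, hZ, h⟩ ⟨Z', hZ', h'⟩
    exact ⟨_, hZ.comp hZ' ⟨x, z, y, h, h'⟩, y, h, h'⟩

/-- An edge is determined by its destination once origin and label are fixed, so counts are sizes of
fibres of the successors over pairs of class and degree. -/
theorem card_succs_fiber (sup : R → V → ℕ) (x : V) (r : R) (i : ℕ) (d : unitInterval) :
    Nat.card {y : G.succs x r // (sup r y, G.E x r y) = (i, d)} = G.count sup x r i d := by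
  refine Nat.card_congr ⟨fun y => ⟨(x, r, y.1.1), ?_⟩, fun e => ⟨⟨e.1.dest, ?_⟩, ?_⟩, ?_, ?_⟩
  · obtain ⟨⟨y, hy⟩, h⟩ := y
    exact ⟨⟨hy, rfl, rfl, congrArg Prod.fst h⟩, congrArg Prod.snd h⟩
  · obtain ⟨⟨x', r', y⟩, ⟨h1, h2, h3, h4⟩, h5⟩ := e
    obtain rfl : x' = x := h2
    obtain rfl : r' = r := h3
    exact h1
  · obtain ⟨⟨x', r', y⟩, ⟨h1, h2, h3, h4⟩, h5⟩ := e
    obtain rfl : x' = x := h2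
    obtain rfl : r' = r := h3
    exact Prod.ext h4 h5
  · intro y
    rfl
  · rintro ⟨⟨x', r', y⟩, ⟨h1, h2, h3, h4⟩, h5⟩
    obtain rfl : x' = x := h2
    obtain rfl : r' = r := h3
    rfl

/-- Each type is the disjoint union of its fibres; bijections chosen fibre by fibre are glued
together. -/
theorem exists_equiv_of_card_fiber_eq {A B C : Type} [Finite A] [Finite B] (f : A → C) (g : B → C)
    (h : ∀ c, Nat.card {a // f a = c} = Nat.card {b // g b = c}) :
    ∃ e : A ≃ B, ∀ a, g (e a) = f a := by
  have e : ∀ c, {a // f a = c} ≃ {b // g b = c} := fun c => (Finite.card_eq.1 (h c)).some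
  refine ⟨((Equiv.sigmaFiberEquiv f).symm.trans (Equiv.sigmaCongrRight e)).trans
    (Equiv.sigmaFiberEquiv g), fun a => ?_⟩
  exact (e (f a) ⟨a, rfl⟩).2

end FuzzyGraph

/-! ### The final partition as an s-bisimulation, and the returned lists. -/

namespace SCompCB

variable {V S R : Type} {G : FuzzyGraph V S R} {Z : V → V → Prop} {sup : R → V → ℕ}
  {s : Store V R}

/-- The super-partition of label `r` has no compound super-block. -/
def NoCompound (s : Store V R) (r : R) : Prop :=
  ∃ q, s.Q r = some q ∧ q.compoundSuperBlocks = []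

theorem Inv.with_choices (h : Inv G Z sup s) (c : ℕ → ℕ) : Inv G Z sup { s with choices := c } :=
  ⟨h.processed, h.coming_nodup, h.mem_coming, h.edges,
    h.blocks.congr rfl rfl rfl rfl rfl le_rfl, h.stable, h.coarse⟩

/-- Without compound super-blocks, vertices in one super-block are in one block. Stability then
gives equal fibre sizes over pairs of block and degree, and these glue to the required bijections.
-/
theorem Inv.isSBisimulation [Nonempty V] [Finite V] (h : Inv G Z sup s)
    (hc : ∀ r, NoCompound s r) :
    G.IsSBisimulation fun x x' => s.vertexBlock x = s.vertexBlock x' := by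
  refine ⟨⟨Classical.arbitrary V, _, rfl⟩, fun x x' hxx => (h.stable x x' hxx).1,
    fun x x' r hxx => ?_⟩
  have hinj : ∀ y y', sup r y = sup r y' → s.vertexBlock y = s.vertexBlock y' := by
    intro y y' hyy
    obtain ⟨q, hq, -, -, hids⟩ := h.blocks.super r
    obtain ⟨q', hq', hnil⟩ := hc r
    obtain rfl := Option.some.inj (hq.symm.trans hq')
    obtain ⟨-, bs, -, hnd, hmem, hlen⟩ := hids (sup r y) ⟨y, rfl⟩
    rw [hnil] at hlen
    have hlen : ¬ 1 < bs.length := fun hl => List.not_mem_nil (hlen.2 hl)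
    obtain ⟨b, -, hb⟩ := h.blocks.vertexBlock y
    obtain ⟨b', -, hb'⟩ := h.blocks.vertexBlock y'
    have h1 := (hmem b).2 ⟨y, hb, rfl⟩
    have h2 := (hmem b').2 ⟨y', hb', hyy.symm⟩
    obtain ⟨n, hn, rfl⟩ := List.mem_iff_getElem.1 h1
    obtain ⟨m, hm, rfl⟩ := List.mem_iff_getElem.1 h2
    -- The super-block lists at most one block, so both indices are 0.
    obtain rfl : n = m := by omega
    rw [hb, hb']
  obtain ⟨e, he⟩ := FuzzyGraph.exists_equiv_of_card_fiber_eq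
    (fun y : G.succs x r => (sup r y, G.E x r y)) (fun y : G.succs x' r => (sup r y, G.E x' r y))
    fun ⟨i, d⟩ => by
      rw [FuzzyGraph.card_succs_fiber, FuzzyGraph.card_succs_fiber, (h.stable x x' hxx).2]
  exact ⟨e, fun y => ⟨hinj _ _ (congrArg Prod.fst (he y)).symm, (congrArg Prod.snd (he y)).symm⟩⟩

theorem wp_returnP {Z : V → V → Prop} (hZ : Equivalence Z) (h : Inv G Z sup s)
    (hvb : ∀ x x', Z x x' ↔ s.vertexBlock x = s.vertexBlock x') :
    wp returnP (fun out _ => ListsPartition out (Setoid.classes ⟨Z, hZ⟩)) s := by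
  -- Reading the blocks leaves the memory unchanged; `Forall₂` keeps track of which list belongs to
  -- which block.
  have hmap : ∀ bs : List ℕ, (∀ b ∈ bs, b ∈ s.P) →
      ∃ out, List.Forall₂ (fun b X => X.Nodup ∧ ∀ x, x ∈ X ↔ s.vertexBlock x = some b) bs out ∧
        (bs.mapM fun b => do pure (← getBlock b).vertices : Prog V R (List (List V))) s =
          some (out, s) := by
    intro bs
    induction bs with
    | nil => exact fun _ => ⟨[], .nil, rfl⟩
    | cons b bs ih =>
      intro hbs
      obtain ⟨out, hout, hrun⟩ := ih fun b hb => hbs b (by simp [hb])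
      obtain ⟨B, hB, hnd, hmem⟩ := h.block_vertices (hbs b (by simp))
      refine ⟨B.vertices :: out, .cons ⟨hnd, hmem⟩ hout, ?_⟩
      have : wp ((b :: bs).mapM fun b => do pure (← getBlock b).vertices : Prog V R (List (List V)))
          (fun out' s' => out' = B.vertices :: out ∧ s' = s) s := by
        rw [List.mapM_cons]
        simp only [wp_bind, wp_getBlock, wp_pure]
        exact ⟨B, hB, out, s, hrun, rfl, rfl⟩
      obtain ⟨_, _, h1, rfl, rfl⟩ := this
      exact h1
  obtain ⟨out, hout, hrun⟩ := hmap s.P fun _ hb => hb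
  refine ⟨out, s, hrun, ?_, ?_, ?_⟩
  · intro X hX
    obtain ⟨n, hn, rfl⟩ := List.mem_iff_getElem.1 hX
    exact (hout.get (by rw [hout.length_eq]; exact hn) hn).1
  · have hne : ∀ b ∈ s.P, ∃ x, s.vertexBlock x = some b := by
      intro b hb
      obtain ⟨B, -, ⟨κ₀, -, hsh⟩, -⟩ := h.blocks.block b hb
      exact hsh.nonempty
    have hnd := h.blocks.nodup
    clear hrun hmap
    generalize s.P = bs at hout hne hnd
    induction hout with
    | nil => simp
    | @cons b X bs out hX hout ih =>
      rw [List.nodup_cons] at hnd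
      rw [List.map_cons, List.nodup_cons]
      refine ⟨fun hmem => ?_, ih (fun b hb => hne b (by simp [hb])) hnd.2⟩
      obtain ⟨Y, hY, hYX⟩ := List.mem_map.1 hmem
      obtain ⟨n, hn, rfl⟩ := List.mem_iff_getElem.1 hY
      have hn' : n < bs.length := by rw [hout.length_eq]; exact hn
      have hY' := hout.get hn' hn
      -- Blocks are non-empty, and a vertex has only one block; so two references with the same set
      -- of vertices coincide.
      obtain ⟨x, hx⟩ := hne b (by simp)
      have hxY : x ∈ out[n] := (Set.ext_iff.1 hYX x).2 ((hX.2 x).2 hx)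
      have := Option.some.inj (hx.symm.trans ((hY'.2 x).1 hxY))
      exact hnd.1 (this ▸ List.getElem_mem hn')
  · have hclass : ∀ n (hn : n < out.length) x, x ∈ out[n] →
        {y | Z y x} = {y | y ∈ out[n]} := by
      intro n hn x hx
      have hX := (hout.get (by rw [hout.length_eq]; exact hn) hn).2
      ext y
      change Z y x ↔ y ∈ out[n]
      have hx' := (hX x).1 hx
      rw [hvb, hx']
      exact (hX y).symm
    ext B
    constructor
    · rintro ⟨X, hX, rfl⟩
      obtain ⟨n, hn, rfl⟩ := List.mem_iff_getElem.1 hX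
      have hn' : n < s.P.length := by rw [hout.length_eq]; exact hn
      obtain ⟨B, -, ⟨κ₀, -, hsh⟩, -⟩ := h.blocks.block _ (List.getElem_mem hn')
      obtain ⟨x, hx⟩ := hsh.nonempty
      exact ⟨x, (hclass n hn x (((hout.get hn' hn).2 x).2 hx)).symm⟩
    · rintro ⟨x, rfl⟩
      obtain ⟨b, hb, hxb⟩ := h.blocks.vertexBlock x
      obtain ⟨n, hn', rfl⟩ := List.mem_iff_getElem.1 hb
      have hn : n < out.length := by rw [← hout.length_eq]; exact hn'
      exact ⟨out[n], List.getElem_mem hn, hclass n hn x (((hout.get hn' hn).2 x).2 hxb)⟩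

end SCompCB

/-! ### Termination and total correctness. -/

namespace SCompCB

variable {V S R : Type} {G : FuzzyGraph V S R} {Z : V → V → Prop} {sup : R → V → ℕ}
  {s : Store V R}

/-- The sizes are irrelevant for correctness. What a split needs is only that the super-block has
another block besides the chosen one. -/
theorem wp_smallerBlock {i : ℕ} {r : R} {bs : List ℕ} (hi : s.superBlock i = some ⟨bs, r⟩)
    (hlen : 1 < bs.length) (hnd : bs.Nodup) (hbs : ∀ b ∈ bs, ∃ B, s.block b = some B)
    {Q : ℕ → Store V R → Prop}
    (hQ : ∀ b b' c, b ∈ bs → b' ∈ bs → b' ≠ b → Q b { s with choices := c }) :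
    wp (SuperBlock.smallerBlock i) Q s := by
  match bs, hlen with
  | b₁ :: b₂ :: bs, _ =>
    have hne : b₁ ≠ b₂ := fun h => (List.nodup_cons.1 hnd).1 (by simp [h])
    obtain ⟨B₁, hB₁⟩ := hbs b₁ (by simp)
    obtain ⟨B₂, hB₂⟩ := hbs b₂ (by simp)
    have h₁ : ∀ c, Q b₁ { s with choices := c } := fun c =>
      hQ b₁ b₂ c (by simp) (by simp) hne.symm
    have h₂ : ∀ c, Q b₂ { s with choices := c } := fun c =>
      hQ b₂ b₁ c (by simp) (by simp) hne
    simp only [SuperBlock.smallerBlock, wp_bind, wp_getSuperBlock]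
    refine ⟨_, hi, ?_⟩
    simp only [wp_bind, wp_getBlock]
    refine ⟨B₁, hB₁, B₂, hB₂, ?_⟩
    rw [wp_ite]
    refine ⟨fun _ => wp_pure.2 (h₁ s.choices), fun _ => ?_⟩
    rw [wp_ite]
    refine ⟨fun _ => wp_pure.2 (h₂ s.choices), fun _ => ?_⟩
    rw [wp_bind]
    refine wp_chooseUpTo fun k c _ => ?_
    rw [wp_ite]
    exact ⟨fun _ => wp_pure.2 (h₁ c), fun _ => wp_pure.2 (h₂ c)⟩

/-- The blocks of a super-block are distinct members of `P`. Hence the early return satisfies the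
same final condition as the loops. -/
theorem Inv.noCompound_of_length_eq_one (h : Inv G Z sup s) (hP : s.P.length = 1) (r : R) :
    NoCompound s r := by
  obtain ⟨q, hq, -, hids, hsup⟩ := h.blocks.super r
  refine ⟨q, hq, List.eq_nil_iff_forall_not_mem.2 fun i hi => ?_⟩
  obtain ⟨-, bs, -, hnd, hmem, hlen⟩ := hsup i ((hids i).1 (List.mem_append_left _ hi))
  have hle : bs.length ≤ s.P.length := (hnd.subperm fun b hb => by
    obtain ⟨x, hx, -⟩ := (hmem b).1 hb
    exact h.blocks.mem_P hx).length_le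
  have := hlen.1 hi
  omega

variable [Fintype V] [Fintype R]

/-- The invariant together with a bound `n` for the number of splits to come. -/
def InvBound (G : FuzzyGraph V S R) (Z : V → V → Prop) (n : ℕ) (s : Store V R) : Prop :=
  ∃ sup, Inv G Z sup s ∧ n + ∑ r, (Finset.univ.image (sup r)).card =
    Fintype.card R * Fintype.card V

theorem sum_card_image_le (sup : R → V → ℕ) :
    ∑ r, (Finset.univ.image (sup r)).card ≤ Fintype.card R * Fintype.card V := by
  rw [← smul_eq_mul]
  exact Finset.sum_le_card_nsmul _ _ _ fun r _ => Finset.card_image_le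

theorem Inv.invBound (h : Inv G Z sup s) :
    ∃ n ≤ Fintype.card R * Fintype.card V, InvBound G Z n s :=
  ⟨_, Nat.sub_le _ _, sup, h, Nat.sub_add_cancel (sum_card_image_le sup)⟩

theorem InvBound.le {n : ℕ} (h : InvBound G Z n s) : n ≤ Fintype.card R * Fintype.card V := by
  obtain ⟨sup, -, hn⟩ := h
  omega

variable [DecidableEq R]

/-- A split adds the new class `f` and destroys none, since the class of the separated block also
contains `x₁`. -/
theorem sum_card_image_separate {vb : V → Option ℕ} {b : ℕ} {r : R} {f : ℕ}
    (hf : ∀ x, sup r x < f) (hvb : ∀ x x', vb x = vb x' → sup r x = sup r x') {x₀ x₁ : V}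
    (hx₀ : vb x₀ = some b) (hx₁ : vb x₁ ≠ some b) (heq : sup r x₁ = sup r x₀) :
    ∑ r, (Finset.univ.image (sup r)).card <
      ∑ r', (Finset.univ.image (separate sup vb b r f r')).card := by
  have hsub : Finset.univ.image (sup r) ⊂ Finset.univ.image (separate sup vb b r f r) := by
    refine (Finset.ssubset_iff_of_subset fun j hj => ?_).2 ⟨f, ?_, ?_⟩
    · obtain ⟨x, -, rfl⟩ := Finset.mem_image.1 hj
      by_cases hx : vb x = some b
      -- The old class of a vertex in `b` is still attained, namely at `x₁`.
      · rw [hvb x x₀ (hx.trans hx₀.symm), ← heq, ← separate_of_notMem (sup := sup) (r := r) (f := f) (r' := r) hx₁]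
        exact Finset.mem_image_of_mem _ (Finset.mem_univ _)
      · rw [← separate_of_notMem (sup := sup) (r := r) (f := f) (r' := r) hx]
        exact Finset.mem_image_of_mem _ (Finset.mem_univ _)
    · exact Finset.mem_image.2 ⟨x₀, Finset.mem_univ _, separate_of_mem hx₀⟩
    · intro hc
      obtain ⟨x, -, hx⟩ := Finset.mem_image.1 hc
      exact (hf x).ne hx
  refine Finset.sum_lt_sum (fun r' _ => ?_) ⟨r, Finset.mem_univ r, Finset.card_lt_card hsub⟩
  by_cases hr : r' = r
  · rw [hr]
    exact Finset.card_le_card hsub.1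
  · rw [funext (separate_of_ne (sup := sup) (vb := vb) (b := b) (f := f) hr)]

variable [DecidableEq V]

/-- If nothing was split, the memory is literally the same. This is what lets the outer loop
conclude that labels treated earlier in the pass still have no compound super-block. -/
theorem wp_refineLoop (hZ : G.IsSBisimulation Z) {n bound : ℕ} (h : InvBound G Z n s)
    (hn : n < bound) (r : R) (changed : Bool) :
    wp (refineLoop bound r changed) (fun changed' s' => NoCompound s' r ∧
      ((changed' = true ∧ ∃ m < n, InvBound G Z m s') ∨ (changed' = changed ∧ s' = s))) s := by
  refine wp_whileLoop (fun k b s' => InvBound G Z k s' ∧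
    ((b = true ∧ k < n) ∨ (b = changed ∧ s' = s ∧ k = n))) ?_ ⟨h, .inr ⟨rfl, rfl, rfl⟩⟩ hn
  rintro k b s' ⟨⟨sup, hI, hk⟩, hb⟩
  obtain ⟨q, hq, -, hids, hsup⟩ := hI.blocks.super r
  simp only [wp_bind, wp_getSuperPartition, wp_pure]
  refine ⟨q, hq, ?_⟩
  cases hcomp : q.compoundSuperBlocks with
  | nil =>
    simp only [List.isEmpty_nil, Bool.not_true, Bool.false_eq_true, if_false]
    refine ⟨⟨q, hq, hcomp⟩, ?_⟩
    rcases hb with ⟨hb, hkn⟩ | ⟨hb, hs, -⟩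
    · exact .inl ⟨hb, k, hkn, sup, hI, hk⟩
    · exact .inr ⟨hb, hs⟩
  | cons i l =>
    simp only [List.isEmpty_cons, Bool.not_false, if_true, wp_deref]
    refine ⟨q, hq, i, by rw [hcomp]; rfl, ?_⟩
    have hi : i ∈ q.compoundSuperBlocks := by simp [hcomp]
    obtain ⟨-, bs, hbs, hnd, hmem, hlen⟩ :=
      hsup i ((hids i).1 (List.mem_append_left _ hi))
    refine wp_smallerBlock hbs (hlen.1 hi) hnd ?_ fun b₀ b₁ c hb₀ hb₁ hne => ?_
    · intro b hb
      obtain ⟨x, hx, -⟩ := (hmem b).1 hb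
      obtain ⟨B, hB, -⟩ := hI.block_vertices (hI.blocks.mem_P hx)
      exact ⟨B, hB⟩
    · obtain ⟨x₀, hx₀, hi₀⟩ := (hmem b₀).1 hb₀
      obtain ⟨x₁, hx₁, hi₁⟩ := (hmem b₁).1 hb₁
      have hx₁b : s'.vertexBlock x₁ ≠ some b₀ := by simpa [hx₁] using hne
      refine wp_mono (wp_sSplit hZ (hI.with_choices c) hx₀ hi₀ hi₁ hx₁b) ?_
      rintro _ s'' ⟨f, hf, hI'⟩
      have hlt := sum_card_image_separate (vb := s'.vertexBlock) (f := f)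
        (fun x => (hI.blocks.super.lt ⟨x, rfl⟩).trans_le hf)
        (fun x x' hxx => hI.blocks.sup_eq hxx r) hx₀ hx₁b (hi₁.trans hi₀.symm)
      have hle := sum_card_image_le (separate sup s'.vertexBlock b₀ r f)
      refine ⟨Fintype.card R * Fintype.card V -
        ∑ r', (Finset.univ.image (separate sup s'.vertexBlock b₀ r f r')).card, by omega,
        ⟨_, hI', Nat.sub_add_cancel hle⟩, .inl ⟨trivial, by omega⟩⟩

/-- The variant is `2 * n` plus one if `changed` holds. A pass with a split lowers `n`; a pass
without one lowers only the flag, and then no label has a compound super-block. -/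
theorem wp_mainLoop (hZ : G.IsSBisimulation Z) {n bound : ℕ} (h : InvBound G Z n s)
    (hbound : 2 * (Fintype.card R * Fintype.card V) + 1 < bound) :
    wp (mainLoop bound) (fun _ s' => (∃ sup, Inv G Z sup s') ∧ ∀ r, NoCompound s' r) s := by
  have hn := h.le
  refine wp_whileLoop (n := 2 * n + 1) (fun k b s' => ∃ n, InvBound G Z n s' ∧
    (b = false → ∀ r, NoCompound s' r) ∧ k = 2 * n + b.toNat) ?_ ⟨n, h, by simp, by simp⟩ (by omega)
  rintro k b s' ⟨n, hI, hb, rfl⟩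
  rw [wp_pure]
  cases b with
  | false =>
    obtain ⟨sup, hI, -⟩ := hI
    exact ⟨⟨sup, hI⟩, hb rfl⟩
  | true =>
    have hn := hI.le
    simp only [if_true, wp_bind]
    refine wp_inAnyOrder fun rs c _ hrs => ?_
    refine wp_forIn (fun pre ch s'' => (ch = true ∧ ∃ m < n, InvBound G Z m s'') ∨
      (ch = false ∧ InvBound G Z n s'' ∧ ∀ r ∈ pre, NoCompound s'' r)) ?_ ?_ ?_
    · obtain ⟨sup, hI, hn⟩ := hI
      exact .inr ⟨rfl, ⟨sup, hI.with_choices c, hn⟩, by simp⟩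
    · rintro pre r suf ch s'' - hJ
      rw [wp_bind]
      rcases hJ with ⟨rfl, m, hm, hI'⟩ | ⟨rfl, hI', hpre⟩
      · refine wp_mono (wp_refineLoop hZ hI' (by omega) r _) ?_
        rintro ch' s₃ ⟨-, hch⟩
        rw [wp_pure]
        refine ⟨_, rfl, .inl ?_⟩
        rcases hch with ⟨h1, m', hm', h2⟩ | ⟨rfl, rfl⟩
        · exact ⟨h1, m', hm'.trans hm, h2⟩
        · exact ⟨rfl, m, hm, hI'⟩
      · refine wp_mono (wp_refineLoop hZ hI' (by omega) r _) ?_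
        rintro ch' s₃ ⟨hr, hch⟩
        rw [wp_pure]
        refine ⟨_, rfl, ?_⟩
        rcases hch with ⟨h1, h2⟩ | ⟨rfl, rfl⟩
        · exact .inl ⟨h1, h2⟩
        · refine .inr ⟨rfl, hI', fun r' hr' => ?_⟩
          rcases List.mem_append.1 hr' with hr' | hr'
          · exact hpre r' hr'
          · exact List.mem_singleton.1 hr' ▸ hr
    · rintro ch s'' (⟨rfl, m, hm, hI'⟩ | ⟨rfl, hI', hpre⟩)
      · rw [wp_pure]
        exact ⟨2 * m + 1, by simp; omega, m, hI', by simp, by simp⟩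
      · rw [wp_pure]
        exact ⟨2 * n, by simp, n, hI',
          fun _ r => hpre r ((hrs r).2 (Finset.mem_univ r)), by simp⟩

/-- The invariant, used with the largest s-bisimulation, gives one inclusion between the two
equivalences; maximality applied to the final partition gives the other. -/
theorem computes_classes [Nonempty V] (hZ : G.IsLargestSBisimulation Z) (he : Equivalence Z) :
    Computes G (Setoid.classes ⟨Z, he⟩) := by
  intro c
  -- The variant of the main loop starts at most at `2 * |R| * |V| + 1`, and the permitted number of
  -- evaluations must exceed it.
  refine ⟨2 * (Fintype.card R * Fintype.card V) + 2, fun bound hbound => ?_⟩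
  change wp (sCompCB2 bound G) (fun out _ => ListsPartition out (Setoid.classes ⟨Z, he⟩)) _
  have hreturn : ∀ {sup : R → V → ℕ} {s : Store V R}, Inv G Z sup s → (∀ r, NoCompound s r) →
      wp returnP (fun out _ => ListsPartition out (Setoid.classes ⟨Z, he⟩)) s := fun hI hc =>
    wp_returnP he hI fun x x' => ⟨hI.coarse x x', hZ.2 _ (hI.isSBisimulation hc) x x'⟩
  rw [sCompCB2, wp_bind]
  refine wp_mono (wp_sInitialize G hZ.1 c) ?_
  rintro _ s ⟨sup, hI⟩
  rw [wp_bind, wp_get, wp_ite]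
  refine ⟨fun hP => hreturn hI (hI.noCompound_of_length_eq_one hP), fun _ => ?_⟩
  obtain ⟨n, -, hn⟩ := hI.invBound
  rw [wp_bind]
  refine wp_mono (wp_mainLoop hZ.1 hn (by omega)) ?_
  rintro _ s' ⟨⟨sup', hI'⟩, hc⟩
  exact hreturn hI' hc

end SCompCB

theorem mainTheorem8 {V S R : Type} [Fintype V] [Nonempty V] [Finite S] [Fintype R]
    [DecidableEq V] [DecidableEq R] (G : FuzzyGraph V S R) :
    ∃ Z : V → V → Prop, G.IsLargestSBisimulation Z ∧
      ∃ hZ : Equivalence Z, SCompCB.Computes G (Setoid.classes ⟨Z, hZ⟩) :=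
  ⟨G.bisimilar, FuzzyGraph.isLargestSBisimulation_bisimilar, FuzzyGraph.equivalence_bisimilar,
    SCompCB.computes_classes FuzzyGraph.isLargestSBisimulation_bisimilar _⟩
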